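/- Let $(A,\mathfrak m)$ be a Cohen–Macaulay local ring of dimension $d$ with infinite residue field, and let $I\subset A$ be an ideal with $\sqrt I=\mathfrak m$. Let $\mathcal R=\mathcal R(I)=\bigoplus_{n\ge 0}I^nt^n\subset A[t]$ be the Rees algebra, $\mathcal R_+=\bigoplus_{n>0}I^nt^n$, $\mathfrak M=\mathfrak m\mathcal R+\mathcal R_+$ its graded maximal ideal, and $G=G(I)=\mathcal R/I\mathcal R=\bigoplus_{n\ge 0}I^n/I^{n+1}$ the associated graded ring. A reduction of $I$ is an ideal $Q\subseteq I$ with $I^{n+1}=QI^n$ for some $n\ge 0$, and a minimal reduction is one that is minimal with respect to inclusion. Call $I$ good if $I^2=QI$ and $Q:I=I$ for some minimal reduction $Q$ of $I$. Let $H^d_{\mathfrak M}(G)$ be the graded local cohomology module (computed by the Čech complex of $G$ on any finite system of homogeneous generators of $\mathfrak M$), let $\mathrm a(G)=\max\{n\in\mathbb Z: [H^d_{\mathfrak M}(G)]_n\neq 0\}$, and let $\mathrm{Soc}(H)=\{h\in H:\mathfrak M h=0\}$. Then the following conditions are equivalent: 1. $I$ is a good ideal; 2. $G$ is a Cohen–Macaulay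 ring, $\mathrm a(G)=1-d$, and $\mathrm{Soc}(H^d_{\mathfrak M}(G))\subseteq[H^d_{\mathfrak M}(G)]_{1-d}$. Moreover, goodness does not depend on the choice of the minimal reduction: for every minimal reduction $Q$ of $I$, the ideal $I$ is good if and only if $I^2=QI$ and $Q:I=I$. -/

import Mathlib

open Polynomial

/-! ### Cohen–Macaulay rings -/

/-- A Noetherian local ring is Cohen–Macaulay if its maximal ideal contains a regular sequence
whose length is the Krull dimension of the ring. -/
def IsCohenMacaulayLocalRing (A : Type*) [CommRing A] [IsLocalRing A] : Prop :=
  IsNoetherianRing A ∧ ∃ rs : List A, (∀ x ∈ rs, x ∈ IsLocalRing.maximalIdeal A) ∧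
    RingTheory.Sequence.IsRegular A rs ∧ (rs.length : WithBot ℕ∞) = ringKrullDim A

/-- A commutative ring is Cohen–Macaulay if it is Noetherian and all its localizations at prime
ideals are Cohen–Macaulay local rings. -/
def IsCohenMacaulayRing (R : Type*) [CommRing R] : Prop :=
  IsNoetherianRing R ∧
    ∀ (p : Ideal R) [p.IsPrime], IsCohenMacaulayLocalRing (Localization.AtPrime p)

/-! ### Reductions and good ideals -/

/-- `Q` is a reduction of `I`: `Q ⊆ I` and `I ^ (n + 1) = Q * I ^ n` for some `n`. -/
def IsReduction {A : Type*} [CommRing A] (Q I : Ideal A) : Prop :=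
  Q ≤ I ∧ ∃ n : ℕ, I ^ (n + 1) = Q * I ^ n

/-- `Q` is a reduction of `I` that is minimal, with respect to inclusion, among the reductions
of `I`. -/
def IsMinimalReduction {A : Type*} [CommRing A] (Q I : Ideal A) : Prop :=
  Minimal (fun J : Ideal A => IsReduction J I) Q

/-- `I` is good: `I² = QI` and `Q : I = I` for some minimal reduction `Q` of `I`. -/
def IsGoodIdeal {A : Type*} [CommRing A] (I : Ideal A) : Prop :=
  ∃ Q : Ideal A, IsMinimalReduction Q I ∧ I ^ 2 = Q * I ∧ Q.colon (I : Set A) = I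

/-! ### The Rees algebra `𝓡(I) = ⨁ Iⁿ tⁿ` and the associated graded ring `G(I) = ⨁ Iⁿ / Iⁿ⁺¹` -/

section Blowup

variable {A : Type*} [CommRing A] (I : Ideal A)

/-- The homogeneous component `Iⁿ tⁿ` of the Rees algebra. -/
noncomputable def reesPiece (n : ℕ) : Submodule A (reesAlgebra I) :=
  (LinearMap.range (Polynomial.monomial (R := A) n)).comap (reesAlgebra I).val.toLinearMap

/-- The ideal `𝓡₊ = ⨁_{n > 0} Iⁿ tⁿ` of the Rees algebra. -/
noncomputable def reesIrrelevant : Ideal (reesAlgebra I) :=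
  Ideal.span {x | ∃ n : ℕ, 0 < n ∧ x ∈ reesPiece I n}

/-- The graded maximal ideal `𝔐 = 𝔪𝓡 + 𝓡₊` of the Rees algebra over a local ring. -/
noncomputable def reesMaximalIdeal [IsLocalRing A] : Ideal (reesAlgebra I) :=
  (IsLocalRing.maximalIdeal A).map (algebraMap A (reesAlgebra I)) ⊔ reesIrrelevant I

/-- The associated graded ring `G(I) = 𝓡(I) / I𝓡(I)`. Since `I𝓡(I) = ⨁ Iⁿ⁺¹ tⁿ`, it is
`⨁ Iⁿ / Iⁿ⁺¹`, the multiplication being induced from that of `A`. -/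
abbrev AssocGradedRing : Type _ :=
  reesAlgebra I ⧸ I.map (algebraMap A (reesAlgebra I))

noncomputable instance : Algebra (reesAlgebra I) (AssocGradedRing I) :=
  Ideal.Quotient.algebra (reesAlgebra I)

noncomputable instance : Module (reesAlgebra I) (AssocGradedRing I) :=
  Algebra.toModule

/-- The homogeneous component `Iⁿ / Iⁿ⁺¹` of `G(I)`: the image of `Iⁿ tⁿ`. -/
noncomputable def assocGradedPiece (n : ℕ) : Submodule A (AssocGradedRing I) :=
  (reesPiece I n).map
    (Ideal.Quotient.mkₐ A (I.map (algebraMap A (reesAlgebra I)))).toLinearMap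

end Blowup

/-! ### Graded local cohomology, through the Čech complex

`R` is an `ℕ`-graded `A`-algebra with components `𝒜 n`, `N` is an `ℕ`-graded `R`-module with
components `𝒩 n`, and `f` is a finite sequence of homogeneous elements of `R`. -/

section Cech

variable {A R : Type*} [CommRing A] [CommRing R] [Algebra A R]
  {r : ℕ} (f : Fin r → R) (N : Type*) [AddCommGroup N] [Module A N] [Module R N]

/-- The multiplicative set generated by the elements `f i`, `i ∈ S`. -/
def cechMonoid (S : Finset (Fin r)) : Submonoid R :=
  Submonoid.closure (f '' (S : Set (Fin r)))

theorem cechMonoid_mono {S T : Finset (Fin r)} (h : S ⊆ T) : cechMonoid f S ≤ cechMonoid f T :=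
  Submonoid.closure_mono (Set.image_mono (by exact_mod_cast h))

/-- The localization of `N` at the product of the elements `f i`, `i ∈ S`. -/
abbrev CechLocalization (S : Finset (Fin r)) : Type _ :=
  LocalizedModule (cechMonoid f S) N

/-- The total module `⨁_S N_{f_S}` of the Čech complex. -/
abbrev CechTotal : Type _ :=
  (S : Finset (Fin r)) → CechLocalization f N S

/-- The Čech differential,
`(d c)_T = ∑_{i ∈ T} (-1) ^ #{j ∈ T | j < i} • (c_{T \ {i}} in the localization at T)`. -/
noncomputable def cechDifferential : CechTotal f N →ₗ[R] CechTotal f N :=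
  LinearMap.pi fun T => ∑ i ∈ T, ((-1 : R) ^ (T.filter (· < i)).card) •
    (LocalizedModule.liftOfLE (M := N) (cechMonoid f (T.erase i)) (cechMonoid f T)
      (cechMonoid_mono f (T.erase_subset i))).comp (LinearMap.proj (T.erase i))

/-- The Čech cochains of degree `p`: families supported on the `S` with `p` elements. -/
def cechCochains (p : ℕ) : Submodule R (CechTotal f N) where
  carrier := {c | ∀ S : Finset (Fin r), S.card ≠ p → c S = 0}
  add_mem' ha hb S hS := by simp [ha S hS, hb S hS]
  zero_mem' S _ := rfl
  smul_mem' a c hc S hS := by simp [hc S hS]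

/-- The Čech cocycles of degree `p`. -/
noncomputable def cechCocycles (p : ℕ) : Submodule R (CechTotal f N) :=
  cechCochains f N p ⊓ LinearMap.ker (cechDifferential f N)

/-- The Čech coboundaries of degree `p`. As the differential raises the cochain degree by one,
these are the differentials of the cochains of degree `p - 1` (and `0` if `p = 0`). -/
noncomputable def cechCoboundaries (p : ℕ) : Submodule R (CechTotal f N) :=
  cechCochains f N p ⊓ LinearMap.range (cechDifferential f N)

/-- The `p`-th local cohomology module of `N` with support in the ideal generated by the `f i`,
as the `p`-th cohomology of the Čech complex. -/
abbrev CechLocalCohomology (p : ℕ) : Type _ :=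
  cechCocycles f N p ⧸ (cechCoboundaries f N p).submoduleOf (cechCocycles f N p)

variable (𝒜 : ℕ → Submodule A R) (𝒩 : ℕ → Submodule A N)

/-- The homogeneous component of degree `n` of the localization `N_{f_S}`: it is generated by the
fractions `m / s` with `m` and `s` homogeneous and `deg m - deg s = n`. -/
def cechLocalizationPiece (S : Finset (Fin r)) (n : ℤ) : AddSubgroup (CechLocalization f N S) :=
  AddSubgroup.closure {x | ∃ (j l : ℕ) (m : N) (s : cechMonoid f S),
    m ∈ 𝒩 j ∧ (s : R) ∈ 𝒜 l ∧ (j : ℤ) - (l : ℤ) = n ∧ x = LocalizedModule.mk m s}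

/-- The homogeneous component of degree `n` of local cohomology: the classes of the cocycles all
of whose entries are homogeneous of degree `n`. -/
noncomputable def cechLocalCohomologyPiece (p : ℕ) (n : ℤ) : AddSubgroup (CechLocalCohomology f N p) :=
  ((AddSubgroup.pi Set.univ fun S => cechLocalizationPiece f N 𝒜 𝒩 S n).comap
      (cechCocycles f N p).subtype.toAddMonoidHom).map
    ((cechCoboundaries f N p).submoduleOf (cechCocycles f N p)).mkQ.toAddMonoidHom

end Cech

/-- The socle `0 :_H 𝔐` of an `R`-module `H`, with respect to a maximal ideal `𝔐` of `R`. -/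
def socle {R : Type*} [CommRing R] (𝔐 : Ideal R) (H : Type*) [AddCommGroup H] [Module R H] :
    Submodule R H :=
  Submodule.torsionBySet R H (𝔐 : Set R)

/-! ### The local cohomology of the associated graded ring -/

section AssocGraded

variable {A : Type*} [CommRing A] (I : Ideal A) {r : ℕ} (f : Fin r → reesAlgebra I)

/-- `H^p_𝔐(G(I))`, for homogeneous generators `f` of `𝔐`. -/
abbrev AssocGradedCohomology (p : ℕ) : Type _ :=
  CechLocalCohomology f (AssocGradedRing I) p

/-- The homogeneous component `[H^p_𝔐(G(I))]_n`. -/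
noncomputable def assocGradedCohomologyPiece (p : ℕ) (n : ℤ) : AddSubgroup (AssocGradedCohomology I f p) :=
  cechLocalCohomologyPiece f (AssocGradedRing I) (reesPiece I) (assocGradedPiece I) p n

/-- The `a`-invariant of `G(I)` is `a`: with `d = dim G(I)`, it is the largest integer `n` with
`[H^d_𝔐(G(I))]_n ≠ 0`. By graded duality, this is `-min {n | [K_{G(I)}]_n ≠ 0}`. -/
def AssocGradedHasAInvariant (d : ℕ) (a : ℤ) : Prop :=
  IsGreatest {n : ℤ | assocGradedCohomologyPiece I f d n ≠ ⊥} a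

end AssocGraded

/-! Let `Q` be a minimal reduction of `I`. Since the residue field is infinite, `Q` is generated by
a regular sequence `a` of length `d`. Suppose that the elements `a i * t` form a regular sequence on
`G`. The connecting maps obtained by dividing out these elements one at a time then compose to an
isomorphism from `G/(at)G` onto the submodule of `H^d` killed by `at`, lowering degrees by `d`
(`exists_socle_map`, `exists_assocGraded_socleMap`). Both conditions of the theorem are read off
from this map.

The components of `G/(at)G` are `A/I`, `I/(Q + I²)`, `I²/(QI + I³)`, and so on. Every nonzero
homogeneous class of `H^d` has a nonzero homogeneous multiple, of no smaller degree, killed by `at`,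
and the socle is killed by `at` too. Vanishing of `H^d` in degree `2 - d` thus gives `I² ⊆ QI + I³`,
which is `I² = QI` by Nakayama. Conversely, if `I² = QI` then `G/(at)G = A/I ⊕ I/Q`, so `H^d`
vanishes above degree `1 - d`. In that case the socle in degree `-d` consists of the classes of `c`
in `A/I` with `𝔪c ⊆ I` and `cI ⊆ Q`. As `A/I` has finite length, no nonzero such class exists
exactly when `Q : I = I`. Since the second condition does not mention `Q`, independence of the
minimal reduction follows.

Two facts make the map available. If `I² = QI`, then `G` is Cohen–Macaulay: over `P = A[T₁, …, T_d]`
there is an exact sequence `0 → P ⊗ A/I → G → P ⊗ I/Q → 0`, by quasi-regularity of `a`, and the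
outer terms are filtered by copies of `k[T]`, so sequences regular on a localization of `k[T]` are
regular on that of `G` (`isCohenMacaulayRing_of_sq`). If `G` is Cohen–Macaulay, then `at` is regular
on it: at the graded maximal ideal `at` is a system of parameters, because analytic independence of
`a` bounds the dimension below by counting monomials, and a graded Nakayama argument removes the
localization (`isWeaklyRegular_reesLinear`).

The supporting theory consists of the Northcott–Rees argument for minimal reductions
(`coeff_mem_maximalIdeal_of_isShortest`) and the regularity of systems of parameters in
Cohen–Macaulay local rings, where depth is measured by vanishing of Čech cohomology
(`isWeaklyRegular_of_isWeaklyRegular`). -/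

/-! ### The Čech complex -/

section CechBasics

open scoped Pointwise

variable {R : Type*} [CommRing R] {r : ℕ} (f : Fin r → R) (N : Type*) [AddCommGroup N] [Module R N]

/-- The restriction map of the Čech complex between two localizations. -/
noncomputable abbrev cechRestrict {S T : Finset (Fin r)} (h : S ⊆ T) :
    CechLocalization f N S →ₗ[R] CechLocalization f N T :=
  LocalizedModule.liftOfLE (M := N) (cechMonoid f S) (cechMonoid f T) (cechMonoid_mono f h)

variable {N}

theorem cechRestrict_mk {S T : Finset (Fin r)} (h : S ⊆ T) (m : N) (s : cechMonoid f S) :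
    cechRestrict f N h (LocalizedModule.mk m s) =
      LocalizedModule.mk m ⟨s.1, cechMonoid_mono f h s.2⟩ := by
  simp only [IsLocalizedModule.mk_eq_mk']
  exact IsLocalizedModule.liftOfLE_mk' _ _ _ _ _ _ _

theorem cechRestrict_comp {S T U : Finset (Fin r)} (h : S ⊆ T) (h' : T ⊆ U)
    (x : CechLocalization f N S) :
    cechRestrict f N h' (cechRestrict f N h x) = cechRestrict f N (h.trans h') x := by
  induction x using LocalizedModule.induction_on with
  | h m s => simp only [cechRestrict_mk]

theorem cechRestrict_congr {S S' T : Finset (Fin r)} (e : S = S') (h : S ⊆ T) (h' : S' ⊆ T)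
    (c : CechTotal f N) : cechRestrict f N h (c S) = cechRestrict f N h' (c S') := by
  subst e; rfl

theorem cechDifferential_apply (c : CechTotal f N) (T : Finset (Fin r)) :
    cechDifferential f N c T = ∑ i ∈ T, ((-1 : R) ^ (T.filter (· < i)).card) •
      cechRestrict f N (T.erase_subset i) (c (T.erase i)) := by
  simp [cechDifferential, LinearMap.sum_apply]

/-- Deleting `j` leaves the elements below `i` untouched, while deleting `i` removes one element
below `j`. The two orders of deletion therefore differ by one sign. -/
theorem cech_sign_antisymm (T : Finset (Fin r)) {i j : Fin r} (hi : i ∈ T) (hij : i < j) :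
    (-1 : R) ^ (T.filter (· < j)).card * (-1) ^ ((T.erase j).filter (· < i)).card =
      -((-1) ^ (T.filter (· < i)).card * (-1) ^ ((T.erase i).filter (· < j)).card) := by
  have h1 : (T.erase j).filter (· < i) = T.filter (· < i) := by
    rw [Finset.filter_erase]
    exact Finset.erase_eq_of_notMem (by simp [hij.le])
  have h2 : ((T.erase i).filter (· < j)).card + 1 = (T.filter (· < j)).card := by
    rw [Finset.filter_erase]
    exact Finset.card_erase_add_one (by simp [hi, hij])
  rw [h1, ← h2]
  ring

theorem cechDifferential_comp_self (c : CechTotal f N) :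
    cechDifferential f N (cechDifferential f N c) = 0 := by
  funext T
  simp only [cechDifferential_apply, map_sum, map_smul, Finset.smul_sum, smul_smul,
    cechRestrict_comp, Pi.zero_apply]
  rw [Finset.sum_sigma']
  -- The terms are indexed by ordered pairs of deleted indices; swapping the pair keeps the
  -- restriction and flips the sign.
  refine Finset.sum_involution (fun x _ => ⟨x.2, x.1⟩) ?_ ?_ ?_ ?_
  · rintro ⟨i, j⟩ h
    simp only [Finset.mem_sigma, Finset.mem_erase] at h
    obtain ⟨hi, hji, hj⟩ := h
    have hc := cechRestrict_congr f (T := T) (Finset.erase_right_comm (s := T) (a := i) (b := j))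
      ((Finset.erase_subset _ _).trans (Finset.erase_subset _ _))
      ((Finset.erase_subset _ _).trans (Finset.erase_subset _ _)) c
    dsimp only
    rw [hc, ← add_smul]
    rcases lt_or_gt_of_ne hji with h | h
    · rw [cech_sign_antisymm (R := R) T hj h, neg_add_cancel, zero_smul]
    · rw [cech_sign_antisymm (R := R) T hi h, add_neg_cancel, zero_smul]
  · rintro ⟨i, j⟩ h _ he
    simp only [Finset.mem_sigma, Finset.mem_erase] at h
    simp only [Sigma.mk.injEq] at he
    exact h.2.1 he.1
  · rintro ⟨i, j⟩ h
    simp only [Finset.mem_sigma, Finset.mem_erase] at h ⊢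
    exact ⟨h.2.2, Ne.symm h.2.1, h.1⟩
  · rintro ⟨i, j⟩ h
    rfl

/-- The projection of the Čech complex onto the cochains of degree `p`. -/
def cechTruncate (p : ℕ) : CechTotal f N →ₗ[R] CechTotal f N where
  toFun c S := if S.card = p then c S else 0
  map_add' a b := by funext S; by_cases h : S.card = p <;> simp [h]
  map_smul' a b := by funext S; by_cases h : S.card = p <;> simp [h]

theorem cechTruncate_mem (p : ℕ) (c : CechTotal f N) : cechTruncate f p c ∈ cechCochains f N p :=
  fun _ h => if_neg h

theorem cechTruncate_eq_self {p : ℕ} {c : CechTotal f N} (h : c ∈ cechCochains f N p) :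
    cechTruncate f p c = c := by
  funext S
  by_cases hS : S.card = p
  · exact if_pos hS
  · exact (if_neg hS).trans (h S hS).symm

/-- All cochain degrees share one total module. This commutation is what allows a primitive of a
cochain of degree `p + 1` to be replaced by its part of degree `p`. -/
theorem cechDifferential_truncate (p : ℕ) (c : CechTotal f N) :
    cechDifferential f N (cechTruncate f p c) = cechTruncate f (p + 1) (cechDifferential f N c) := by
  funext T
  have hc : ∀ i ∈ T, (T.erase i).card = p ↔ T.card = p + 1 := fun i hi => by
    rw [← Finset.card_erase_add_one hi]; omega
  change _ = if T.card = p + 1 then cechDifferential f N c T else 0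
  split_ifs with h
  · rw [cechDifferential_apply, cechDifferential_apply]
    refine Finset.sum_congr rfl fun i hi => ?_
    congr 2
    exact if_pos ((hc i hi).2 h)
  · rw [cechDifferential_apply]
    refine Finset.sum_eq_zero fun i hi => ?_
    have : cechTruncate f p c (T.erase i) = 0 := if_neg fun h' => h ((hc i hi).1 h')
    rw [this, map_zero, smul_zero]

theorem cechDifferential_mem {p : ℕ} {c : CechTotal f N} (h : c ∈ cechCochains f N p) :
    cechDifferential f N c ∈ cechCochains f N (p + 1) := by
  rw [← cechTruncate_eq_self f h, cechDifferential_truncate]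
  exact cechTruncate_mem f _ _

theorem exists_cochain_of_coboundary {p : ℕ} {c : CechTotal f N}
    (h : c ∈ cechCochains f N (p + 1)) (hc : c ∈ LinearMap.range (cechDifferential f N)) :
    ∃ b ∈ cechCochains f N p, cechDifferential f N b = c := by
  obtain ⟨b, rfl⟩ := hc
  exact ⟨cechTruncate f p b, cechTruncate_mem f p b, by
    rw [cechDifferential_truncate, cechTruncate_eq_self f h]⟩

theorem coboundary_zero {c : CechTotal f N} (h : c ∈ cechCochains f N 0)
    (hc : c ∈ LinearMap.range (cechDifferential f N)) : c = 0 := by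
  obtain ⟨b, rfl⟩ := hc
  funext T
  by_cases hT : T.card = 0
  · rw [Finset.card_eq_zero] at hT
    subst hT
    rw [cechDifferential_apply, Finset.sum_empty]; rfl
  · exact h T hT

/-! ### Torsion -/

theorem mem_cechMonoid_of_mem {S : Finset (Fin r)} {i : Fin r} (hi : i ∈ S) :
    f i ∈ cechMonoid f S :=
  Submonoid.subset_closure ⟨i, hi, rfl⟩

theorem exists_of_mem_cechMonoid_insert {S : Finset (Fin r)} {i : Fin r} {s : R}
    (hs : s ∈ cechMonoid f (insert i S)) : ∃ t ∈ cechMonoid f S, ∃ n : ℕ, s = f i ^ n * t := by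
  rw [cechMonoid, Finset.coe_insert, Set.image_insert_eq, Set.insert_eq, Submonoid.closure_union,
    ← Submonoid.powers_eq_closure, Submonoid.mem_sup] at hs
  obtain ⟨y, hy, z, hz, rfl⟩ := hs
  obtain ⟨n, rfl⟩ := Submonoid.mem_powers_iff _ _ |>.1 hy
  exact ⟨z, hz, n, rfl⟩

theorem exists_pow_smul_mem_range_cechRestrict (S : Finset (Fin r)) (i : Fin r)
    (x : CechLocalization f N (insert i S)) :
    ∃ n : ℕ, ∀ m ≥ n, ∃ y, cechRestrict f N (Finset.subset_insert i S) y = f i ^ m • x := by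
  induction x using LocalizedModule.induction_on with
  | h m s =>
    obtain ⟨s, hs⟩ := s
    obtain ⟨t, ht, n, rfl⟩ := exists_of_mem_cechMonoid_insert f hs
    refine ⟨n, fun k hk => ⟨LocalizedModule.mk (f i ^ (k - n) • m) ⟨t, ht⟩, ?_⟩⟩
    rw [cechRestrict_mk, LocalizedModule.smul'_mk, LocalizedModule.mk_eq]
    refine ⟨1, ?_⟩
    simp only [one_smul, Submonoid.smul_def, smul_smul]
    congr 1
    conv_rhs => rw [← Nat.sub_add_cancel hk, pow_add]
    ring

theorem exists_pow_smul_eq_zero_of_cechRestrict (S : Finset (Fin r)) (i : Fin r)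
    (x : CechLocalization f N S) (hx : cechRestrict f N (Finset.subset_insert i S) x = 0) :
    ∃ n : ℕ, ∀ m ≥ n, f i ^ m • x = 0 := by
  induction x using LocalizedModule.induction_on with
  | h m s =>
    rw [cechRestrict_mk, ← LocalizedModule.zero_mk 1, LocalizedModule.mk_eq] at hx
    obtain ⟨⟨u, hu⟩, hx⟩ := hx
    obtain ⟨t, ht, n, rfl⟩ := exists_of_mem_cechMonoid_insert f hu
    refine ⟨n, fun k hk => ?_⟩
    rw [LocalizedModule.smul'_mk, ← LocalizedModule.zero_mk 1, LocalizedModule.mk_eq]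
    refine ⟨⟨t, ht⟩, ?_⟩
    simp only [one_smul, Submonoid.smul_def, smul_zero, smul_smul] at hx ⊢
    rw [← Nat.sub_add_cancel hk, pow_add, mul_left_comm, mul_comm t, mul_smul, hx, smul_zero]

/-- The Čech complex becomes contractible once `f i` is inverted, the homotopy moving the entry at
`insert i S` to `S`. Without inverting, the homotopy exists after multiplication by a power of `f
i`, and the error it leaves is killed by a further power. -/
theorem exists_pow_smul_mem_range_cechDifferential {c : CechTotal f N}
    (hc : cechDifferential f N c = 0) (i : Fin r) :
    ∃ n : ℕ, f i ^ n • c ∈ LinearMap.range (cechDifferential f N) := by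
  classical
  choose n hn using fun S => exists_pow_smul_mem_range_cechRestrict f (N := N) S i (c (insert i S))
  let m := Finset.univ.sup n
  choose y hy using fun S => hn S m (Finset.le_sup (Finset.mem_univ S))
  -- `b` is `f i ^ m` times the homotopy applied to `c`. Its sign is the one that cancels the sign
  -- of the only surviving term of the differential at a set containing `i`.
  let b : CechTotal f N := fun S => if i ∈ S then 0 else
    ((-1 : R) ^ ((insert i S).filter (· < i)).card) • y S
  have hb : ∀ T, i ∈ T → cechDifferential f N b T = f i ^ m • c T := fun T hT => by
    rw [cechDifferential_apply, Finset.sum_eq_single_of_mem i hT]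
    · have h1 : b (T.erase i) = ((-1 : R) ^ (T.filter (· < i)).card) • y (T.erase i) := by
        simp [b, Finset.insert_erase hT]
      rw [h1, map_smul, smul_smul, ← mul_pow, neg_mul_neg, one_mul, one_pow, one_smul]
      have h2 : ∀ U (hU : T.erase i ⊆ U), U = insert i (T.erase i) →
          cechRestrict f N hU (y (T.erase i)) = f i ^ m • c U := by
        rintro U hU rfl
        exact hy _
      exact h2 T _ (Finset.insert_erase hT).symm
    · intro j hj hji
      have : b (T.erase j) = 0 := if_pos (Finset.mem_erase.2 ⟨hji.symm, hT⟩)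
      rw [this, map_zero, smul_zero]
  -- `c'` is a cocycle vanishing at all sets containing `i`. The cocycle equation at `insert i T`
  -- reduces to one term: `c' T` restricts to zero there, so it is torsion for the powers of `f i`.
  set c' := f i ^ m • c - cechDifferential f N b with hc'
  have hc'0 : ∀ T, i ∈ T → c' T = 0 := fun T hT => by
    rw [hc', Pi.sub_apply, hb T hT, Pi.smul_apply, sub_self]
  have hdc' : cechDifferential f N c' = 0 := by
    rw [hc', map_sub, map_smul, hc, cechDifferential_comp_self, smul_zero, sub_zero]
  have hres : ∀ T, i ∉ T → cechRestrict f N (Finset.subset_insert i T) (c' T) = 0 := fun T hT => by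
    have h := congrFun hdc' (insert i T)
    rw [cechDifferential_apply, Finset.sum_eq_single_of_mem i (Finset.mem_insert_self i T)] at h
    · rw [cechRestrict_congr f (Finset.erase_insert hT) _ (Finset.subset_insert i T)] at h
      have h' := congrArg (fun z => ((-1 : R) ^ ((insert i T).filter (· < i)).card) • z) h
      simpa only [smul_smul, ← mul_pow, neg_mul_neg, one_mul, one_pow, one_smul, Pi.zero_apply,
        smul_zero] using h'
    · intro j hj hji
      rw [hc'0 _ (Finset.mem_erase.2 ⟨hji.symm, Finset.mem_insert_self i T⟩), map_zero, smul_zero]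
  have hk : ∀ T, ∃ k : ℕ, ∀ l ≥ k, f i ^ l • c' T = 0 := fun T => by
    by_cases hT : i ∈ T
    · exact ⟨0, fun l _ => by rw [hc'0 T hT, smul_zero]⟩
    · exact exists_pow_smul_eq_zero_of_cechRestrict f T i _ (hres T hT)
  choose k hk using hk
  let l := Finset.univ.sup k
  have h0 : f i ^ l • c' = 0 := funext fun T => hk T l (Finset.le_sup (Finset.mem_univ T))
  refine ⟨l + m, f i ^ l • b, ?_⟩
  rw [hc', smul_sub, sub_eq_zero, smul_smul, ← pow_add] at h0
  rw [map_smul, h0]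

/-- The multipliers that turn `c` into a coboundary form an ideal whose radical contains every `f
i`. -/
theorem exists_pow_smul_mem_range_of_mem_radical {x : R} (hx : x ∈ (Ideal.span (Set.range f)).radical)
    {c : CechTotal f N} (hc : cechDifferential f N c = 0) :
    ∃ n : ℕ, x ^ n • c ∈ LinearMap.range (cechDifferential f N) := by
  let J : Ideal R := (LinearMap.range (cechDifferential f N)).comap (LinearMap.toSpanSingleton R _ c)
  have : Ideal.span (Set.range f) ≤ J.radical := by
    rw [Ideal.span_le]
    rintro _ ⟨i, rfl⟩
    exact exists_pow_smul_mem_range_cechDifferential f hc i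
  have := Ideal.radical_mono this hx
  rw [Ideal.radical_idem] at this
  exact this

/-! ### Functoriality -/

variable {N' : Type*} [AddCommGroup N'] [Module R N']

/-- The map of Čech complexes induced by a linear map. -/
noncomputable def cechMap (g : N →ₗ[R] N') : CechTotal f N →ₗ[R] CechTotal f N' :=
  LinearMap.pi fun S => (IsLocalizedModule.map (cechMonoid f S)
    (LocalizedModule.mkLinearMap (cechMonoid f S) N)
    (LocalizedModule.mkLinearMap (cechMonoid f S) N') g).comp (LinearMap.proj S)

theorem cechMap_apply_mk (g : N →ₗ[R] N') (S : Finset (Fin r)) (m : N) (s : cechMonoid f S) :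
    IsLocalizedModule.map (cechMonoid f S)
    (LocalizedModule.mkLinearMap (cechMonoid f S) N)
    (LocalizedModule.mkLinearMap (cechMonoid f S) N') g (LocalizedModule.mk m s) =
      LocalizedModule.mk (g m) s := by
  simp only [IsLocalizedModule.mk_eq_mk', IsLocalizedModule.map_mk']

theorem cechMap_apply_of_eq_mk (g : N →ₗ[R] N') {c : CechTotal f N} {S : Finset (Fin r)} {m : N}
    {s : cechMonoid f S} (h : c S = LocalizedModule.mk m s) :
    cechMap f g c S = LocalizedModule.mk (g m) s := by
  rw [← cechMap_apply_mk, ← h]; rfl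

theorem cechMap_differential (g : N →ₗ[R] N') (c : CechTotal f N) :
    cechMap f g (cechDifferential f N c) = cechDifferential f N' (cechMap f g c) := by
  have key : ∀ (S T : Finset (Fin r)) (h : S ⊆ T) (x : CechLocalization f N S),
      IsLocalizedModule.map (cechMonoid f T) (LocalizedModule.mkLinearMap (cechMonoid f T) N)
        (LocalizedModule.mkLinearMap (cechMonoid f T) N') g (cechRestrict f N h x) =
      cechRestrict f N' h (IsLocalizedModule.map (cechMonoid f S)
        (LocalizedModule.mkLinearMap (cechMonoid f S) N)
        (LocalizedModule.mkLinearMap (cechMonoid f S) N') g x) := fun S T h x => by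
    induction x using LocalizedModule.induction_on with
    | h m s => simp only [cechRestrict_mk, cechMap_apply_mk]
  funext T
  change IsLocalizedModule.map _ _ _ g (cechDifferential f N c T) = _
  rw [cechDifferential_apply, cechDifferential_apply, map_sum]
  refine Finset.sum_congr rfl fun i _ => ?_
  rw [map_smul, key]
  rfl

theorem cechMap_mem {g : N →ₗ[R] N'} {p : ℕ} {c : CechTotal f N} (hc : c ∈ cechCochains f N p) :
    cechMap f g c ∈ cechCochains f N' p := fun S hS => by
  change IsLocalizedModule.map _ _ _ g (c S) = 0
  rw [hc S hS, map_zero]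

theorem exists_cechMap_eq {g : N →ₗ[R] N'} (hg : Function.Surjective g) {p : ℕ}
    {c : CechTotal f N'} (hc : c ∈ cechCochains f N' p) :
    ∃ b ∈ cechCochains f N p, cechMap f g b = c := by
  have : ∀ S, ∃ y : CechLocalization f N S, IsLocalizedModule.map (cechMonoid f S)
      (LocalizedModule.mkLinearMap (cechMonoid f S) N)
      (LocalizedModule.mkLinearMap (cechMonoid f S) N') g y = c S := fun S =>
    IsLocalizedModule.map_surjective _ _ _ g hg (c S)
  choose y hy using this
  refine ⟨cechTruncate f p y, cechTruncate_mem f p y, funext fun S => ?_⟩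
  by_cases hS : S.card = p
  · rw [← hy S]
    change IsLocalizedModule.map _ _ _ g (cechTruncate f p y S) = _
    congr 1
    exact if_pos hS
  · rw [hc S hS, cechMap_mem f (cechTruncate_mem f p y) S hS]

theorem smul_cechTotal_injective {x : R} (hx : IsSMulRegular N x) :
    IsSMulRegular (CechTotal f N) x := by
  refine isSMulRegular_iff_right_eq_zero_of_smul.2 fun c hc => funext fun S => ?_
  have hS := congrFun hc S
  rw [Pi.smul_apply] at hS
  generalize c S = y at hS ⊢
  induction y using LocalizedModule.induction_on with
  | h m s =>
    rw [LocalizedModule.smul'_mk, Pi.zero_apply, ← LocalizedModule.zero_mk 1,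
      LocalizedModule.mk_eq] at hS
    obtain ⟨u, hu⟩ := hS
    rw [Pi.zero_apply, ← LocalizedModule.zero_mk 1, LocalizedModule.mk_eq]
    refine ⟨u, hx ?_⟩
    simp only [one_smul, smul_zero] at hu ⊢
    rw [smul_comm x u, hu]

/-- Exactness of localization: a numerator becomes divisible by `x` after multiplication by some
denominator `u`, and `u` is then absorbed into the denominator. -/
theorem exists_eq_smul_of_cechMap_eq_zero {x : R} {c : CechTotal f N}
    (hc : cechMap f (Submodule.mkQ (x • (⊤ : Submodule R N))) c = 0) :
    ∃ e : CechTotal f N, c = x • e := by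
  have : ∀ S, ∃ y, c S = x • y := fun S => by
    obtain ⟨⟨m, s⟩, hm⟩ : ∃ q : N × cechMonoid f S, c S = LocalizedModule.mk q.1 q.2 := by
      generalize c S = y
      induction y using LocalizedModule.induction_on with
      | h m s => exact ⟨(m, s), rfl⟩
    have h := congrFun hc S
    rw [cechMap_apply_of_eq_mk f _ hm, Pi.zero_apply, ← LocalizedModule.zero_mk 1,
      LocalizedModule.mk_eq] at h
    obtain ⟨u, hu⟩ := h
    simp only [one_smul, smul_zero, Submonoid.smul_def] at hu
    rw [← map_smul, Submodule.mkQ_apply, Submodule.Quotient.mk_eq_zero,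
      Submodule.mem_smul_pointwise_iff_exists] at hu
    obtain ⟨n, -, hn⟩ := hu
    refine ⟨LocalizedModule.mk n (u * s), ?_⟩
    rw [hm, LocalizedModule.smul'_mk, hn]
    exact (LocalizedModule.mk_cancel_common_left u s m).symm
  choose e he using this
  exact ⟨e, funext he⟩

theorem mem_cechCochains_of_smul {x : R} (hx : IsSMulRegular N x) {p : ℕ} {e : CechTotal f N}
    (h : x • e ∈ cechCochains f N p) : e ∈ cechCochains f N p := by
  have : x • e = x • cechTruncate f p e := by
    rw [← map_smul, cechTruncate_eq_self f h]
  rw [smul_cechTotal_injective f hx this]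
  exact cechTruncate_mem f p e

end CechBasics

/-! ### Vanishing of local cohomology and the connecting homomorphism -/

section CechVanishing

open scoped Pointwise
open RingTheory.Sequence

variable {R : Type*} [CommRing R] {r : ℕ} (f : Fin r → R)

/-- The `p`-th Čech cohomology of `N` vanishes. -/
def CechVanishes (N : Type*) [AddCommGroup N] [Module R N] (p : ℕ) : Prop :=
  cechCocycles f N p ≤ LinearMap.range (cechDifferential f N)

theorem exists_linearMap_comp_eq {M A B : Type*} [AddCommGroup M] [Module R M] [AddCommGroup A]
    [Module R A] [AddCommGroup B] [Module R B] (g : M →ₗ[R] A) (h : M →ₗ[R] B)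
    (hg : Function.Surjective g) (hk : LinearMap.ker g ≤ LinearMap.ker h) :
    ∃ δ : A →ₗ[R] B, ∀ m, δ (g m) = h m := by
  refine ⟨((LinearMap.ker g).liftQ h hk).comp (g.quotKerEquivOfSurjective hg).symm.toLinearMap,
    fun m => ?_⟩
  have : (g.quotKerEquivOfSurjective hg).symm (g m) = Submodule.Quotient.mk m := by
    rw [LinearEquiv.symm_apply_eq]; rfl
  simp [this]

variable {N : Type*} [AddCommGroup N] [Module R N]

theorem mem_cechCocycles {p : ℕ} {c : CechTotal f N} :
    c ∈ cechCocycles f N p ↔ c ∈ cechCochains f N p ∧ cechDifferential f N c = 0 := Iff.rfl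

/-- First half of the snake lemma: the differential of a lift of a cocycle modulo `x` is divisible
by `x`. The quotient is a cocycle because `x` stays regular on all localizations. -/
theorem exists_smul_eq_differential {x : R} (hx : IsSMulRegular N x) {p : ℕ} {c : CechTotal f N}
    (hc : c ∈ cechCochains f N p)
    (h : cechDifferential f (QuotSMulTop x N) (cechMap f (Submodule.mkQ _) c) = 0) :
    ∃ e ∈ cechCocycles f N (p + 1), cechDifferential f N c = x • e := by
  rw [← cechMap_differential] at h
  obtain ⟨e, he⟩ := exists_eq_smul_of_cechMap_eq_zero f h
  refine ⟨e, (mem_cechCocycles f).2 ⟨mem_cechCochains_of_smul f hx (he ▸ cechDifferential_mem f hc),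
    smul_cechTotal_injective f hx ?_⟩, he⟩
  simp only
  rw [← map_smul, ← he, cechDifferential_comp_self, smul_zero]

theorem cechMap_mkQ_smul (x : R) (c : CechTotal f N) :
    cechMap f (Submodule.mkQ (x • (⊤ : Submodule R N))) (x • c) = 0 := by
  funext S
  change IsLocalizedModule.map _ _ _ _ (x • c S) = 0
  generalize c S = y
  induction y using LocalizedModule.induction_on with
  | h m s =>
    rw [LocalizedModule.smul'_mk, cechMap_apply_mk]
    have : (Submodule.mkQ (x • (⊤ : Submodule R N))) (x • m) = 0 :=
      (Submodule.Quotient.mk_eq_zero _).2 (Submodule.smul_mem_pointwise_smul m x ⊤ trivial)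
    rw [this, LocalizedModule.zero_mk]

theorem exists_eq_differential_add_smul {x : R} {p : ℕ} {c : CechTotal f N}
    (hc : c ∈ cechCochains f N p)
    (h : cechMap f (Submodule.mkQ (x • (⊤ : Submodule R N))) c ∈
      LinearMap.range (cechDifferential f (QuotSMulTop x N))) :
    ∃ b e : CechTotal f N, c = cechDifferential f N b + x • e := by
  have : ∃ b : CechTotal f N, cechDifferential f (QuotSMulTop x N) (cechMap f (Submodule.mkQ _) b) =
      cechMap f (Submodule.mkQ _) c := by
    rcases p with _ | p
    · refine ⟨0, ?_⟩
      rw [coboundary_zero f (cechMap_mem f hc) h, map_zero, map_zero]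
    · obtain ⟨b', hb', hb⟩ := exists_cochain_of_coboundary f (cechMap_mem f hc) h
      obtain ⟨b, -, rfl⟩ := exists_cechMap_eq f (Submodule.mkQ_surjective _) hb'
      exact ⟨b, hb⟩
  obtain ⟨b, hb⟩ := this
  rw [← cechMap_differential, ← sub_eq_zero, ← map_sub] at hb
  obtain ⟨e, he⟩ := exists_eq_smul_of_cechMap_eq_zero f hb
  exact ⟨b, -e, by rw [smul_neg, ← he]; abel⟩

/-- Exactness of `H^p(N) → H^p(N/xN) → H^{p+1}(N)`. -/
theorem CechVanishes.quotSMulTop {x : R} (hx : IsSMulRegular N x) {p : ℕ}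
    (h : CechVanishes f N p) (h' : CechVanishes f N (p + 1)) :
    CechVanishes f (QuotSMulTop x N) p := by
  rintro c hc
  obtain ⟨hc1, hc2⟩ := (mem_cechCocycles f).1 hc
  obtain ⟨b, hb, rfl⟩ := exists_cechMap_eq f (Submodule.mkQ_surjective _) hc1
  obtain ⟨e, he, hbe⟩ := exists_smul_eq_differential f hx hb hc2
  obtain ⟨a, ha, rfl⟩ := exists_cochain_of_coboundary f he.1 (h' he)
  have : b - x • a ∈ cechCocycles f N p := (mem_cechCocycles f).2
    ⟨sub_mem hb (Submodule.smul_mem _ _ ha), by rw [map_sub, map_smul, hbe, sub_self]⟩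
  obtain ⟨a', ha'⟩ := h this
  refine ⟨cechMap f (Submodule.mkQ (x • (⊤ : Submodule R N))) a', ?_⟩
  rw [← cechMap_differential, ha', map_sub, cechMap_mkQ_smul, sub_zero]

/-- The exact sequence `H^p(N/xN) → H^{p+1}(N) → H^{p+1}(N)` makes multiplication by `x` injective
on `H^{p+1}(N)`. -/
theorem mem_range_of_smul_mem_range {x : R} (hx : IsSMulRegular N x) {p : ℕ}
    (h : CechVanishes f (QuotSMulTop x N) p) {c : CechTotal f N} (hc : c ∈ cechCocycles f N (p + 1))
    (hxc : x • c ∈ LinearMap.range (cechDifferential f N)) :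
    c ∈ LinearMap.range (cechDifferential f N) := by
  obtain ⟨b, hb, hbc⟩ := exists_cochain_of_coboundary f (Submodule.smul_mem _ x hc.1) hxc
  have : cechMap f (Submodule.mkQ (x • (⊤ : Submodule R N))) b ∈
      cechCocycles f (QuotSMulTop x N) p := (mem_cechCocycles f).2
    ⟨cechMap_mem f hb, by
      rw [← cechMap_differential, hbc]
      exact cechMap_mkQ_smul f x c⟩
  obtain ⟨a, e, hae⟩ := exists_eq_differential_add_smul f hb (h this)
  refine ⟨e, smul_cechTotal_injective f hx ?_⟩
  simp only
  rw [← hbc, hae, map_add, cechDifferential_comp_self, zero_add, map_smul]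

theorem mem_range_of_pow_smul_mem_range {x : R} (hx : IsSMulRegular N x) {p : ℕ}
    (h : CechVanishes f (QuotSMulTop x N) p) {c : CechTotal f N} (hc : c ∈ cechCocycles f N (p + 1))
    (n : ℕ) (hxc : x ^ n • c ∈ LinearMap.range (cechDifferential f N)) :
    c ∈ LinearMap.range (cechDifferential f N) := by
  induction n with
  | zero => simpa using hxc
  | succ n ih =>
    exact ih (mem_range_of_smul_mem_range f hx h (Submodule.smul_mem _ _ hc)
      (by rwa [smul_smul, ← pow_succ']))

/-- Multiplication by `x` is injective on `H^{p+1}(N)`, yet each class is killed by a power of `x`.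
-/
theorem CechVanishes.of_quotSMulTop {x : R} (hx : IsSMulRegular N x)
    (hxf : x ∈ (Ideal.span (Set.range f)).radical) {p : ℕ}
    (h : CechVanishes f (QuotSMulTop x N) p) : CechVanishes f N (p + 1) := fun c hc => by
  obtain ⟨n, hn⟩ := exists_pow_smul_mem_range_of_mem_radical f hxf ((mem_cechCocycles f).1 hc).2
  exact mem_range_of_pow_smul_mem_range f hx h hc n hn

theorem CechVanishes.zero_of_isSMulRegular {x : R} (hx : IsSMulRegular N x)
    (hxf : x ∈ (Ideal.span (Set.range f)).radical) : CechVanishes f N 0 := fun c hc => by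
  obtain ⟨n, hn⟩ := exists_pow_smul_mem_range_of_mem_radical f hxf ((mem_cechCocycles f).1 hc).2
  have h := coboundary_zero f (Submodule.smul_mem _ _ hc.1) hn
  have : c = 0 := smul_cechTotal_injective f (hx.pow n) (by simpa using h)
  rw [this]
  exact zero_mem _

theorem cechVanishes_of_isWeaklyRegular {xs : List R} (hxs : IsWeaklyRegular N xs)
    (hxf : ∀ x ∈ xs, x ∈ (Ideal.span (Set.range f)).radical) {p : ℕ} (hp : p < xs.length) :
    CechVanishes f N p := by
  induction xs generalizing N p with
  | nil => simp at hp
  | cons x xs ih =>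
    rw [isWeaklyRegular_cons_iff] at hxs
    rcases p with _ | p
    · exact .zero_of_isSMulRegular f hxs.1 (hxf x List.mem_cons_self)
    · exact .of_quotSMulTop f hxs.1 (hxf x List.mem_cons_self)
        (ih hxs.2 (fun y hy => hxf y (List.mem_cons_of_mem x hy)) (by simpa using hp))

/-- The class of a cocycle. -/
noncomputable abbrev cechClass {p : ℕ} (c : cechCocycles f N p) : CechLocalCohomology f N p :=
  Submodule.Quotient.mk c

theorem cechClass_eq_zero {p : ℕ} (c : cechCocycles f N p) :
    cechClass f c = 0 ↔ (c : CechTotal f N) ∈ LinearMap.range (cechDifferential f N) := by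
  rw [Submodule.Quotient.mk_eq_zero, Submodule.submoduleOf, Submodule.mem_comap]
  exact ⟨fun h => h.2, fun h => ⟨c.2.1, h⟩⟩

/-- The snake lemma: lift a cocycle, apply the differential, divide by `x`. The explicit formula is
kept in the statement because the degree shift is computed from it; the other clauses are exactness
at `H^{p+1}(N)` and at `H^p(N/xN)`. -/
theorem exists_connecting {x : R} (hx : IsSMulRegular N x) (p : ℕ) :
    ∃ δ : CechLocalCohomology f (QuotSMulTop x N) p →ₗ[R] CechLocalCohomology f N (p + 1),
      (∀ (c : CechTotal f N) (_ : c ∈ cechCochains f N p) (e : cechCocycles f N (p + 1))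
        (c' : cechCocycles f (QuotSMulTop x N) p),
        cechMap f (Submodule.mkQ (x • (⊤ : Submodule R N))) c = c' →
        cechDifferential f N c = x • (e : CechTotal f N) → δ (cechClass f c') = cechClass f e) ∧
      (∀ h, h ∈ LinearMap.range δ ↔ x • h = 0) ∧
      (CechVanishes f N p → Function.Injective δ) := by
  let g : CechTotal f N →ₗ[R] CechTotal f (QuotSMulTop x N) := cechMap f (Submodule.mkQ _)
  -- `Γ` consists of the cochains that are cocycles modulo `x`. Reduction (`G`) and division of the
  -- differential by `x` (`H`) are both linear on it, `G` is onto, and `δ` is `H` factored through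
  -- `G`.
  let Γ : Submodule R (CechTotal f N) := cechCochains f N p ⊓ (cechCocycles f _ p).comap g
  have hΓ : ∀ c : Γ, ∃ e : cechCocycles f N (p + 1), cechDifferential f N c = x • (e : CechTotal f N) :=
    fun c => by
      obtain ⟨e, he, h⟩ := exists_smul_eq_differential f hx c.2.1 ((mem_cechCocycles f).1 c.2.2).2
      exact ⟨⟨e, he⟩, h⟩
  choose E hE using hΓ
  have huniq : ∀ e e' : cechCocycles f N (p + 1),
      x • (e : CechTotal f N) = x • (e' : CechTotal f N) → e = e' := fun e e' h =>
    Subtype.ext (smul_cechTotal_injective f hx h)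
  let G : Γ →ₗ[R] CechLocalCohomology f (QuotSMulTop x N) p :=
    (Submodule.mkQ _).comp ((g.comp Γ.subtype).codRestrict (cechCocycles f _ p) fun c => c.2.2)
  let H' : Γ →ₗ[R] cechCocycles f N (p + 1) :=
    { toFun := E
      map_add' := fun a b => huniq _ _ (by
        rw [← hE, Submodule.coe_add, Submodule.coe_add, smul_add, ← hE, ← hE, map_add])
      map_smul' := fun t a => huniq _ _ (by
        rw [← hE, RingHom.id_apply, Submodule.coe_smul, Submodule.coe_smul, smul_comm, ← hE,
          map_smul]) }
  let H : Γ →ₗ[R] CechLocalCohomology f N (p + 1) := (Submodule.mkQ _).comp H'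
  have hG : ∀ c : Γ, G c = cechClass f ⟨g c, c.2.2⟩ := fun _ => rfl
  have hH : ∀ c : Γ, H c = cechClass f (E c) := fun _ => rfl
  have hGs : Function.Surjective G := fun y => by
    obtain ⟨c', rfl⟩ := Submodule.Quotient.mk_surjective _ y
    obtain ⟨c, hc, hcc⟩ := exists_cechMap_eq f (Submodule.mkQ_surjective _) c'.2.1
    have hcc' : g c = c' := hcc
    refine ⟨⟨c, hc, by rw [SetLike.mem_coe, Submodule.mem_comap, hcc']; exact c'.2⟩, ?_⟩
    rw [hG]
    congr 1
    exact Subtype.ext hcc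
  have hker : LinearMap.ker G ≤ LinearMap.ker H := fun c hc => by
    rw [LinearMap.mem_ker, hG, cechClass_eq_zero] at hc
    rw [LinearMap.mem_ker, hH, cechClass_eq_zero]
    obtain ⟨b, e, hbe⟩ := exists_eq_differential_add_smul f c.2.1 hc
    refine ⟨e, smul_cechTotal_injective f hx ?_⟩
    simp only
    rw [← hE, hbe, map_add, cechDifferential_comp_self, zero_add, map_smul]
  obtain ⟨δ, hδ⟩ := exists_linearMap_comp_eq G H hGs hker
  refine ⟨δ, ?_, ?_, ?_⟩
  · intro c hc e c' hcc' hce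
    have hcΓ : c ∈ Γ := ⟨hc, by rw [SetLike.mem_coe, Submodule.mem_comap]; exact hcc' ▸ c'.2⟩
    have h1 := hδ ⟨c, hcΓ⟩
    rw [hG, hH, huniq (E ⟨c, hcΓ⟩) e (by rw [← hE, ← hce])] at h1
    rw [← h1]
    congr 2
    exact Subtype.ext hcc'.symm
  · intro h
    constructor
    · rintro ⟨y, rfl⟩
      obtain ⟨c, rfl⟩ := hGs y
      rw [hδ, hH, ← Submodule.Quotient.mk_smul, cechClass_eq_zero]
      exact ⟨c, by rw [hE]; rfl⟩
    · intro h0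
      obtain ⟨e, rfl⟩ := Submodule.Quotient.mk_surjective _ h
      rw [← Submodule.Quotient.mk_smul, cechClass_eq_zero] at h0
      obtain ⟨c, hc, hce⟩ := exists_cochain_of_coboundary f (x • e).2.1 h0
      have hce' : cechDifferential f N c = x • (e : CechTotal f N) := hce
      have hcΓ : c ∈ Γ := by
        refine ⟨hc, (mem_cechCocycles f).2 ⟨cechMap_mem f hc, ?_⟩⟩
        rw [← cechMap_differential, hce']
        exact cechMap_mkQ_smul f x _
      refine ⟨G ⟨c, hcΓ⟩, ?_⟩
      rw [hδ, hH, huniq (E ⟨c, hcΓ⟩) e (by rw [← hE, ← hce'])]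
  · intro hv
    rw [injective_iff_map_eq_zero]
    intro y hy
    obtain ⟨c, rfl⟩ := hGs y
    rw [hδ, hH, cechClass_eq_zero] at hy
    obtain ⟨a, ha, hac⟩ := exists_cochain_of_coboundary f (E c).2.1 hy
    have hcc : (c : CechTotal f N) - x • a ∈ cechCocycles f N p := (mem_cechCocycles f).2
      ⟨sub_mem c.2.1 (Submodule.smul_mem _ _ ha), by rw [map_sub, map_smul, hE, hac, sub_self]⟩
    obtain ⟨b, hb⟩ := hv hcc
    rw [hG, cechClass_eq_zero]
    refine ⟨g b, ?_⟩
    change _ = g c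
    rw [← cechMap_differential, hb, map_sub]
    change g c - cechMap f _ (x • a) = _
    rw [cechMap_mkQ_smul, sub_zero]

/-- The augmentation of the Čech complex. -/
noncomputable def cechAugment : N →ₗ[R] CechTotal f N :=
  (LinearMap.single R (fun S => CechLocalization f N S) ∅).comp
    (LocalizedModule.mkLinearMap (cechMonoid f ∅) N)

theorem cechAugment_empty (m : N) : cechAugment f m ∅ = LocalizedModule.mk m 1 := by
  simp [cechAugment]

theorem cechAugment_of_ne (m : N) {S : Finset (Fin r)} (hS : S ≠ ∅) : cechAugment f m S = 0 := by
  simp [cechAugment, hS]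

theorem cechAugment_mem_cocycles {m : N} (ht : ∀ i, ∃ n : ℕ, f i ^ n • m = 0) :
    cechAugment f m ∈ cechCocycles f N 0 := by
  refine (mem_cechCocycles f).2 ⟨fun S hS => cechAugment_of_ne f m (by rintro rfl; simp at hS),
    funext fun T => ?_⟩
  rw [cechDifferential_apply]
  refine Finset.sum_eq_zero fun i hi => ?_
  by_cases hT : T.erase i = ∅
  · rw [cechRestrict_congr f hT _ (Finset.empty_subset T), cechAugment_empty, cechRestrict_mk]
    obtain ⟨n, hn⟩ := ht i
    have : LocalizedModule.mk m (⟨(1 : cechMonoid f ∅).1, one_mem _⟩ : cechMonoid f T) = 0 := by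
      rw [← LocalizedModule.zero_mk 1, LocalizedModule.mk_eq]
      refine ⟨⟨f i ^ n, pow_mem (mem_cechMonoid_of_mem f hi) n⟩, ?_⟩
      rw [one_smul, smul_zero, smul_zero]
      exact hn
    rw [this, smul_zero]
  · rw [cechAugment_of_ne f m hT, map_zero, smul_zero]

theorem eq_one_of_cechMonoid_empty (s : cechMonoid f (∅ : Finset (Fin r))) : s = 1 := by
  have := s.2
  simp only [cechMonoid, Finset.coe_empty, Set.image_empty, Submonoid.closure_empty,
    Submonoid.mem_bot] at this
  exact Subtype.ext this

theorem eq_zero_of_cechAugment_mem_range {m : N}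
    (h : cechAugment f m ∈ cechCochains f N 0)
    (h' : cechAugment f m ∈ LinearMap.range (cechDifferential f N)) : m = 0 := by
  have h2 := congrFun (coboundary_zero f h h') ∅
  rw [cechAugment_empty, Pi.zero_apply, ← LocalizedModule.zero_mk 1, LocalizedModule.mk_eq] at h2
  obtain ⟨u, hu⟩ := h2
  rwa [eq_one_of_cechMonoid_empty f u, one_smul, one_smul, one_smul, one_smul] at hu

theorem CechVanishes.eq_zero_of_torsion (h : CechVanishes f N 0) {m : N}
    (ht : ∀ i, ∃ n : ℕ, f i ^ n • m = 0) : m = 0 :=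
  eq_zero_of_cechAugment_mem_range f (cechAugment_mem_cocycles f ht).1
    (h (cechAugment_mem_cocycles f ht))

end CechVanishing

/-! ### Gradings on localizations and on local cohomology -/

section Graded

open scoped Pointwise
open RingTheory.Sequence

/-- The projections onto the components of a `ℤ`-grading of an abelian group. -/
structure GradedProj {N : Type*} [AddCommGroup N] (𝒩 : ℤ → AddSubgroup N) where
  /-- The projection onto the component of degree `n`. -/
  proj : ℤ → N →+ N
  proj_mem : ∀ n x, proj n x ∈ 𝒩 n
  proj_self : ∀ n, ∀ x ∈ 𝒩 n, proj n x = x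
  proj_ne : ∀ m n, m ≠ n → ∀ x ∈ 𝒩 n, proj m x = 0
  exists_sum : ∀ x, ∃ F : Finset ℤ, x = ∑ n ∈ F, proj n x

namespace GradedProj

variable {N N' : Type*} [AddCommGroup N] [AddCommGroup N'] {𝒩 : ℤ → AddSubgroup N}
  {𝒩' : ℤ → AddSubgroup N'}

theorem proj_sum (P : GradedProj 𝒩) {F : Finset ℤ} {y : ℤ → N} (hy : ∀ n ∈ F, y n ∈ 𝒩 n) (n : ℤ) :
    P.proj n (∑ m ∈ F, y m) = if n ∈ F then y n else 0 := by
  rw [map_sum]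
  split_ifs with h
  · rw [Finset.sum_eq_single_of_mem n h fun m hm hmn => P.proj_ne n m hmn.symm _ (hy m hm),
      P.proj_self n _ (hy n h)]
  · exact Finset.sum_eq_zero fun m hm => P.proj_ne n m (by rintro rfl; exact h hm) _ (hy m hm)

theorem proj_eq_zero (P : GradedProj 𝒩) {F : Finset ℤ} {x : N} (h : x = ∑ n ∈ F, P.proj n x)
    {n : ℤ} (hn : n ∉ F) : P.proj n x = 0 := by
  rw [h, P.proj_sum fun m _ => P.proj_mem m x, if_neg hn]

theorem eq_sum_of_subset (P : GradedProj 𝒩) {F F' : Finset ℤ} {x : N} (hF : F ⊆ F')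
    (h : x = ∑ n ∈ F, P.proj n x) : x = ∑ n ∈ F', P.proj n x := by
  conv_lhs => rw [h]
  exact Finset.sum_subset hF fun n _ hn => P.proj_eq_zero h hn

theorem map_proj (P : GradedProj 𝒩) (P' : GradedProj 𝒩') (φ : N →+ N') (k : ℤ)
    (hφ : ∀ n, ∀ x ∈ 𝒩 n, φ x ∈ 𝒩' (n + k)) (n : ℤ) (x : N) :
    φ (P.proj n x) = P'.proj (n + k) (φ x) := by
  obtain ⟨F, hF⟩ := P.exists_sum x
  conv_rhs => rw [hF, map_sum, map_sum]
  by_cases h : n ∈ F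
  · rw [Finset.sum_eq_single_of_mem n h, P'.proj_self _ _ (hφ n _ (P.proj_mem n x))]
    intro m _ hmn
    exact P'.proj_ne _ (m + k) (by omega) _ (hφ m _ (P.proj_mem m x))
  · rw [P.proj_eq_zero hF h, map_zero, Finset.sum_eq_zero]
    intro m hm
    exact P'.proj_ne _ (m + k) (by rintro h'; exact h (by rwa [add_right_cancel h']))
      _ (hφ m _ (P.proj_mem m x))

theorem nonempty_of_span_of_indep
    (hs : ∀ x, ∃ (F : Finset ℤ) (y : ℤ → N), (∀ n, y n ∈ 𝒩 n) ∧ x = ∑ n ∈ F, y n)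
    (hi : ∀ (F : Finset ℤ) (y : ℤ → N), (∀ n ∈ F, y n ∈ 𝒩 n) → ∑ n ∈ F, y n = 0 → ∀ n ∈ F, y n = 0) :
    Nonempty (GradedProj 𝒩) := by
  classical
  let φ := DirectSum.coeAddMonoidHom 𝒩
  have hφ : Function.Bijective φ := by
    constructor
    · rw [injective_iff_map_eq_zero]
      intro z hz
      rw [DirectSum.coeAddMonoidHom_eq_dfinsuppSum, DFinsupp.sum] at hz
      have := hi _ (fun n => (z n : N)) (fun n _ => (z n).2) hz
      ext n
      by_cases hn : n ∈ DFinsupp.support z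
      · exact this n hn
      · rw [DFinsupp.notMem_support_iff] at hn
        rw [hn]; rfl
    · intro x
      obtain ⟨F, y, hy, rfl⟩ := hs x
      refine ⟨∑ n ∈ F, DirectSum.of (fun n => 𝒩 n) n ⟨y n, hy n⟩, ?_⟩
      rw [map_sum]
      exact Finset.sum_congr rfl fun n _ => DirectSum.coeAddMonoidHom_of _ _ _
  let e : (DirectSum ℤ fun n => 𝒩 n) ≃+ N := AddEquiv.ofBijective φ hφ
  have he : ∀ n (x : 𝒩 n), e.symm x = DirectSum.of (fun n => 𝒩 n) n x := fun n x => by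
    rw [AddEquiv.symm_apply_eq]
    exact (DirectSum.coeAddMonoidHom_of _ _ _).symm
  refine ⟨⟨fun n => ((𝒩 n).subtype.comp (DFinsupp.evalAddMonoidHom n)).comp e.symm.toAddMonoidHom,
    fun n x => ((e.symm x) n).2, fun n x hx => ?_, fun m n hmn x hx => ?_, fun x => ?_⟩⟩
  · change ((e.symm x) n : N) = x
    rw [he n ⟨x, hx⟩, DirectSum.of_eq_same]
  · change ((e.symm x) m : N) = 0
    rw [he n ⟨x, hx⟩, DirectSum.of_eq_of_ne _ _ _ hmn]; rfl
  · refine ⟨DFinsupp.support (e.symm x), ?_⟩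
    conv_lhs => rw [← e.apply_symm_apply x]
    change φ _ = _
    rw [DirectSum.coeAddMonoidHom_eq_dfinsuppSum, DFinsupp.sum]
    rfl

end GradedProj

variable {A R : Type*} [CommRing A] [CommRing R] [Algebra A R] (𝒜 : ℕ → Submodule A R)

/-- The homogeneous elements of `R` of degree `l` shift the degrees in `N` by `l`. -/
def GradedSMul {N : Type*} [AddCommGroup N] [Module R N] (𝒩 : ℤ → AddSubgroup N) : Prop :=
  ∀ (l : ℕ) (n : ℤ), ∀ a ∈ 𝒜 l, ∀ m ∈ 𝒩 n, a • m ∈ 𝒩 (n + l)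

variable {N : Type*} [AddCommGroup N] [Module R N] {𝒩 : ℤ → AddSubgroup N}

/-- The image of a grading in the quotient by a homogeneous element. -/
def quotSMulTopPiece (x : R) (𝒩 : ℤ → AddSubgroup N) (n : ℤ) : AddSubgroup (QuotSMulTop x N) :=
  (𝒩 n).map (Submodule.mkQ (x • (⊤ : Submodule R N))).toAddMonoidHom

variable {𝒜}

theorem GradedSMul.quotSMulTop (h : GradedSMul 𝒜 𝒩) (x : R) :
    GradedSMul 𝒜 (quotSMulTopPiece x 𝒩) := by
  rintro l n a ha _ ⟨m, hm, rfl⟩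
  exact ⟨a • m, h l n a ha m hm, map_smul (Submodule.mkQ _) _ _⟩

theorem GradedProj.quotSMulTop (P : GradedProj 𝒩) (h : GradedSMul 𝒜 𝒩) {x : R} {l : ℕ}
    (hx : x ∈ 𝒜 l) : Nonempty (GradedProj (quotSMulTopPiece x 𝒩)) := by
  refine GradedProj.nonempty_of_span_of_indep (fun y => ?_) fun F y hy h0 n hn => ?_
  · obtain ⟨y, rfl⟩ := Submodule.Quotient.mk_surjective _ y
    obtain ⟨F, hF⟩ := P.exists_sum y
    refine ⟨F, fun n => Submodule.mkQ _ (P.proj n y), fun n => ⟨_, P.proj_mem n y, rfl⟩, ?_⟩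
    rw [← map_sum, ← hF]
    rfl
  · have : ∀ n, ∃ z ∈ 𝒩 n, n ∈ F → Submodule.mkQ (x • (⊤ : Submodule R N)) z = y n := fun n => by
      by_cases hn : n ∈ F
      · obtain ⟨z, hz, hzy⟩ := hy n hn
        exact ⟨z, hz, fun _ => hzy⟩
      · exact ⟨0, zero_mem _, fun h => absurd h hn⟩
    choose z hz hzy using this
    rw [← Finset.sum_congr rfl fun n hn => hzy n hn, ← map_sum, Submodule.mkQ_apply,
      Submodule.Quotient.mk_eq_zero, Submodule.mem_smul_pointwise_iff_exists] at h0
    obtain ⟨w, -, hw⟩ := h0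
    rw [← hzy n hn, Submodule.mkQ_apply, Submodule.Quotient.mk_eq_zero,
      Submodule.mem_smul_pointwise_iff_exists]
    -- As `x` has degree `l`, the degree `n` part of `x • w` is `x` times the degree `n - l` part of
    -- `w`.
    refine ⟨P.proj (n - l) w, trivial, ?_⟩
    have h1 := P.map_proj P (DistribSMul.toAddMonoidHom N x) l
      (fun n m hm => h l n x hx m hm) (n - l) w
    simp only [DistribSMul.toAddMonoidHom_apply, sub_add_cancel] at h1
    rw [h1, hw, P.proj_sum fun m _ => hz m, if_pos hn]

theorem localizedModule_mk_sum {W : Submonoid R} {ι : Type*} (F : Finset ι) (y : ι → N) (s : W) :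
    LocalizedModule.mk (∑ n ∈ F, y n) s = ∑ n ∈ F, LocalizedModule.mk (y n) s := by
  classical
  induction F using Finset.induction_on with
  | empty => simp
  | insert a F ha ih =>
    rw [Finset.sum_insert ha, Finset.sum_insert ha, ← ih]
    simp only [IsLocalizedModule.mk_eq_mk', IsLocalizedModule.mk'_add]

variable {r : ℕ} (f : Fin r → R)

section

variable [SetLike.GradedMonoid 𝒜]

variable (𝒜 𝒩) in
/-- The component of degree `n` of the localization `N_{f_S}`. -/
def localizedPiece (hsm : GradedSMul 𝒜 𝒩) (S : Finset (Fin r)) (n : ℤ) :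
    AddSubgroup (CechLocalization f N S) where
  carrier := {x | ∃ (l : ℕ) (m : N) (s : cechMonoid f S), m ∈ 𝒩 (n + l) ∧ (s : R) ∈ 𝒜 l ∧
    x = LocalizedModule.mk m s}
  zero_mem' := ⟨0, 0, 1, zero_mem _, SetLike.GradedOne.one_mem, (LocalizedModule.zero_mk 1).symm⟩
  neg_mem' := by
    rintro _ ⟨l, m, s, hm, hs, rfl⟩
    exact ⟨l, -m, s, neg_mem hm, hs, LocalizedModule.mk_neg.symm⟩
  add_mem' := by
    rintro _ _ ⟨l, m, s, hm, hs, rfl⟩ ⟨l', m', s', hm', hs', rfl⟩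
    refine ⟨l + l', s' • m + s • m', s * s', add_mem ?_ ?_, SetLike.GradedMul.mul_mem hs hs',
      LocalizedModule.mk_add_mk⟩
    · have := hsm l' _ _ hs' m hm
      rwa [add_assoc, ← Nat.cast_add] at this
    · have := hsm l _ _ hs m' hm'
      rwa [add_assoc, ← Nat.cast_add, add_comm l' l] at this

theorem exists_degree_of_mem_cechMonoid (hf : ∀ i, ∃ n, f i ∈ 𝒜 n) {S : Finset (Fin r)} {s : R}
    (hs : s ∈ cechMonoid f S) : ∃ l, s ∈ 𝒜 l := by
  refine Submonoid.closure_induction ?_ ⟨0, SetLike.GradedOne.one_mem⟩ ?_ hs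
  · rintro _ ⟨i, -, rfl⟩
    exact hf i
  · rintro x y _ _ ⟨l, hl⟩ ⟨l', hl'⟩
    exact ⟨l + l', SetLike.GradedMul.mul_mem hl hl'⟩

/-- With one homogeneous denominator, independence of the degrees in the localization reduces to
independence of the numerators in `N`. -/
theorem exists_common_denominator (hsm : GradedSMul 𝒜 𝒩) (S : Finset (Fin r)) (F : Finset ℤ)
    (y : ℤ → CechLocalization f N S) (hy : ∀ n ∈ F, y n ∈ localizedPiece 𝒜 𝒩 f hsm S n) :
    ∃ (l : ℕ) (s : cechMonoid f S), (s : R) ∈ 𝒜 l ∧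
      ∀ n ∈ F, ∃ m ∈ 𝒩 (n + l), y n = LocalizedModule.mk m s := by
  classical
  induction F using Finset.induction_on with
  | empty => exact ⟨0, 1, SetLike.GradedOne.one_mem, by simp⟩
  | insert a F ha ih =>
    obtain ⟨l, s, hs, h⟩ := ih fun n hn => hy n (Finset.mem_insert_of_mem hn)
    obtain ⟨l', m', s', hm', hs', h'⟩ := hy a (Finset.mem_insert_self a F)
    refine ⟨l + l', s * s', SetLike.GradedMul.mul_mem hs hs', fun n hn => ?_⟩
    rcases Finset.mem_insert.1 hn with rfl | hn
    · refine ⟨s • m', ?_, ?_⟩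
      · have := hsm l _ _ hs m' hm'
        rwa [add_assoc, ← Nat.cast_add, add_comm l' l] at this
      · rw [h', LocalizedModule.mk_cancel_common_left]
    · obtain ⟨m, hm, hmn⟩ := h n hn
      refine ⟨s' • m, ?_, ?_⟩
      · have := hsm l' _ _ hs' m hm
        rwa [add_assoc, ← Nat.cast_add] at this
      · rw [hmn, LocalizedModule.mk_cancel_common_right]

theorem GradedProj.localized (P : GradedProj 𝒩) (hsm : GradedSMul 𝒜 𝒩) (hf : ∀ i, ∃ n, f i ∈ 𝒜 n)
    (S : Finset (Fin r)) : Nonempty (GradedProj (localizedPiece 𝒜 𝒩 f hsm S)) := by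
  refine GradedProj.nonempty_of_span_of_indep (fun x => ?_) fun F y hy h0 n hn => ?_
  · induction x using LocalizedModule.induction_on with
    | h m s =>
      obtain ⟨l, hl⟩ := exists_degree_of_mem_cechMonoid f hf s.2
      obtain ⟨F, hF⟩ := P.exists_sum m
      refine ⟨F.image (· - (l : ℤ)), fun n => LocalizedModule.mk (P.proj (n + l) m) s,
        fun n => ⟨l, _, s, P.proj_mem _ _, hl, rfl⟩, ?_⟩
      rw [Finset.sum_image (by simp)]
      simp only [sub_add_cancel]
      conv_lhs => rw [hF]
      rw [localizedModule_mk_sum]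
  · obtain ⟨l, s, hs, h⟩ := exists_common_denominator f hsm S F y hy
    have : ∀ n, ∃ z ∈ 𝒩 (n + l), n ∈ F → y n = LocalizedModule.mk z s := fun n => by
      by_cases hn : n ∈ F
      · obtain ⟨z, hz, hzy⟩ := h n hn
        exact ⟨z, hz, fun _ => hzy⟩
      · exact ⟨0, zero_mem _, fun h => absurd h hn⟩
    choose z hz hzy using this
    have h1 : LocalizedModule.mk (∑ n ∈ F, z n) s = 0 := by
      rw [← h0, Finset.sum_congr rfl fun n hn => hzy n hn]
      rw [localizedModule_mk_sum]
    rw [← LocalizedModule.zero_mk 1, LocalizedModule.mk_eq] at h1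
    obtain ⟨u, hu⟩ := h1
    simp only [one_smul, smul_zero, Finset.smul_sum] at hu
    obtain ⟨k, hk⟩ := exists_degree_of_mem_cechMonoid f hf u.2
    -- The annihilating element `u` is homogeneous of degree `k`, so the relation splits into its
    -- homogeneous parts.
    have h2 : P.proj (n + l + k) (∑ m ∈ F, u • z m) = u • z n := by
      rw [map_sum, Finset.sum_eq_single_of_mem n hn]
      · exact P.proj_self _ _ (hsm k _ _ hk _ (hz n))
      · intro m _ hmn
        exact P.proj_ne _ (m + l + k) (by omega) _ (hsm k _ _ hk _ (hz m))
    rw [hu, map_zero] at h2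
    rw [hzy n hn, ← LocalizedModule.zero_mk 1, LocalizedModule.mk_eq]
    exact ⟨u, by rw [one_smul, smul_zero, smul_zero, ← h2]⟩

variable (𝒜 𝒩) in
/-- The families of elements of degree `n` of the localizations `N_{f_S}`. -/
def cechTotalPiece (hsm : GradedSMul 𝒜 𝒩) (n : ℤ) : AddSubgroup (CechTotal f N) :=
  AddSubgroup.pi Set.univ fun S => localizedPiece 𝒜 𝒩 f hsm S n

theorem mem_cechTotalPiece {hsm : GradedSMul 𝒜 𝒩} {n : ℤ} {c : CechTotal f N} :
    c ∈ cechTotalPiece 𝒜 𝒩 f hsm n ↔ ∀ S, c S ∈ localizedPiece 𝒜 𝒩 f hsm S n :=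
  ⟨fun h S => h S trivial, fun h S _ => h S⟩

theorem GradedProj.cechTotal (P : GradedProj 𝒩) (hsm : GradedSMul 𝒜 𝒩)
    (hf : ∀ i, ∃ n, f i ∈ 𝒜 n) : Nonempty (GradedProj (cechTotalPiece 𝒜 𝒩 f hsm)) := by
  classical
  have Q := fun S => (P.localized f hsm hf S).some
  refine ⟨⟨fun n => ⟨⟨fun c S => (Q S).proj n (c S), funext fun S => map_zero _⟩,
    fun a b => funext fun S => map_add _ _ _⟩, fun n c => ?_, fun n c hc => ?_,
    fun m n hmn c hc => ?_, fun c => ?_⟩⟩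
  · exact (mem_cechTotalPiece f).2 fun S => (Q S).proj_mem n (c S)
  · exact funext fun S => (Q S).proj_self n _ ((mem_cechTotalPiece f).1 hc S)
  · exact funext fun S => (Q S).proj_ne m n hmn _ ((mem_cechTotalPiece f).1 hc S)
  · choose F hF using fun S => (Q S).exists_sum (c S)
    refine ⟨Finset.univ.biUnion F, funext fun S => ?_⟩
    rw [Finset.sum_apply]
    exact (Q S).eq_sum_of_subset (Finset.subset_biUnion_of_mem F (Finset.mem_univ S)) (hF S)

theorem cechRestrict_mem_piece {hsm : GradedSMul 𝒜 𝒩} {S T : Finset (Fin r)} (h : S ⊆ T) {n : ℤ}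
    {x : CechLocalization f N S} (hx : x ∈ localizedPiece 𝒜 𝒩 f hsm S n) :
    cechRestrict f N h x ∈ localizedPiece 𝒜 𝒩 f hsm T n := by
  obtain ⟨l, m, s, hm, hs, rfl⟩ := hx
  exact ⟨l, m, _, hm, hs, cechRestrict_mk f h m s⟩

theorem cechDifferential_mem_piece {hsm : GradedSMul 𝒜 𝒩} {n : ℤ} {c : CechTotal f N}
    (hc : c ∈ cechTotalPiece 𝒜 𝒩 f hsm n) :
    cechDifferential f N c ∈ cechTotalPiece 𝒜 𝒩 f hsm n := by
  rw [mem_cechTotalPiece] at hc ⊢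
  intro T
  rw [cechDifferential_apply]
  refine sum_mem fun i _ => ?_
  have h := cechRestrict_mem_piece f (T.erase_subset i) (hc (T.erase i))
  rcases neg_one_pow_eq_or R ((T.filter (· < i)).card) with h1 | h1 <;> rw [h1]
  · rwa [one_smul]
  · rw [neg_smul, one_smul]
    exact neg_mem h

theorem smul_mem_cechTotalPiece {hsm : GradedSMul 𝒜 𝒩} {l : ℕ} {x : R} (hx : x ∈ 𝒜 l) {n : ℤ}
    {c : CechTotal f N} (hc : c ∈ cechTotalPiece 𝒜 𝒩 f hsm n) :
    x • c ∈ cechTotalPiece 𝒜 𝒩 f hsm (n + l) := by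
  rw [mem_cechTotalPiece] at hc ⊢
  intro T
  obtain ⟨k, m, s, hm, hs, h⟩ := hc T
  refine ⟨k, x • m, s, ?_, hs, by rw [Pi.smul_apply, h, LocalizedModule.smul'_mk]⟩
  have := hsm l _ _ hx m hm
  rwa [add_right_comm] at this

variable (𝒜 𝒩) in
/-- The component of degree `n` of the Čech cohomology of `N`. -/
noncomputable def cohomologyPiece (hsm : GradedSMul 𝒜 𝒩) (p : ℕ) (n : ℤ) :
    AddSubgroup (CechLocalCohomology f N p) :=
  ((cechTotalPiece 𝒜 𝒩 f hsm n).comap (cechCocycles f N p).subtype.toAddMonoidHom).map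
    ((cechCoboundaries f N p).submoduleOf (cechCocycles f N p)).mkQ.toAddMonoidHom

theorem mem_cohomologyPiece {hsm : GradedSMul 𝒜 𝒩} {p : ℕ} {n : ℤ} {h : CechLocalCohomology f N p} :
    h ∈ cohomologyPiece 𝒜 𝒩 f hsm p n ↔ ∃ c : cechCocycles f N p,
      (c : CechTotal f N) ∈ cechTotalPiece 𝒜 𝒩 f hsm n ∧ cechClass f c = h := Iff.rfl

theorem smul_mem_cohomologyPiece {hsm : GradedSMul 𝒜 𝒩} {p : ℕ} {l : ℕ} {x : R} (hx : x ∈ 𝒜 l)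
    {n : ℤ} {h : CechLocalCohomology f N p} (hh : h ∈ cohomologyPiece 𝒜 𝒩 f hsm p n) :
    x • h ∈ cohomologyPiece 𝒜 𝒩 f hsm p (n + l) := by
  obtain ⟨c, hc, rfl⟩ := (mem_cohomologyPiece f).1 hh
  exact (mem_cohomologyPiece f).2 ⟨x • c, smul_mem_cechTotalPiece f hx hc, rfl⟩

/-- The degrees are independent in cohomology: the differential preserves degree, so the degree `n`
part of a primitive of `c - ∑ z m` is a primitive of `c` itself. -/
theorem eq_zero_of_mem_cohomologyPiece (P : GradedProj 𝒩) {hsm : GradedSMul 𝒜 𝒩}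
    (hf : ∀ i, ∃ n, f i ∈ 𝒜 n) {p : ℕ} {F : Finset ℤ} {n : ℤ} (hn : n ∉ F)
    {h : CechLocalCohomology f N p} (hh : h ∈ cohomologyPiece 𝒜 𝒩 f hsm p n)
    {g : ℤ → CechLocalCohomology f N p} (hg : ∀ m ∈ F, g m ∈ cohomologyPiece 𝒜 𝒩 f hsm p m)
    (hsum : h = ∑ m ∈ F, g m) : h = 0 := by
  obtain ⟨Q⟩ := P.cechTotal f hsm hf
  obtain ⟨c, hc, rfl⟩ := (mem_cohomologyPiece f).1 hh
  have : ∀ m, ∃ z : cechCocycles f N p, (z : CechTotal f N) ∈ cechTotalPiece 𝒜 𝒩 f hsm m ∧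
      (m ∈ F → cechClass f z = g m) := fun m => by
    by_cases hm : m ∈ F
    · obtain ⟨z, hz, hzg⟩ := (mem_cohomologyPiece f).1 (hg m hm)
      exact ⟨z, hz, fun _ => hzg⟩
    · exact ⟨0, zero_mem _, fun h => absurd h hm⟩
  choose z hz hzg using this
  have h1 : cechClass f (c - ∑ m ∈ F, z m) = 0 := by
    change Submodule.mkQ _ (c - ∑ m ∈ F, z m) = 0
    rw [map_sub, map_sum, sub_eq_zero]
    exact hsum.trans (Finset.sum_congr rfl fun m hm => (hzg m hm).symm)
  obtain ⟨b, hb⟩ := (cechClass_eq_zero f _).1 h1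
  rw [cechClass_eq_zero]
  refine ⟨Q.proj n b, ?_⟩
  have h2 := Q.map_proj Q (cechDifferential f N).toAddMonoidHom 0
    (fun k x hx => by rw [add_zero]; exact cechDifferential_mem_piece f hx) n b
  rw [add_zero] at h2
  change cechDifferential f N (Q.proj n b) = Q.proj n (cechDifferential f N b) at h2
  rw [h2, hb, Submodule.coe_sub, Submodule.coe_sum, map_sub, Q.proj_self n _ hc, map_sum,
    Finset.sum_eq_zero, sub_zero]
  exact fun m hm => Q.proj_ne n m (by rintro rfl; exact hn hm) _ (hz m)

theorem exists_lift_mem_piece {hsm : GradedSMul 𝒜 𝒩} {x : R} {p : ℕ} {n : ℤ}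
    {c : CechTotal f (QuotSMulTop x N)} (hc : c ∈ cechCochains f (QuotSMulTop x N) p)
    (hcn : c ∈ cechTotalPiece 𝒜 (quotSMulTopPiece x 𝒩) f (hsm.quotSMulTop x) n) :
    ∃ b ∈ cechCochains f N p, b ∈ cechTotalPiece 𝒜 𝒩 f hsm n ∧
      cechMap f (Submodule.mkQ (x • (⊤ : Submodule R N))) b = c := by
  rw [mem_cechTotalPiece] at hcn
  choose l m s hm hs hms using hcn
  choose z hz hzm using hm
  let b : CechTotal f N := fun S => LocalizedModule.mk (z S) (s S)
  have hb : b ∈ cechTotalPiece 𝒜 𝒩 f hsm n :=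
    (mem_cechTotalPiece f).2 fun S => ⟨l S, z S, s S, hz S, hs S, rfl⟩
  have hbc : cechMap f (Submodule.mkQ (x • (⊤ : Submodule R N))) b = c := funext fun S => by
    rw [cechMap_apply_of_eq_mk f _ rfl, hms S, ← hzm S]
    rfl
  refine ⟨cechTruncate f p b, cechTruncate_mem f p b, (mem_cechTotalPiece f).2 fun S => ?_,
    funext fun S => ?_⟩
  · by_cases hS : S.card = p
    · have : cechTruncate f p b S = b S := if_pos hS
      rw [this]
      exact (mem_cechTotalPiece f).1 hb S
    · have : cechTruncate f p b S = 0 := if_neg hS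
      rw [this]
      exact zero_mem _
  · by_cases hS : S.card = p
    · rw [← hbc]
      have : cechTruncate f p b S = b S := if_pos hS
      change IsLocalizedModule.map _ _ _ _ (cechTruncate f p b S) = _
      rw [this]
      rfl
    · rw [hc S hS, cechMap_mem f (cechTruncate_mem f p b) S hS]

theorem exists_graded_connecting (P : GradedProj 𝒩) (hsm : GradedSMul 𝒜 𝒩)
    (hf : ∀ i, ∃ n, f i ∈ 𝒜 n) {x : R} (hx : IsSMulRegular N x) (hx1 : x ∈ 𝒜 1) (p : ℕ) :
    ∃ δ : CechLocalCohomology f (QuotSMulTop x N) p →ₗ[R] CechLocalCohomology f N (p + 1),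
      (∀ (n : ℤ), ∀ h ∈ cohomologyPiece 𝒜 (quotSMulTopPiece x 𝒩) f (hsm.quotSMulTop x) p n,
        δ h ∈ cohomologyPiece 𝒜 𝒩 f hsm (p + 1) (n - 1)) ∧
      (∀ h, h ∈ LinearMap.range δ ↔ x • h = 0) ∧
      (CechVanishes f N p → Function.Injective δ) := by
  obtain ⟨δ, hδ, h1, h2⟩ := exists_connecting f hx p
  refine ⟨δ, fun n h hh => ?_, h1, h2⟩
  obtain ⟨Q⟩ := P.cechTotal f hsm hf
  obtain ⟨c', hc', rfl⟩ := (mem_cohomologyPiece f).1 hh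
  obtain ⟨c, hc, hcn, hcc'⟩ := exists_lift_mem_piece f c'.2.1 hc'
  obtain ⟨e, he, hce⟩ := exists_smul_eq_differential f hx hc
    (by rw [hcc']; exact ((mem_cechCocycles f).1 c'.2).2)
  rw [hδ c hc ⟨e, he⟩ c' hcc' hce]
  refine (mem_cohomologyPiece f).2 ⟨⟨e, he⟩, ?_, rfl⟩
  -- `x • e` is homogeneous of degree `n` and `x` is injective of degree one, hence `e` equals its
  -- part of degree `n - 1`.
  have h3 : Q.proj (n - 1) e = e := smul_cechTotal_injective f hx (by
    have := Q.map_proj Q (DistribSMul.toAddMonoidHom _ x) (1 : ℕ)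
      (fun k y hy => smul_mem_cechTotalPiece f hx1 hy) (n - 1) e
    simp only [DistribSMul.toAddMonoidHom_apply, Nat.cast_one, sub_add_cancel] at this
    simp only
    rw [this, ← hce, Q.proj_self n _ (cechDifferential_mem_piece f hcn)])
  simp only
  rw [← h3]
  exact Q.proj_mem _ _

/-- On a torsion module every element is a 0-cocycle and only `0` is a 0-coboundary. This starts the
induction for the socle map. -/
theorem exists_torsion_equiv_zero (hsm : GradedSMul 𝒜 𝒩)
    (ht : ∀ i, ∀ y : N, ∃ n : ℕ, f i ^ n • y = 0) :
    ∃ φ : N →ₗ[R] CechLocalCohomology f N 0, Function.Bijective φ ∧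
      ∀ n, ∀ m ∈ 𝒩 n, φ m ∈ cohomologyPiece 𝒜 𝒩 f hsm 0 n := by
  have hC := fun m => cechAugment_mem_cocycles f (m := m) fun i => ht i m
  refine ⟨(Submodule.mkQ _).comp ((cechAugment f).codRestrict _ hC), ⟨?_, ?_⟩, ?_⟩
  · rw [injective_iff_map_eq_zero]
    intro m hm
    exact eq_zero_of_cechAugment_mem_range f (hC m).1
      ((cechClass_eq_zero f (⟨cechAugment f m, hC m⟩ : cechCocycles f N 0)).1 hm)
  · intro h
    obtain ⟨c, rfl⟩ := Submodule.Quotient.mk_surjective _ h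
    obtain ⟨⟨m, s⟩, hm⟩ : ∃ q : N × cechMonoid f (∅ : Finset (Fin r)),
        (c : CechTotal f N) ∅ = LocalizedModule.mk q.1 q.2 := by
      generalize (c : CechTotal f N) ∅ = y
      induction y using LocalizedModule.induction_on with
      | h m s => exact ⟨(m, s), rfl⟩
    refine ⟨m, ?_⟩
    change cechClass f ⟨cechAugment f m, hC m⟩ = cechClass f c
    congr 1
    refine Subtype.ext (funext fun S => ?_)
    by_cases hS : S = ∅
    · subst hS
      simp only
      rw [cechAugment_empty, hm, eq_one_of_cechMonoid_empty f s]
    · simp only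
      rw [cechAugment_of_ne f m hS, c.2.1 S (by simpa using hS)]
  · intro n m hm
    refine (mem_cohomologyPiece f).2
      ⟨⟨cechAugment f m, hC m⟩, (mem_cechTotalPiece f).2 fun S => ?_, rfl⟩
    by_cases hS : S = ∅
    · subst hS
      exact ⟨0, m, 1, by simpa using hm, SetLike.GradedOne.one_mem, cechAugment_empty f m⟩
    · simp only
      rw [cechAugment_of_ne f m hS]
      exact zero_mem _

/-- `φ` is a composite of connecting maps. Each is injective because the cohomology of the middle
term vanishes below the length of the remaining regular sequence, each has image the elements killed
by the current `x`, and each lowers degrees by one. -/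
theorem exists_socle_map (hf : ∀ i, ∃ n, f i ∈ 𝒜 n) (xs : List R) (P : GradedProj 𝒩)
    (hsm : GradedSMul 𝒜 𝒩) (hxs : ∀ x ∈ xs, x ∈ 𝒜 1)
    (hxf : ∀ x ∈ xs, x ∈ (Ideal.span (Set.range f)).radical) (hreg : IsWeaklyRegular N xs)
    (ht : ∀ i, ∀ y : N ⧸ (Ideal.ofList xs • ⊤ : Submodule R N), ∃ n : ℕ, f i ^ n • y = 0) :
    ∃ φ : (N ⧸ (Ideal.ofList xs • ⊤ : Submodule R N)) →ₗ[R] CechLocalCohomology f N xs.length,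
      Function.Injective φ ∧ (∀ h, h ∈ LinearMap.range φ ↔ ∀ x ∈ xs, x • h = 0) ∧
      ∀ n, ∀ m ∈ 𝒩 n, φ (Submodule.Quotient.mk m) ∈
        cohomologyPiece 𝒜 𝒩 f hsm xs.length (n - xs.length) := by
  induction xs generalizing N with
  | nil =>
    let e : (N ⧸ (Ideal.ofList [] • ⊤ : Submodule R N)) ≃ₗ[R] N :=
      Submodule.quotEquivOfEqBot (Ideal.ofList [] • ⊤ : Submodule R N)
        ((congrArg (· • (⊤ : Submodule R N)) (Ideal.ofList_nil (R := R))).trans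
          (Submodule.bot_smul _))
    have he : ∀ m, e (Submodule.Quotient.mk m) = m := fun m => rfl
    obtain ⟨φ, hφ, hn⟩ := exists_torsion_equiv_zero f hsm fun i y => by
      obtain ⟨n, hn⟩ := ht i (Submodule.Quotient.mk y)
      exact ⟨n, by rw [← he (f i ^ n • y), Submodule.Quotient.mk_smul, hn, map_zero]⟩
    refine ⟨φ.comp e.toLinearMap, hφ.1.comp e.injective, fun h => ?_, fun n m hm => ?_⟩
    · simp only [List.not_mem_nil, false_imp_iff, implies_true, iff_true]
      rw [LinearMap.range_comp, LinearEquiv.range, Submodule.map_top]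
      exact hφ.2 h
    · have := hn n m hm
      simpa [he] using this
  | cons x xs ih =>
    rw [isWeaklyRegular_cons_iff] at hreg
    have hx1 := hxs x List.mem_cons_self
    obtain ⟨P'⟩ := P.quotSMulTop hsm hx1
    let e := Submodule.quotOfListConsSMulTopEquivQuotSMulTopInner N x xs
    have he : ∀ m, e (Submodule.Quotient.mk m) =
        Submodule.Quotient.mk (Submodule.Quotient.mk m) := fun m => rfl
    obtain ⟨φ, hφ1, hφ2, hφ3⟩ := ih P' (hsm.quotSMulTop x)
      (fun y hy => hxs y (List.mem_cons_of_mem x hy)) (fun y hy => hxf y (List.mem_cons_of_mem x hy))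
      hreg.2 fun i y => by
        obtain ⟨n, hn⟩ := ht i (e.symm y)
        exact ⟨n, by rw [← e.apply_symm_apply y, ← map_smul, hn, map_zero]⟩
    obtain ⟨δ, hδ1, hδ2, hδ3⟩ := exists_graded_connecting f P hsm hf hreg.1 hx1 xs.length
    have hδ := hδ3 (cechVanishes_of_isWeaklyRegular f (xs := x :: xs)
      ((isWeaklyRegular_cons_iff N x xs).2 hreg) hxf (by simp))
    refine ⟨(δ.comp φ).comp e.toLinearMap, (hδ.comp hφ1).comp e.injective, fun h => ?_,
      fun n m hm => ?_⟩
    · rw [LinearMap.range_comp, LinearEquiv.range, Submodule.map_top, LinearMap.range_comp]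
      constructor
      · rintro ⟨g, hg, rfl⟩ y hy
        rcases List.mem_cons.1 hy with rfl | hy
        · exact (hδ2 _).1 ⟨g, rfl⟩
        · rw [← map_smul, (hφ2 g).1 hg y hy, map_zero]
      · intro hh
        obtain ⟨g, rfl⟩ := (hδ2 h).2 (hh x List.mem_cons_self)
        refine ⟨g, (hφ2 g).2 fun y hy => hδ ?_, rfl⟩
        rw [map_smul, hh y (List.mem_cons_of_mem x hy), map_zero]
    · have := hδ1 _ _ (hφ3 n (Submodule.Quotient.mk m) ⟨m, hm, rfl⟩)
      rw [sub_sub] at this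
      simpa [he] using this

end

end Graded

/-! ### Systems of parameters are regular sequences -/

section Parameters

open RingTheory.Sequence IsLocalRing
open scoped Pointwise

variable {B : Type*} [CommRing B] [IsLocalRing B] [IsNoetherianRing B] {r : ℕ} {f : Fin r → B}

/-- If the maximal ideal consisted of zero divisors on `N`, prime avoidance would place it inside an
associated prime, and the element with that annihilator would be torsion, giving a nonzero class in
`H^0`. -/
theorem exists_isSMulRegular_of_cechVanishes (hf : Ideal.span (Set.range f) = maximalIdeal B)
    {N : Type*} [AddCommGroup N] [Module B N] [Module.Finite B N] (h : CechVanishes f N 0) :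
    ∃ y ∈ maximalIdeal B, IsSMulRegular N y := by
  by_contra! hy
  have h1 : (maximalIdeal B : Set B) ⊆ ⋃ p ∈ associatedPrimes B N, p := by
    rw [biUnion_associatedPrimes_eq_compl_regular]
    exact fun y hym => hy y hym
  obtain ⟨p, hp, hmp⟩ := (Ideal.subset_union_prime_finite (associatedPrimes.finite B N) (f := id)
    ⊥ ⊥ fun p hp _ _ => hp.isPrime).1 h1
  obtain ⟨hpp, x, hx⟩ := (isAssociatedPrime_iff (I := p)).1 hp
  have h2 : x = 0 := h.eq_zero_of_torsion f fun i => ⟨1, by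
    have : f i ∈ p := hmp (hf ▸ Ideal.subset_span ⟨i, rfl⟩)
    rw [hx, Submodule.mem_colon_singleton] at this
    simpa using this⟩
  apply hpp.ne_top
  rw [hx, h2, Ideal.eq_top_iff_one, Submodule.mem_colon_singleton]
  simp

/-- This is `depth N ≤ dim B/p` for associated primes `p`, with depth measured by Čech vanishing.
For a regular `y`, the submodule `L` killed by `p` has nonzero image in `N/yN`. That image produces
an associated prime `q ⊇ p + (y)` of `N/yN`, strictly larger than `p`, and induction applies. -/
theorem le_ringKrullDim_quotient_of_isAssociatedPrime
    (hf : Ideal.span (Set.range f) = maximalIdeal B) (k : ℕ)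
    {N : Type*} [AddCommGroup N] [Module B N] [Module.Finite B N]
    (h : ∀ i < k, CechVanishes f N i) {p : Ideal B} (hp : IsAssociatedPrime p N) :
    (k : WithBot ℕ∞) ≤ ringKrullDim (B ⧸ p) := by
  induction k generalizing N p with
  | zero =>
    have := hp.isPrime
    simpa using ringKrullDim_nonneg_of_nontrivial (R := B ⧸ p)
  | succ k ih =>
    obtain ⟨y, hym, hy⟩ := exists_isSMulRegular_of_cechVanishes hf (h 0 (Nat.succ_pos k))
    obtain ⟨hpp, x, hx⟩ := (isAssociatedPrime_iff (I := p)).1 hp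
    have hmem : ∀ b, b ∈ p ↔ b • x = 0 := fun b => by
      rw [hx, Submodule.mem_colon_singleton, Submodule.mem_bot]
    have hx0 : x ≠ 0 := by
      rintro rfl
      exact hpp.ne_top ((Ideal.eq_top_iff_one _).2 ((hmem 1).2 (smul_zero _)))
    have hyp : y ∉ p := fun hyp => hx0 (hy (by simpa using (hmem y).1 hyp))
    let L : Submodule B N := Submodule.torsionBySet B N (p : Set B)
    have hL : ∀ n, n ∈ L ↔ ∀ b ∈ p, b • n = 0 := fun n =>
      (Submodule.mem_torsionBySet_iff _ _).trans ⟨fun h b hb => h ⟨b, hb⟩, fun h b => h b b.2⟩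
    -- If `L ⊆ yN`, regularity of `y` shows that the quotients by `y` again lie in `L`, so `L = yL`,
    -- and Nakayama contradicts `x ∈ L`.
    obtain ⟨n, hnL, hn⟩ : ∃ n ∈ L, n ∉ y • (⊤ : Submodule B N) := by
      by_contra! hcon
      have : L ≤ maximalIdeal B • L := fun n hn => by
        obtain ⟨m, -, rfl⟩ := (Submodule.mem_smul_pointwise_iff_exists _ _ _).1 (hcon n hn)
        refine Submodule.smul_mem_smul hym ((hL m).2 fun b hb => hy ?_)
        simp only [smul_zero]
        rw [smul_comm, (hL _).1 hn b hb]
      have hbot := Submodule.eq_bot_of_le_smul_of_le_jacobson_bot _ L (IsNoetherian.noetherian L)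
        this (maximalIdeal_le_jacobson ⊥)
      have hxL : x ∈ L := (hL x).2 fun b hb => (hmem b).1 hb
      rw [hbot, Submodule.mem_bot] at hxL
      exact hx0 hxL
    obtain ⟨q, hq, hqle⟩ := exists_le_isAssociatedPrime_of_isNoetherianRing B
      (Submodule.Quotient.mk n : QuotSMulTop y N)
      (fun h0 => hn ((Submodule.Quotient.mk_eq_zero _).1 h0))
    have hpq : p ≤ q := fun b hb => hqle (by
      rw [Submodule.mem_colon_singleton, ← Submodule.Quotient.mk_smul, (hL n).1 hnL b hb]
      simp)
    have hyq : y ∈ q := hqle (by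
      rw [Submodule.mem_colon_singleton, ← Submodule.Quotient.mk_smul, Submodule.mem_bot,
        Submodule.Quotient.mk_eq_zero]
      exact Submodule.smul_mem_pointwise_smul _ _ _ trivial)
    have h1 := ih (fun i hi => (h i (by omega)).quotSMulTop f hy (h (i + 1) (by omega))) hq
    have h2 : ringKrullDim (B ⧸ q) + 1 ≤ ringKrullDim (B ⧸ p) := by
      refine ringKrullDim_succ_le_of_surjective (Ideal.Quotient.factor hpq)
        (Ideal.Quotient.factor_surjective hpq) (r := Ideal.Quotient.mk p y) ?_ ?_
      · exact mem_nonZeroDivisors_of_ne_zero fun h0 => hyp (Ideal.Quotient.eq_zero_iff_mem.1 h0)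
      · simpa using Ideal.Quotient.eq_zero_iff_mem.2 hyq
    refine le_trans ?_ h2
    rw [Nat.cast_succ]
    gcongr

theorem ringKrullDim_quotient_le_length (p : Ideal B) [hp : p.IsPrime] (bs : List B)
    (hbs : ∀ b ∈ bs, b ∈ maximalIdeal B)
    (h : ∀ q : Ideal B, q.IsPrime → p ≤ q → Ideal.ofList bs ≤ q → q = maximalIdeal B) :
    ringKrullDim (B ⧸ p) ≤ bs.length := by
  classical
  have : IsLocalRing (B ⧸ p) := .of_surjective' (Ideal.Quotient.mk p) Ideal.Quotient.mk_surjective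
  have hm : (maximalIdeal (B ⧸ p)).comap (Ideal.Quotient.mk p) = maximalIdeal B :=
    eq_maximalIdeal (Ideal.comap_isMaximal_of_surjective _ Ideal.Quotient.mk_surjective)
  rw [← maximalIdeal_height_eq_ringKrullDim]
  have hle : (maximalIdeal (B ⧸ p)).height ≤ ((bs.map (Ideal.Quotient.mk p)).toFinset.card : ℕ∞) := by
    refine Ideal.height_le_card_of_mem_minimalPrimes_span_finset ⟨⟨inferInstance, ?_⟩, ?_⟩
    · rw [Ideal.span_le]
      intro x hx
      simp only [List.coe_toFinset, List.mem_map, Set.mem_ofPred_eq] at hx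
      obtain ⟨b, hb, rfl⟩ := hx
      rw [SetLike.mem_coe, ← Ideal.mem_comap, hm]
      exact hbs b hb
    · rintro q ⟨hq, hq2⟩ -
      have h1 := h (q.comap (Ideal.Quotient.mk p)) inferInstance (fun x hx => by
        rw [Ideal.mem_comap, Ideal.Quotient.eq_zero_iff_mem.2 hx]
        exact zero_mem _) (Ideal.span_le.2 fun b hb => hq2 (Ideal.subset_span (by
          simp only [List.coe_toFinset, List.mem_map, Set.mem_ofPred_eq]
          exact ⟨b, hb, rfl⟩)))
      rw [← hm] at h1
      exact (Ideal.comap_injective_of_surjective _ Ideal.Quotient.mk_surjective h1).ge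
  have h2 : (bs.map (Ideal.Quotient.mk p)).toFinset.card ≤ bs.length :=
    (List.toFinset_card_le _).trans (by simp)
  exact_mod_cast hle.trans (Nat.cast_le.2 h2)

/-- A zero divisor `b` would lie in an associated prime `p`. Vanishing gives `dim B/p ≥ bs.length +
1`, whereas the remaining `bs` already cut `B/p` down to its closed point, so `dim B/p ≤ bs.length`.
-/
theorem isWeaklyRegular_of_cechVanishes (hf : Ideal.span (Set.range f) = maximalIdeal B)
    (bs : List B) (hbs : ∀ b ∈ bs, b ∈ maximalIdeal B)
    {N : Type*} [AddCommGroup N] [Module B N] [Module.Finite B N]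
    (h : ∀ i < bs.length, CechVanishes f N i)
    (hq : ∀ q : Ideal B, q.IsPrime → Module.annihilator B N ≤ q → Ideal.ofList bs ≤ q →
      q = maximalIdeal B) :
    IsWeaklyRegular N bs := by
  induction bs generalizing N with
  | nil => exact IsWeaklyRegular.nil B N
  | cons b bs ih =>
    have hb : IsSMulRegular N b := by
      by_contra hb
      have h1 : b ∈ ⋃ p ∈ associatedPrimes B N, (p : Set B) := by
        rw [biUnion_associatedPrimes_eq_compl_regular]
        exact hb
      simp only [Set.mem_iUnion, SetLike.mem_coe, exists_prop] at h1
      obtain ⟨p, hp, hbp⟩ := h1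
      have hpp := hp.isPrime
      have h2 := le_ringKrullDim_quotient_of_isAssociatedPrime hf _ h hp
      have h3 := ringKrullDim_quotient_le_length p bs
        (fun b hb => hbs b (List.mem_cons_of_mem _ hb)) fun q hqp hpq hbq =>
          hq q hqp ((Submodule.annihilator_top.ge.trans hp.annihilator_le).trans hpq) (by
            rw [Ideal.ofList_cons, sup_le_iff, Ideal.span_singleton_le_iff_mem]
            exact ⟨hpq hbp, hbq⟩)
      have h4 := h2.trans h3
      rw [List.length_cons] at h4
      norm_cast at h4
      omega
    refine IsWeaklyRegular.cons hb (ih (fun b hb => hbs b (List.mem_cons_of_mem _ hb))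
      (fun i hi => (h i (by simp; omega)).quotSMulTop f hb (h (i + 1) (by simpa using hi)))
      fun q hqp hqa hqb => hq q hqp ?_ ?_)
    · exact le_trans ((Submodule.mkQ (b • (⊤ : Submodule B N))).annihilator_le_of_surjective
        (Submodule.mkQ_surjective _)) hqa
    · rw [Ideal.ofList_cons, sup_le_iff, Ideal.span_singleton_le_iff_mem]
      exact ⟨hqa (QuotSMulTop.mem_annihilator N b), hqb⟩

/-- Čech vanishing does not refer to a particular regular sequence, so it carries depth from `xs` to
`bs`. -/
theorem isWeaklyRegular_of_isWeaklyRegular {xs bs : List B} (hx : IsWeaklyRegular B xs)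
    (hxs : ∀ x ∈ xs, x ∈ maximalIdeal B) (hbs : ∀ b ∈ bs, b ∈ maximalIdeal B)
    (hlen : bs.length ≤ xs.length)
    (hq : ∀ q : Ideal B, q.IsPrime → Ideal.ofList bs ≤ q → q = maximalIdeal B) :
    IsWeaklyRegular B bs := by
  obtain ⟨r, f, hf⟩ := Submodule.fg_iff_exists_fin_generating_family.1
    (IsNoetherian.noetherian (maximalIdeal B))
  refine isWeaklyRegular_of_cechVanishes (f := f) hf bs hbs (fun i hi => ?_)
    fun q hqp _ hqb => hq q hqp hqb
  exact cechVanishes_of_isWeaklyRegular f hx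
    (fun x hxm => Ideal.le_radical (by rw [Ideal.span, hf]; exact hxs x hxm)) (by omega)

end Parameters

/-! ### Minimal reductions -/

section Reductions

open IsLocalRing

variable {A : Type*} [CommRing A]

theorem pow_add_eq_of_isReduction {Q I : Ideal A} {n : ℕ} (h : I ^ (n + 1) = Q * I ^ n) (k : ℕ) :
    I ^ (n + k) = Q ^ k * I ^ n := by
  induction k with
  | zero => simp
  | succ k ih => rw [← add_assoc, pow_succ', ih, mul_left_comm, ← pow_succ', h, pow_succ', mul_assoc,
      mul_left_comm]

/-- Elements `x` and `y` of `Q ^ n` which are congruent modulo `L * Q ^ (n - 1)`. -/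
def CongrModPow (L Q : Ideal A) (n : ℕ) (x y : A) : Prop :=
  x ∈ Q ^ n ∧ y ∈ Q ^ n ∧ ∀ q ∈ Q, q * (x - y) ∈ L * Q ^ n

/-- Testing the difference after multiplication by elements of `Q` avoids the exponent `n - 1` and
keeps the relation meaningful for `n = 0`. -/
theorem CongrModPow.mul {L Q : Ideal A} {n n' : ℕ} {x y x' y' : A} (h : CongrModPow L Q n x y)
    (h' : CongrModPow L Q n' x' y') : CongrModPow L Q (n + n') (x * x') (y * y') := by
  refine ⟨pow_add Q n n' ▸ Ideal.mul_mem_mul h.1 h'.1, pow_add Q n n' ▸ Ideal.mul_mem_mul h.2.1 h'.2.1,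
    fun q hq => ?_⟩
  have e : q * (x * x' - y * y') = q * (x - y) * x' + y * (q * (x' - y')) := by ring
  rw [e, pow_add]
  refine add_mem ?_ ?_
  · rw [← mul_assoc]
    exact Ideal.mul_mem_mul (h.2.2 q hq) h'.1
  · rw [mul_left_comm]
    exact Ideal.mul_mem_mul h.2.1 (h'.2.2 q hq)

theorem CongrModPow.one (L Q : Ideal A) : CongrModPow L Q 0 1 1 := by
  refine ⟨by simp, by simp, fun q _ => by simp⟩

theorem CongrModPow.pow {L Q : Ideal A} {x y : A} (h : CongrModPow L Q 1 x y) (n : ℕ) :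
    CongrModPow L Q n (x ^ n) (y ^ n) := by
  induction n with
  | zero => simpa using CongrModPow.one L Q
  | succ n ih => simpa [pow_succ] using ih.mul h

theorem CongrModPow.prod {ι : Type*} {L Q : Ideal A} (s : Finset ι) {n : ι → ℕ} {x y : ι → A}
    (h : ∀ i ∈ s, CongrModPow L Q (n i) (x i) (y i)) :
    CongrModPow L Q (∑ i ∈ s, n i) (∏ i ∈ s, x i) (∏ i ∈ s, y i) := by
  classical
  induction s using Finset.induction_on with
  | empty => simpa using CongrModPow.one L Q
  | insert a s ha ih =>
    rw [Finset.sum_insert ha, Finset.prod_insert ha, Finset.prod_insert ha]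
    exact (h a (Finset.mem_insert_self a s)).mul
      (ih fun i hi => h i (Finset.mem_insert_of_mem hi))

theorem CongrModPow.aeval {ι : Type*} {L Q : Ideal A} {x y : ι → A}
    (h : ∀ i, CongrModPow L Q 1 (x i) (y i)) {p : MvPolynomial ι A} {n : ℕ}
    (hp : p.IsHomogeneous n) :
    CongrModPow L Q n (MvPolynomial.aeval x p) (MvPolynomial.aeval y p) := by
  classical
  have key : ∀ α ∈ p.support, CongrModPow L Q n (α.prod fun i k => x i ^ k)
      (α.prod fun i k => y i ^ k) := fun α hα => by
    have := CongrModPow.prod (L := L) (Q := Q) α.support (n := fun i => α i)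
      fun i _ => (h i).pow (α i)
    rwa [show ∑ i ∈ α.support, α i = n from by
      rw [← hp (MvPolynomial.mem_support_iff.1 hα), Finsupp.weight_apply]
      simp [Finsupp.sum]] at this
  rw [MvPolynomial.aeval_def, MvPolynomial.eval₂_eq, MvPolynomial.aeval_def, MvPolynomial.eval₂_eq]
  refine ⟨sum_mem fun α hα => Ideal.mul_mem_left _ _ (key α hα).1,
    sum_mem fun α hα => Ideal.mul_mem_left _ _ (key α hα).2.1, fun q hq => ?_⟩
  rw [← Finset.sum_sub_distrib, Finset.mul_sum]
  refine sum_mem fun α hα => ?_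
  rw [← mul_sub, mul_left_comm]
  exact Ideal.mul_mem_left _ _ ((key α hα).2.2 q hq)

theorem sup_span_singleton_pow_le (L : Ideal A) (x : A) (n : ℕ) :
    (L ⊔ Ideal.span {x}) ^ (n + 1) ≤ L * (L ⊔ Ideal.span {x}) ^ n ⊔ Ideal.span {x ^ (n + 1)} := by
  induction n with
  | zero => simp
  | succ n ih =>
    conv_lhs => rw [pow_succ', Ideal.sup_mul]
    refine sup_le le_sup_left ((Ideal.mul_mono_right ih).trans ?_)
    rw [Ideal.mul_sup]
    refine sup_le_sup ?_ ?_
    · rw [mul_left_comm, pow_succ']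
      exact Ideal.mul_mono_right (Ideal.mul_mono_left le_sup_right)
    · rw [Ideal.span_singleton_mul_span_singleton, ← pow_succ']

theorem aeval_mul_of_isHomogeneous {ι : Type*} {p : MvPolynomial ι A} {n : ℕ}
    (hp : p.IsHomogeneous n) (c : A) (w : ι → A) :
    MvPolynomial.aeval (fun i => c * w i) p = c ^ n * MvPolynomial.eval w p := by
  rw [MvPolynomial.aeval_def, MvPolynomial.eval₂_eq, MvPolynomial.eval_eq, Finset.mul_sum]
  refine Finset.sum_congr rfl fun α hα => ?_
  simp only [mul_pow, Finset.prod_mul_distrib, Algebra.algebraMap_self, RingHom.id_apply]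
  rw [Finset.prod_pow_eq_pow_sum, show ∑ i ∈ α.support, α i = n from by
      rw [← hp (MvPolynomial.mem_support_iff.1 hα), Finsupp.weight_apply]
      simp [Finsupp.sum]]
  ring

variable [IsLocalRing A] [IsNoetherianRing A]

theorem isReduction_of_pow_le {L I : Ideal A} (hL : L ≤ I) {n : ℕ}
    (h : I ^ (n + 1) ≤ L * I ^ n ⊔ maximalIdeal A * I ^ (n + 1)) : IsReduction L I := by
  refine ⟨hL, n, le_antisymm ?_ ?_⟩
  · exact Submodule.le_of_le_smul_of_le_jacobson_bot (IsNoetherian.noetherian _)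
      (maximalIdeal_le_jacobson ⊥) h
  · rw [pow_succ']
    exact Ideal.mul_mono_left hL

/-- A family `a` generating a reduction of `I` with the least number of generators: no shorter
family of elements of the ideal generated by `a` generates a reduction of `I`. -/
def IsShortest (I : Ideal A) {l : ℕ} (a : Fin l → A) : Prop :=
  ∀ k < l, ∀ b : Fin k → A, (∀ i, b i ∈ Ideal.span (Set.range a)) →
    ¬ IsReduction (Ideal.span (Set.range b)) I

/-- Analytic independence, after Northcott and Rees. If `p` is nonzero modulo `𝔪`, it has a point
`w` over the infinite residue field where neither `p` nor the first coordinate vanishes. Modulo the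
`b i = a (i+1) - (w (i+1) / w 0) a 0`, every `a i` is a multiple of `a 0`, so `p(a)` becomes a unit
times `a 0 ^ n`. Hence `a 0 ^ (n + 1) ∈ L I^n + 𝔪 I^(n+1)` with `L = (b)`, and by Nakayama the
shorter family `b` already generates a reduction. -/
theorem coeff_mem_maximalIdeal_of_isShortest [Infinite (ResidueField A)] {I : Ideal A} {l : ℕ}
    {a : Fin l → A} (ha : IsShortest I a) (hred : IsReduction (Ideal.span (Set.range a)) I) {n : ℕ}
    {p : MvPolynomial (Fin l) A} (hp : p.IsHomogeneous n)
    (h : MvPolynomial.aeval a p ∈ maximalIdeal A * I ^ n) (α : Fin l →₀ ℕ) :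
    p.coeff α ∈ maximalIdeal A := by
  by_contra hα
  rcases l with _ | l
  · obtain ⟨c, rfl⟩ := MvPolynomial.C_surjective (Fin 0) p
    have h' : c ∈ maximalIdeal A := Ideal.mul_le_left (J := I ^ n) (by simpa using h)
    rw [MvPolynomial.coeff_C] at hα
    split_ifs at hα with h0
    · exact hα h'
    · exact hα (zero_mem _)
  have hp0 : MvPolynomial.map (residue A) p ≠ 0 := fun h0 => hα (by
    rw [← residue_eq_zero_iff, ← MvPolynomial.coeff_map, h0, MvPolynomial.coeff_zero])
  -- The factor `X 0` forces the first coordinate of the point to be nonzero, so that it can be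
  -- divided by.
  obtain ⟨v, hv⟩ : ∃ v : Fin (l + 1) → ResidueField A,
      MvPolynomial.eval v (MvPolynomial.map (residue A) p * MvPolynomial.X 0) ≠ 0 := by
    by_contra! hcon
    exact mul_ne_zero hp0 (MvPolynomial.X_ne_zero 0)
      (MvPolynomial.funext fun x => by rw [hcon x, map_zero])
  choose w hw using fun i => residue_surjective (v i)
  rw [map_mul, MvPolynomial.eval_X, MvPolynomial.eval_map, ← (funext hw : (fun i => residue A (w i)) = v),
    mul_ne_zero_iff] at hv
  obtain ⟨hv1, hv0⟩ := hv
  rw [show MvPolynomial.eval₂ (residue A) (fun i => residue A (w i)) p =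
    residue A (MvPolynomial.eval w p) from
      (MvPolynomial.eval₂_comp_left (residue A) (RingHom.id A) w p).symm,
    residue_ne_zero_iff_isUnit] at hv1
  rw [residue_ne_zero_iff_isUnit] at hv0
  obtain ⟨u, hu⟩ := hv0
  let b : Fin l → A := fun i => a i.succ - ↑u⁻¹ * w i.succ * a 0
  set Q := Ideal.span (Set.range a) with hQ
  set L := Ideal.span (Set.range b) with hL
  have haQ : ∀ i, a i ∈ Q := fun i => Ideal.subset_span ⟨i, rfl⟩
  have hbQ : ∀ i, b i ∈ Q := fun i => sub_mem (haQ _) (Ideal.mul_mem_left _ _ (haQ _))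
  have hLQ : L ≤ Q := Ideal.span_le.2 (by rintro _ ⟨i, rfl⟩; exact hbQ i)
  have hQL : Q ≤ L ⊔ Ideal.span {a 0} := Ideal.span_le.2 (by
    rintro _ ⟨i, rfl⟩
    refine Fin.cases ?_ (fun i => ?_) i
    · exact Ideal.mem_sup_right (Ideal.mem_span_singleton_self _)
    · have : a i.succ = b i + ↑u⁻¹ * w i.succ * a 0 := by simp [b]
      rw [SetLike.mem_coe, this]
      exact add_mem (Ideal.mem_sup_left (Ideal.subset_span ⟨i, rfl⟩))
        (Ideal.mul_mem_left _ _ (Ideal.mem_sup_right (Ideal.mem_span_singleton_self _))))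
  have hQI := hred.1
  have hcongr : ∀ i, CongrModPow L Q 1 (a i) (↑u⁻¹ * w i * a 0) := fun i => by
    refine ⟨by simpa using haQ i, by simpa using Ideal.mul_mem_left _ _ (haQ 0), fun q hq => ?_⟩
    rw [pow_one, mul_comm q]
    refine Ideal.mul_mem_mul ?_ hq
    refine Fin.cases ?_ (fun i => ?_) i
    · rw [← hu]; simp
    · exact Ideal.subset_span ⟨i, rfl⟩
  have h1 := (CongrModPow.aeval hcongr hp).2.2 (a 0) (haQ 0)
  have h2 : MvPolynomial.aeval (fun i => ↑u⁻¹ * w i * a 0) p =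
      (↑u⁻¹ * a 0) ^ n * MvPolynomial.eval w p := by
    rw [← aeval_mul_of_isHomogeneous hp]
    exact congrArg (fun x => MvPolynomial.aeval x p) (funext fun i => by ring)
  have h3 : a 0 ^ (n + 1) ∈ L * I ^ n ⊔ maximalIdeal A * I ^ (n + 1) := by
    obtain ⟨e, he⟩ := hv1
    have h4 : a 0 * MvPolynomial.aeval (fun i => ↑u⁻¹ * w i * a 0) p ∈
        L * I ^ n ⊔ maximalIdeal A * I ^ (n + 1) := by
      rw [← sub_sub_cancel (MvPolynomial.aeval a p)
        (MvPolynomial.aeval (fun i => ↑u⁻¹ * w i * a 0) p), mul_sub]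
      refine sub_mem (Ideal.mem_sup_right ?_) (Ideal.mem_sup_left
        (Ideal.mul_mono_right (Ideal.pow_right_mono hQI n) h1))
      rw [pow_succ', mul_left_comm]
      exact Ideal.mul_mem_mul (hQI (haQ 0)) h
    have h5 : a 0 ^ (n + 1) = ((u : A) ^ n * ↑e⁻¹) *
        (a 0 * MvPolynomial.aeval (fun i => ↑u⁻¹ * w i * a 0) p) := by
      have h6 : ((u : A) * ↑u⁻¹) = 1 := u.mul_inv
      have h7 : ((e : A) * ↑e⁻¹) = 1 := e.mul_inv
      rw [h2, ← he]
      calc a 0 ^ (n + 1) = (u * ↑u⁻¹) ^ n * (e * ↑e⁻¹) * a 0 ^ (n + 1) := by rw [h6, h7]; simp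
        _ = _ := by ring
    rw [h5]
    exact Ideal.mul_mem_left _ _ h4
  -- Since `I ^ (n + s + 1) = Q ^ (n + 1) * I ^ s`, a bound on `Q ^ (n + 1)` suffices.
  obtain ⟨s, hs⟩ := hred.2
  refine ha l (Nat.lt_succ_self l) b hbQ (isReduction_of_pow_le (hLQ.trans hQI) (n := n + s) ?_)
  have h4 : Q ^ (n + 1) ≤ L * I ^ n ⊔ maximalIdeal A * I ^ (n + 1) := by
    have h5 : L ⊔ Ideal.span {a 0} ≤ I := sup_le (hLQ.trans hQI)
      ((Ideal.span_singleton_le_iff_mem _).2 (hQI (haQ 0)))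
    refine (Ideal.pow_right_mono hQL (n + 1)).trans ((sup_span_singleton_pow_le _ _ n).trans
      (sup_le ((Ideal.mul_mono_right (Ideal.pow_right_mono h5 n)).trans le_sup_left) ?_))
    rwa [Ideal.span_singleton_le_iff_mem]
  calc I ^ (n + s + 1) = Q ^ (n + 1) * I ^ s := by
        rw [← pow_add_eq_of_isReduction hs, show s + (n + 1) = n + s + 1 by ring]
    _ ≤ (L * I ^ n ⊔ maximalIdeal A * I ^ (n + 1)) * I ^ s := Ideal.mul_mono_left h4
    _ = L * I ^ (n + s) ⊔ maximalIdeal A * I ^ (n + s + 1) := by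
        rw [Ideal.sup_mul, mul_assoc, mul_assoc, ← pow_add, ← pow_add, add_right_comm]

omit [IsLocalRing A] in
theorem exists_isShortest (I : Ideal A) {J : Ideal A} (hJ : IsReduction J I) :
    ∃ (l : ℕ) (a : Fin l → A), (∀ i, a i ∈ J) ∧ IsReduction (Ideal.span (Set.range a)) I ∧
      ∀ k < l, ∀ b : Fin k → A, (∀ i, b i ∈ J) → ¬ IsReduction (Ideal.span (Set.range b)) I := by
  classical
  have hex : ∃ l, ∃ a : Fin l → A, (∀ i, a i ∈ J) ∧ IsReduction (Ideal.span (Set.range a)) I := by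
    obtain ⟨l, a, ha⟩ := Submodule.fg_iff_exists_fin_generating_family.1
      (IsNoetherian.noetherian J)
    exact ⟨l, a, fun i => ha ▸ Submodule.subset_span ⟨i, rfl⟩, by rwa [Ideal.span, ha]⟩
  obtain ⟨a, ha, hred⟩ := Nat.find_spec hex
  exact ⟨Nat.find hex, a, ha, hred, fun k hk b hb hb' => Nat.find_min hex hk ⟨b, hb, hb'⟩⟩

omit [IsLocalRing A] in
theorem IsMinimalReduction.exists_isShortest {Q I : Ideal A} (hQ : IsMinimalReduction Q I) :
    ∃ (l : ℕ) (a : Fin l → A), Ideal.span (Set.range a) = Q ∧ IsShortest I a := by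
  obtain ⟨l, a, ha, hred, h⟩ := _root_.exists_isShortest I hQ.prop
  have hle : Ideal.span (Set.range a) ≤ Q := Ideal.span_le.2 (by rintro _ ⟨i, rfl⟩; exact ha i)
  exact ⟨l, a, le_antisymm hle (hQ.le_of_le hred hle), fun k hk b hb => h k hk b fun i => hle (hb i)⟩

/-- A reduction with the fewest generators `a` is minimal. A smaller reduction `J` contains a
shortest family `b = M a`. Analytic independence of `b` makes the rows of `M` independent modulo
`𝔪`, so `b` is no longer than `a`; the lengths then agree and `M` is invertible. -/
theorem exists_isMinimalReduction [Infinite (ResidueField A)] (I : Ideal A) :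
    ∃ Q, IsMinimalReduction Q I := by
  obtain ⟨l, a, ha, hred, hmin⟩ := exists_isShortest I (J := I) ⟨le_rfl, 0, by simp⟩
  refine ⟨Ideal.span (Set.range a), hred, fun J hJ hJa => ?_⟩
  have hQI := hred.1
  obtain ⟨l', b, hb, hredb, hminb⟩ := exists_isShortest I hJ
  have hbJ : Ideal.span (Set.range b) ≤ J := Ideal.span_le.2 (by rintro _ ⟨i, rfl⟩; exact hb i)
  have hbs : IsShortest I b := fun k hk c hc => hminb k hk c fun i => hbJ (hc i)
  have hex : ∀ j, ∃ c : Fin l → A, ∑ i, c i * a i = b j := fun j =>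
    Ideal.mem_span_range_iff_exists_fun.1 (hJa (hb j))
  choose M hM using hex
  -- A relation `w` between the rows modulo `𝔪` puts `∑ w j * b j` in `𝔪 I`; the linear form with
  -- coefficients `w` then has all of them in `𝔪`.
  have hinj : Function.Injective (Matrix.vecMulLinear (Matrix.map (Matrix.of M) (residue A))) := by
    rw [injective_iff_map_eq_zero]
    intro v hv
    choose w hw using fun i => residue_surjective (v i)
    have h1 : ∀ i, ∑ j, w j * M j i ∈ maximalIdeal A := fun i => by
      rw [← residue_eq_zero_iff, map_sum]
      have := congrFun hv i
      simpa [Matrix.vecMul, dotProduct, hw] using this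
    have h2 : ∑ j, w j * b j ∈ maximalIdeal A * I := by
      have : ∑ j, w j * b j = ∑ i, (∑ j, w j * M j i) * a i := by
        simp_rw [← hM, Finset.mul_sum, Finset.sum_mul]
        rw [Finset.sum_comm]
        simp_rw [mul_assoc]
      rw [this]
      exact sum_mem fun i _ => Ideal.mul_mem_mul (h1 i) (ha i)
    funext j
    rw [← hw j, Pi.zero_apply, residue_eq_zero_iff]
    have h3 := coeff_mem_maximalIdeal_of_isShortest hbs hredb (n := 1)
      (p := ∑ j, MvPolynomial.C (w j) * MvPolynomial.X j)
      (MvPolynomial.IsHomogeneous.sum _ _ _ fun j _ => by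
        simpa using (MvPolynomial.isHomogeneous_C (Fin l') (w j)).mul
          (MvPolynomial.isHomogeneous_X A j)) (by simpa using h2) (Finsupp.single j 1)
    rw [MvPolynomial.coeff_sum, Finset.sum_eq_single j] at h3
    · simpa using h3
    · intro i _ hij
      rw [MvPolynomial.coeff_C_mul, MvPolynomial.coeff_X, if_neg, mul_zero]
      simpa [Finsupp.single_left_inj] using hij
    · simp
  have hl : l' ≤ l := by
    have := LinearMap.finrank_le_finrank_of_injective hinj
    simpa using this
  obtain rfl : l' = l := le_antisymm hl (by
    by_contra! h
    exact hmin l' h b (fun i => hJ.1 (hb i)) hredb)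
  have hdet : IsUnit (Matrix.of M).det := by
    rw [← residue_ne_zero_iff_isUnit, RingHom.map_det]
    intro h
    obtain ⟨v, hv, hv'⟩ := Matrix.exists_vecMul_eq_zero_iff.2 h
    exact hv (hinj (by rw [map_zero]; exact hv'))
  refine le_trans (Ideal.span_le.2 ?_) hbJ
  rintro _ ⟨i, rfl⟩
  have h1 : (Matrix.of M).mulVec a = b := funext fun j => hM j
  have h2 : a = (Matrix.of M)⁻¹.mulVec b := by
    rw [← h1, Matrix.mulVec_mulVec, Matrix.nonsing_inv_mul _ hdet, Matrix.one_mulVec]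
  have h3 : (Matrix.of M)⁻¹.mulVec b i = ∑ j, (Matrix.of M)⁻¹ i j * b j := rfl
  rw [SetLike.mem_coe, h2, h3]
  exact sum_mem fun j _ => Ideal.mul_mem_left _ _ (Ideal.subset_span ⟨j, rfl⟩)

end Reductions

/-! ### Analytically independent elements and dimension -/

section Lengths

open IsLocalRing

variable {B : Type*} [CommRing B]

theorem length_quotient_add_one_le {K K' : Ideal B} (h : K < K') :
    Module.length B (B ⧸ K') + 1 ≤ Module.length B (B ⧸ K) := by
  rw [Module.length_quotient, Module.length_quotient]
  exact Order.coheight_add_one_le h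

theorem length_quotient_anti {K K' : Ideal B} (h : K ≤ K') :
    Module.length B (B ⧸ K') ≤ Module.length B (B ⧸ K) :=
  Module.length_le_of_surjective (Submodule.factor h) (Submodule.factor_surjective h)

/-- Multiplication by `y` maps `B/(K + z)` onto the kernel of `B/(K + yz) → B/(K + y)`. -/
theorem length_quotient_sup_mul_le (K : Ideal B) (y z : B) :
    Module.length B (B ⧸ K ⊔ Ideal.span {y * z}) ≤
      Module.length B (B ⧸ K ⊔ Ideal.span {y}) + Module.length B (B ⧸ K ⊔ Ideal.span {z}) := by
  have hle : K ⊔ Ideal.span {y * z} ≤ K ⊔ Ideal.span {y} :=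
    sup_le_sup_left (Ideal.span_singleton_le_span_singleton.2 ⟨z, rfl⟩) K
  let g := Submodule.factor hle
  rw [Module.length_eq_add_of_exact (LinearMap.ker g).subtype g (Submodule.subtype_injective _)
    (Submodule.factor_surjective hle) (LinearMap.exact_subtype_ker_map g), add_comm]
  refine add_le_add_right ?_ _
  have hmul : K ⊔ Ideal.span {z} ≤
      Submodule.comap (LinearMap.lsmul B B y) (K ⊔ Ideal.span {y * z}) := by
    refine sup_le (fun k hk => ?_) ((Ideal.span_singleton_le_iff_mem _).2 ?_)
    · exact Ideal.mem_sup_left (Ideal.mul_mem_left _ _ hk)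
    · exact Ideal.mem_sup_right (Ideal.mem_span_singleton_self _)
  let m := Submodule.mapQ (K ⊔ Ideal.span {z}) (K ⊔ Ideal.span {y * z}) _ hmul
  have hker : ∀ x, m x ∈ LinearMap.ker g := fun x => by
    obtain ⟨x, rfl⟩ := Submodule.Quotient.mk_surjective _ x
    rw [LinearMap.mem_ker]
    change Submodule.Quotient.mk (y * x) = 0
    rw [Submodule.Quotient.mk_eq_zero]
    exact Ideal.mem_sup_right (Ideal.mul_mem_right _ _ (Ideal.mem_span_singleton_self _))
  refine Module.length_le_of_surjective (LinearMap.codRestrict _ m hker) ?_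
  rintro ⟨x, hx⟩
  obtain ⟨x, rfl⟩ := Submodule.Quotient.mk_surjective _ x
  rw [LinearMap.mem_ker] at hx
  change Submodule.Quotient.mk x = 0 at hx
  rw [Submodule.Quotient.mk_eq_zero, Submodule.mem_sup] at hx
  obtain ⟨k, hk, t, ht, rfl⟩ := hx
  obtain ⟨b, rfl⟩ := Ideal.mem_span_singleton'.1 ht
  refine ⟨Submodule.Quotient.mk b, Subtype.ext ?_⟩
  change Submodule.Quotient.mk (y * b) = Submodule.Quotient.mk (k + b * y)
  rw [Submodule.Quotient.eq]
  refine Ideal.mem_sup_left ?_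
  rw [show y * b - (k + b * y) = -k by ring]
  exact neg_mem hk

theorem length_quotient_sup_pow_le (K : Ideal B) (y : B) (N : ℕ) :
    Module.length B (B ⧸ K ⊔ Ideal.span {y ^ N}) ≤
      N * Module.length B (B ⧸ K ⊔ Ideal.span {y}) := by
  induction N with
  | zero =>
    have : Subsingleton (B ⧸ K ⊔ Ideal.span {y ^ 0}) :=
      Ideal.Quotient.subsingleton_iff.2 (by simp)
    simp [Module.length_eq_zero]
  | succ N ih =>
    rw [pow_succ]
    refine (length_quotient_sup_mul_le K _ _).trans ?_
    push_cast
    rw [add_mul, one_mul]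
    exact add_le_add_left ih _

theorem length_quotient_sup_span_pow_le [DecidableEq B] (S : Finset B) (K : Ideal B) (N : ℕ) :
    Module.length B (B ⧸ K ⊔ Ideal.span ((· ^ N) '' (S : Set B))) ≤
      N ^ S.card * Module.length B (B ⧸ K ⊔ Ideal.span (S : Set B)) := by
  induction S using Finset.induction_on generalizing K with
  | empty =>
    have h : K ⊔ Ideal.span ((· ^ N) '' ((∅ : Finset B) : Set B)) =
        K ⊔ Ideal.span ((∅ : Finset B) : Set B) := by simp
    rw [h, Finset.card_empty, pow_zero, one_mul]
  | insert y S hy ih =>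
    rw [Finset.coe_insert, Set.image_insert_eq, Ideal.span_insert, Ideal.span_insert,
      Finset.card_insert_of_notMem hy, ← sup_assoc]
    refine (ih _).trans ?_
    rw [pow_succ, mul_assoc]
    refine mul_le_mul_right ?_ _
    have h := length_quotient_sup_pow_le (K ⊔ Ideal.span (S : Set B)) y N
    rwa [← sup_assoc, sup_right_comm K (Ideal.span {y ^ N}), sup_right_comm K (Ideal.span {y})]

variable [IsLocalRing B]

/-- The monomials in `a` are added to `J ^ N` one by one, in order of decreasing degree, and each
strictly enlarges the ideal. Otherwise the new monomial would be a combination of earlier ones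
modulo `J ^ N`, and the part of its own degree would be a form with a coefficient `1` and value in
`𝔪 J^n`. -/
theorem card_le_length_quotient {l : ℕ} {a : Fin l → B} {J : Ideal B} (hJ : J ≤ maximalIdeal B)
    (ha : ∀ i, a i ∈ J)
    (H : ∀ (n : ℕ) (p : MvPolynomial (Fin l) B), p.IsHomogeneous n →
      MvPolynomial.aeval a p ∈ maximalIdeal B * J ^ n → ∀ α, p.coeff α ∈ maximalIdeal B)
    (N : ℕ) (T : Finset (Fin l →₀ ℕ)) (hT : ∀ α ∈ T, α.degree < N) :
    (T.card : ℕ∞) ≤ Module.length B (B ⧸ J ^ N) := by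
  classical
  let mon : (Fin l →₀ ℕ) → B := fun α => MvPolynomial.aeval a (MvPolynomial.monomial α (1 : B))
  have hmon : ∀ α, mon α ∈ J ^ α.degree := fun α => by
    simp only [mon, MvPolynomial.aeval_monomial, map_one, one_mul, Finsupp.prod]
    rw [Finsupp.degree_apply, ← Finset.prod_pow_eq_pow_sum]
    exact Ideal.prod_mem_prod fun i _ => Ideal.pow_mem_pow (ha i) _
  suffices h : Module.length B (B ⧸ (Ideal.span (mon '' (T : Set (Fin l →₀ ℕ))) ⊔ J ^ N)) + T.card ≤
      Module.length B (B ⧸ J ^ N) from le_trans le_add_self h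
  induction T using Finset.induction_on_min_value (fun α : Fin l →₀ ℕ => α.degree) with
  | empty => simpa using length_quotient_anti le_sup_right
  | insert α T hα hmin ih =>
    refine le_trans ?_ (ih fun β hβ => hT β (Finset.mem_insert_of_mem hβ))
    rw [Finset.card_insert_of_notMem hα, Nat.cast_add, Nat.cast_one, add_comm (T.card : ℕ∞),
      ← add_assoc]
    refine add_le_add_left (length_quotient_add_one_le (lt_of_le_of_ne ?_ fun heq => ?_)) _
    · exact sup_le_sup_right (Ideal.span_mono (Set.image_mono (by simp))) _
    have h1 : mon α ∈ Ideal.span (mon '' (T : Set (Fin l →₀ ℕ))) ⊔ J ^ N := by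
      rw [heq]
      exact Ideal.mem_sup_left (Ideal.subset_span ⟨α, by simp, rfl⟩)
    obtain ⟨y, hy, z, hz, hyz⟩ := Submodule.mem_sup.1 h1
    obtain ⟨c, hc⟩ := (Submodule.mem_span_image_finset_iff_exists_fun B).1 hy
    let c' : (Fin l →₀ ℕ) → B := fun β => if h : β ∈ T then c ⟨β, h⟩ else 0
    have hc' : ∑ β ∈ T, c' β * mon β = y := by
      rw [← hc, ← Finset.sum_attach]
      refine Finset.sum_congr rfl fun β _ => ?_
      simp [c']
    let p : MvPolynomial (Fin l) B := MvPolynomial.monomial α 1 -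
      ∑ β ∈ T with β.degree = α.degree, MvPolynomial.monomial β (c' β)
    have hp : p.IsHomogeneous α.degree :=
      (MvPolynomial.isHomogeneous_monomial _ rfl).sub (MvPolynomial.IsHomogeneous.sum _ _ _
        fun β hβ => MvPolynomial.isHomogeneous_monomial _ (Finset.mem_filter.1 hβ).2)
    have hlt : J ^ (α.degree + 1) ≤ maximalIdeal B * J ^ α.degree := by
      rw [pow_succ']
      exact Ideal.mul_mono_left hJ
    have hev : MvPolynomial.aeval a p = z +
        ∑ β ∈ T with ¬ β.degree = α.degree, c' β * mon β := by
      have h2 : ∀ β, MvPolynomial.aeval a (MvPolynomial.monomial β (c' β)) = c' β * mon β :=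
        fun β => by simp [mon, MvPolynomial.aeval_monomial]
      simp only [p, map_sub, map_sum, h2]
      change mon α - _ = _
      rw [← hyz, ← hc', ← Finset.sum_filter_add_sum_filter_not T (fun β => β.degree = α.degree)]
      ring
    have h3 := H _ p hp (by
      rw [hev]
      refine add_mem (hlt (Ideal.pow_le_pow_right (hT α (Finset.mem_insert_self _ _)) hz))
        (sum_mem fun β hβ => hlt (Ideal.mul_mem_left _ _ (Ideal.pow_le_pow_right ?_ (hmon β))))
      rw [Finset.mem_filter] at hβ
      exact lt_of_le_of_ne (hmin β hβ.1) (Ne.symm hβ.2)) α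
    refine (Ideal.ne_top_iff_one _).1 (maximalIdeal.isMaximal B).ne_top ?_
    have h4 : p.coeff α = 1 := by
      simp only [p, MvPolynomial.coeff_sub, MvPolynomial.coeff_sum, MvPolynomial.coeff_monomial]
      rw [Finset.sum_eq_zero]
      · simp
      · intro β hβ
        rw [if_neg]
        rintro rfl
        exact hα (Finset.mem_filter.1 hβ).1
    rwa [h4] at h3

/-- The length of `B / J ^ N` grows at least like `N ^ l` by independence of monomials, and at most
like `N ^ dim B` by comparison with powers of a system of parameters `S`. -/
theorem le_ringKrullDim_of_coeff_mem [IsNoetherianRing B] {l : ℕ} {a : Fin l → B} {J : Ideal B}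
    (hJ : J.radical = maximalIdeal B) (ha : ∀ i, a i ∈ J)
    (H : ∀ (n : ℕ) (p : MvPolynomial (Fin l) B), p.IsHomogeneous n →
      MvPolynomial.aeval a p ∈ maximalIdeal B * J ^ n → ∀ α, p.coeff α ∈ maximalIdeal B) :
    (l : WithBot ℕ∞) ≤ ringKrullDim B := by
  classical
  obtain ⟨S, hS, hcard⟩ := Ideal.exists_finset_card_eq_height_of_isNoetherianRing (maximalIdeal B)
  rw [← maximalIdeal_height_eq_ringKrullDim, ← hcard]
  norm_cast
  by_contra! hlt
  have hrad : (Ideal.span (S : Set B)).radical = maximalIdeal B := by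
    refine le_antisymm ((maximalIdeal.isMaximal B).isPrime.radical_le_iff.2 hS.1.2) ?_
    rw [Ideal.radical_eq_sInf]
    refine le_sInf fun q hq => ?_
    have := hq.2
    exact hS.2 ⟨hq.2, hq.1⟩ (le_maximalIdeal hq.2.ne_top)
  have hfin : Module.length B (B ⧸ Ideal.span (S : Set B)) ≠ ⊤ := by
    have := quotient_artinian_of_mem_minimalPrimes_of_isLocalRing _ hS
    rw [Module.length_eq_of_surjective (S := B) (R := B ⧸ Ideal.span (S : Set B))
      Ideal.Quotient.mk_surjective]
    exact Module.length_ne_top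
  obtain ⟨C, hC⟩ := ENat.ne_top_iff_exists.1 hfin
  obtain ⟨s, hs⟩ := Ideal.exists_pow_le_of_le_radical_of_fg hJ.ge (IsNoetherian.noetherian _)
  -- The `M ^ l` monomials with exponents below `M` have degree below `l * M`. As `𝔪 ^ s ≤ J`, the
  -- powers `x ^ (s * (l * M))` of the parameters lie in `J ^ (l * M)`.
  have key : ∀ M : ℕ, M ^ l ≤ (s * (l * M)) ^ S.card * C := fun M => by
    let T : Finset (Fin l →₀ ℕ) := Finset.univ.image fun α : Fin l → Fin M =>
      Finsupp.equivFunOnFinite.symm fun i => (α i : ℕ)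
    have hTc : T.card = M ^ l := by
      rw [Finset.card_image_of_injective]
      · simp
      · intro α β h
        funext i
        exact Fin.ext (DFunLike.congr_fun h i)
    have hT : ∀ α ∈ T, α.degree < l * M := fun α hα => by
      obtain ⟨β, -, rfl⟩ := Finset.mem_image.1 hα
      rw [Finsupp.degree_eq_sum]
      have : 0 < l := by omega
      have : Nonempty (Fin l) := ⟨⟨0, this⟩⟩
      refine (Finset.sum_lt_sum_of_nonempty (g := fun _ => M) Finset.univ_nonempty
        fun i _ => (β i).2).trans_eq (by simp)
    have h1 := card_le_length_quotient (hJ ▸ Ideal.le_radical) ha H (l * M) T hT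
    have h2 := length_quotient_sup_span_pow_le S (⊥ : Ideal B) (s * (l * M))
    rw [bot_sup_eq, bot_sup_eq, ← hC] at h2
    have h3 : Ideal.span ((· ^ (s * (l * M))) '' (S : Set B)) ≤ J ^ (l * M) := by
      refine Ideal.span_le.2 ?_
      rintro _ ⟨x, hx, rfl⟩
      change x ^ (s * (l * M)) ∈ J ^ (l * M)
      rw [pow_mul x s]
      exact Ideal.pow_mem_pow (hs (Ideal.pow_mem_pow (hS.1.2 (Ideal.subset_span hx)) s)) _
    have h4 := h1.trans ((length_quotient_anti h3).trans h2)
    rw [hTc] at h4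
    exact_mod_cast h4
  obtain ⟨k, hk⟩ := Nat.exists_eq_add_of_lt hlt
  -- With this `D` the bound reads `M ^ l ≤ D * M ^ S.card`, which fails for `M = D + 1` when `l >
  -- S.card`.
  let D := (s * l) ^ S.card * C
  have h5 := key (D + 1)
  have h6 : (D + 1) ^ (S.card + 1) ≤ (D + 1) ^ l := Nat.pow_le_pow_right (by omega) hlt
  have h7 : (s * (l * (D + 1))) ^ S.card * C = D * (D + 1) ^ S.card := by
    calc (s * (l * (D + 1))) ^ S.card * C = ((s * l) ^ S.card * C) * (D + 1) ^ S.card := by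
          rw [show s * (l * (D + 1)) = (s * l) * (D + 1) by ring, mul_pow]; ring
      _ = _ := rfl
  rw [h7] at h5
  have h8 := h6.trans h5
  rw [pow_succ'] at h8
  have := Nat.le_of_mul_le_mul_right h8 (by positivity)
  omega

end Lengths

/-! ### Regular sequences are quasi-regular -/

section QuasiRegular

variable {A : Type*} [CommRing A]

theorem aeval_mem_mul_pow {ι : Type*} {K Q : Ideal A} {a : ι → A} (ha : ∀ i, a i ∈ Q)
    {p : MvPolynomial ι A} {n : ℕ} (hp : p.IsHomogeneous n) (hc : ∀ α, p.coeff α ∈ K) :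
    MvPolynomial.aeval a p ∈ K * Q ^ n := by
  rw [MvPolynomial.aeval_def, MvPolynomial.eval₂_eq]
  refine sum_mem fun α hα => Ideal.mul_mem_mul (hc α) ?_
  rw [← hp (MvPolynomial.mem_support_iff.1 hα), show Finsupp.weight 1 α = ∑ i ∈ α.support, α i by
    rw [Finsupp.weight_apply]; simp [Finsupp.sum], ← Finset.prod_pow_eq_pow_sum]
  exact Ideal.prod_mem_prod fun i _ => Ideal.pow_mem_pow (ha i) _

theorem exists_isHomogeneous_of_mem_mul {ι : Type*} {K : Ideal A} {a : ι → A} {n : ℕ} {y : A}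
    (hy : y ∈ K * Ideal.span (Set.range a) ^ n) :
    ∃ p : MvPolynomial ι A, p.IsHomogeneous n ∧ (∀ α, p.coeff α ∈ K) ∧
      MvPolynomial.aeval a p = y := by
  refine Submodule.mul_induction_on hy (fun k hk z hz => ?_) ?_
  · obtain ⟨p, hp, rfl⟩ := (Ideal.mem_span_pow_iff_exists_isHomogeneous a z).1 hz
    refine ⟨MvPolynomial.C k * p, by simpa using (MvPolynomial.isHomogeneous_C ι k).mul hp,
      fun α => ?_, ?_⟩
    · rw [MvPolynomial.coeff_C_mul]
      exact Ideal.mul_mem_right _ _ hk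
    · simp
  · rintro _ _ ⟨p, hp, hpc, rfl⟩ ⟨q, hq, hqc, rfl⟩
    exact ⟨p + q, hp.add hq, fun α => add_mem (hpc α) (hqc α), map_add _ _ _⟩

theorem MvPolynomial.IsHomogeneous.exists_eq_X_mul_add_rename {d n : ℕ}
    {p : MvPolynomial (Fin (d + 1)) A} (hp : p.IsHomogeneous (n + 1)) :
    ∃ (H : MvPolynomial (Fin (d + 1)) A) (G : MvPolynomial (Fin d) A), H.IsHomogeneous n ∧
      G.IsHomogeneous (n + 1) ∧ p = MvPolynomial.X 0 * H + MvPolynomial.rename Fin.succ G := by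
  set s : Fin (d + 1) →₀ ℕ := Finsupp.single 0 1
  have hM : (p.modMonomial s).IsHomogeneous (n + 1) := fun α hα => by
    by_cases h : s ≤ α
    · exact absurd (MvPolynomial.coeff_modMonomial_of_le p h) hα
    · rw [MvPolynomial.coeff_modMonomial_of_not_le p h] at hα
      exact hp hα
  obtain ⟨G, hG⟩ := MvPolynomial.exists_rename_eq_of_vars_subset_range (p.modMonomial s) Fin.succ
    (Fin.succ_injective d) fun i hi => by
      obtain ⟨α, hα, hi⟩ := (MvPolynomial.mem_vars_iff_mem_support i).1 (Finset.mem_coe.1 hi)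
      refine Fin.exists_succ_eq.2 ?_
      rintro rfl
      refine MvPolynomial.mem_support_iff.1 hα (MvPolynomial.coeff_modMonomial_of_le p ?_)
      rw [Finsupp.single_le_iff]
      exact Nat.one_le_iff_ne_zero.2 (Finsupp.mem_support_iff.1 hi)
  refine ⟨p.divMonomial s, G, fun α hα => ?_, ?_, ?_⟩
  · rw [MvPolynomial.coeff_divMonomial] at hα
    have := hp hα
    rw [map_add] at this
    simp only [s, Finsupp.weight_single, Pi.one_apply, smul_eq_mul, mul_one] at this
    omega
  · rwa [← hG, MvPolynomial.IsHomogeneous.rename_isHomogeneous_iff (Fin.succ_injective d)] at hM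
  · rw [hG]
    exact (MvPolynomial.divMonomial_add_modMonomial_single p 0).symm

theorem MvPolynomial.IsHomogeneous.eq_C_coeff {ι : Type*} {p : MvPolynomial ι A}
    (hp : p.IsHomogeneous 0) : p = MvPolynomial.C (p.coeff 0) :=
  (MvPolynomial.totalDegree_eq_zero_iff_eq_C (p := p)).1 (Nat.le_zero.1 hp.totalDegree_le)

/-- A nonzerodivisor modulo a quasi-regular ideal is one modulo its powers: if `x = g(a)` with `g`
of degree `n` and `b x` lies in the next power, the coefficients of `b g` lie in the ideal, hence so
do those of `g`. -/
theorem mem_span_pow_of_mul_mem {ι : Type*} {a : ι → A}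
    (hq : ∀ (n : ℕ) (p : MvPolynomial ι A), p.IsHomogeneous n → MvPolynomial.aeval a p = 0 →
      ∀ α, p.coeff α ∈ Ideal.span (Set.range a)) {b : A}
    (hb : ∀ x, b * x ∈ Ideal.span (Set.range a) → x ∈ Ideal.span (Set.range a)) (n : ℕ) {x : A}
    (hx : b * x ∈ Ideal.span (Set.range a) ^ n) : x ∈ Ideal.span (Set.range a) ^ n := by
  induction n with
  | zero => simp
  | succ n ih =>
    obtain ⟨g, hg, rfl⟩ := (Ideal.mem_span_pow_iff_exists_isHomogeneous a x).1
      (ih (Ideal.pow_le_pow_right (Nat.le_succ n) hx))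
    rw [← MvPolynomial.coe_aeval_eq_eval, RingHom.coe_coe] at hx ⊢
    rw [pow_succ'] at hx ⊢
    obtain ⟨q, hq1, hq2, hq3⟩ := exists_isHomogeneous_of_mem_mul hx
    refine aeval_mem_mul_pow
      (fun i => (Ideal.subset_span ⟨i, rfl⟩ : a i ∈ Ideal.span (Set.range a))) hg fun α => hb _ ?_
    have := hq n (MvPolynomial.C b * g - q)
      ((by simpa using (MvPolynomial.isHomogeneous_C ι b).mul hg :
        (MvPolynomial.C b * g).IsHomogeneous n).sub hq1) (by rw [map_sub, hq3]; simp) α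
    rw [MvPolynomial.coeff_sub, MvPolynomial.coeff_C_mul] at this
    exact (Submodule.sub_mem_iff_left _ (hq2 α)).1 this

/-- Induction on `d` and `n`; each `a i` is regular modulo the later entries. Write `p = X 0 * H +
G` with `G` free of `X 0`. Then `a 0 * H(a) = -G(a')` lies in `(a') ^ (n + 1)`, so `H(a)` does too,
say `H(a) = g(a')`. The form `H` is treated by induction on `n`, and `a 0 * g + G` is a relation
among the `d - 1` elements `a'` (`d` counting all entries of `a`). -/
theorem coeff_mem_span_of_aeval_eq_zero {d : ℕ} {a : Fin d → A}
    (ha : ∀ i x, a i * x ∈ Ideal.span (a '' Set.Ioi i) → x ∈ Ideal.span (a '' Set.Ioi i))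
    {n : ℕ} {p : MvPolynomial (Fin d) A} (hp : p.IsHomogeneous n)
    (h : MvPolynomial.aeval a p = 0) (α : Fin d →₀ ℕ) :
    p.coeff α ∈ Ideal.span (Set.range a) := by
  revert α
  rw [← MvPolynomial.mem_map_C_iff]
  induction d generalizing n with
  | zero =>
    obtain ⟨c, rfl⟩ := MvPolynomial.C_surjective (Fin 0) p
    rw [show c = 0 by simpa using h, map_zero]
    exact zero_mem _
  | succ d ih =>
    set a' : Fin d → A := fun i => a i.succ with ha'
    have him : ∀ i : Fin d, a' '' Set.Ioi i = a '' Set.Ioi i.succ := fun i => by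
      ext x
      constructor
      · rintro ⟨j, hj, rfl⟩
        exact ⟨j.succ, Fin.succ_lt_succ_iff.2 hj, rfl⟩
      · rintro ⟨j, hj, rfl⟩
        obtain ⟨k, rfl⟩ := Fin.exists_succ_eq.2 (Fin.ne_zero_of_lt hj)
        exact ⟨k, Fin.succ_lt_succ_iff.1 hj, rfl⟩
    have hrange : a '' Set.Ioi 0 = Set.range a' := by
      ext x
      constructor
      · rintro ⟨j, hj, rfl⟩
        obtain ⟨k, rfl⟩ := Fin.exists_succ_eq.2 (Fin.ne_zero_of_lt hj)
        exact ⟨k, rfl⟩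
      · rintro ⟨j, rfl⟩
        exact ⟨j.succ, Fin.succ_pos j, rfl⟩
    have hq : ∀ (n : ℕ) (p : MvPolynomial (Fin d) A), p.IsHomogeneous n →
        MvPolynomial.aeval a' p = 0 → ∀ α, p.coeff α ∈ Ideal.span (Set.range a') :=
      fun n p hp h => MvPolynomial.mem_map_C_iff.1
        (ih (fun i x hx => by rw [him] at hx ⊢; exact ha i.succ x hx) hp h)
    have h0 := ha 0
    rw [hrange] at h0
    have hle : Ideal.span (Set.range a') ≤ Ideal.span (Set.range a) :=
      Ideal.span_mono (by rintro _ ⟨i, rfl⟩; exact ⟨i.succ, rfl⟩)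
    induction n generalizing p with
    | zero =>
      rw [hp.eq_C_coeff] at h ⊢
      rw [show p.coeff 0 = 0 by simpa using h, map_zero]
      exact zero_mem _
    | succ n ihn =>
      obtain ⟨H, G, hH, hG, rfl⟩ := hp.exists_eq_X_mul_add_rename
      rw [map_add, map_mul, MvPolynomial.aeval_X, MvPolynomial.aeval_rename] at h
      have hGa : MvPolynomial.aeval a' G ∈ Ideal.span (Set.range a') ^ (n + 1) :=
        (Ideal.mem_span_pow_iff_exists_isHomogeneous a' _).2 ⟨G, hG, by
          rw [← MvPolynomial.coe_aeval_eq_eval]; rfl⟩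
      have hHa : MvPolynomial.aeval a H ∈ Ideal.span (Set.range a') ^ (n + 1) :=
        mem_span_pow_of_mul_mem hq h0 (n + 1) (by
          rw [eq_neg_of_add_eq_zero_left h]
          exact neg_mem hGa)
      refine add_mem (Ideal.mul_mem_left _ _ ?_) ?_
      · have h1 := Ideal.pow_right_mono hle _ hHa
        rw [pow_succ'] at h1
        obtain ⟨q, hq1, hq2, hq3⟩ := exists_isHomogeneous_of_mem_mul h1
        rw [← sub_add_cancel H q]
        exact add_mem (ihn (hH.sub hq1) (by rw [map_sub, hq3, sub_self]))
          (MvPolynomial.mem_map_C_iff.2 hq2)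
      · obtain ⟨g, hg, hga⟩ := (Ideal.mem_span_pow_iff_exists_isHomogeneous a' _).1 hHa
        rw [← MvPolynomial.coe_aeval_eq_eval, RingHom.coe_coe] at hga
        have h1 : G ∈ Ideal.map MvPolynomial.C (Ideal.span (Set.range a)) := by
          rw [← add_sub_cancel_left (MvPolynomial.C (a 0) * g) G]
          refine sub_mem (Ideal.map_mono hle (MvPolynomial.mem_map_C_iff.2 (hq (n + 1) _
            ((by simpa using (MvPolynomial.isHomogeneous_C (Fin d) (a 0)).mul hg :
              (MvPolynomial.C (a 0) * g).IsHomogeneous (n + 1)).add hG) ?_)))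
            (Ideal.mul_mem_right _ _ (Ideal.mem_map_of_mem _ (Ideal.subset_span ⟨0, rfl⟩)))
          rw [map_add, map_mul, hga, MvPolynomial.aeval_C]
          exact h
        have h2 := Ideal.mem_map_of_mem (MvPolynomial.rename Fin.succ : MvPolynomial (Fin d) A →ₐ[A]
          MvPolynomial (Fin (d + 1)) A).toRingHom h1
        have h3 : (MvPolynomial.rename Fin.succ : MvPolynomial (Fin d) A →ₐ[A]
            MvPolynomial (Fin (d + 1)) A).toRingHom.comp MvPolynomial.C = MvPolynomial.C := by
          ext1 c
          simp
        rwa [Ideal.map_map, h3] at h2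

/-- Regular sequences are quasi-regular. -/
theorem coeff_mem_span_of_aeval_mem {d : ℕ} {a : Fin d → A}
    (ha : ∀ i x, a i * x ∈ Ideal.span (a '' Set.Ioi i) → x ∈ Ideal.span (a '' Set.Ioi i))
    {n : ℕ} {p : MvPolynomial (Fin d) A} (hp : p.IsHomogeneous n)
    (h : MvPolynomial.aeval a p ∈ Ideal.span (Set.range a) ^ (n + 1)) (α : Fin d →₀ ℕ) :
    p.coeff α ∈ Ideal.span (Set.range a) := by
  rw [pow_succ'] at h
  obtain ⟨q, hq1, hq2, hq3⟩ := exists_isHomogeneous_of_mem_mul h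
  have := coeff_mem_span_of_aeval_eq_zero ha (hp.sub hq1) (by rw [map_sub, hq3, sub_self]) α
  rw [MvPolynomial.coeff_sub] at this
  exact (Submodule.sub_mem_iff_left _ (hq2 α)).1 this

end QuasiRegular

/-! ### Polynomial rings over Cohen–Macaulay rings are Cohen–Macaulay -/

section CohenMacaulay

open RingTheory.Sequence IsLocalRing

theorem isCohenMacaulayLocalRing_of_isWeaklyRegular {B : Type*} [CommRing B] [IsLocalRing B]
    [IsNoetherianRing B] {xs : List B} (hx : IsWeaklyRegular B xs)
    (hxs : ∀ x ∈ xs, x ∈ maximalIdeal B)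
    (hq : ∀ q : Ideal B, q.IsPrime → Ideal.ofList xs ≤ q → q = maximalIdeal B) :
    IsCohenMacaulayLocalRing B := by
  have hreg : IsRegular B xs :=
    (isRegular_iff_isWeaklyRegular_of_subset_maximalIdeal hxs).2 hx
  refine ⟨inferInstance, xs, hxs, hreg, ?_⟩
  rw [← ringKrullDim_add_length_eq_ringKrullDim_of_isRegular xs hreg]
  have hne : Ideal.ofList xs ≤ maximalIdeal B := Ideal.span_le.2 hxs
  have : Nontrivial (B ⧸ Ideal.ofList xs) :=
    Ideal.Quotient.nontrivial_iff.2 (ne_top_of_le_ne_top (maximalIdeal.isMaximal B).ne_top hne)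
  have hdim : ringKrullDim (B ⧸ Ideal.ofList xs) = 0 := by
    have : Ring.KrullDimLE 0 (B ⧸ Ideal.ofList xs) := Ring.krullDimLE_zero_iff.2 fun P hP => by
      have hmk := Ideal.Quotient.mk_surjective (I := Ideal.ofList xs)
      have h1 := hq (P.comap (Ideal.Quotient.mk _)) inferInstance fun x hx => by
        rw [Ideal.mem_comap, Ideal.Quotient.eq_zero_iff_mem.2 hx]
        exact zero_mem _
      rw [← Ideal.map_comap_of_surjective _ hmk P, h1]
      refine (Ideal.map_eq_top_or_isMaximal_of_surjective _ hmk
        (maximalIdeal.isMaximal B)).resolve_left fun h => hP.ne_top ?_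
      rw [← h, ← h1, Ideal.map_comap_of_surjective _ hmk P]
    exact ringKrullDimZero_iff_ringKrullDim_eq_zero.1 this
  rw [hdim, zero_add]

theorem IsCohenMacaulayLocalRing.exists_list {B : Type*} [CommRing B] [IsLocalRing B]
    (h : IsCohenMacaulayLocalRing B) : ∃ xs : List B, (∀ x ∈ xs, x ∈ maximalIdeal B) ∧
      IsRegular B xs ∧ (xs.length : WithBot ℕ∞) = ringKrullDim B ∧
      ∀ q : Ideal B, q.IsPrime → Ideal.ofList xs ≤ q → q = maximalIdeal B := by
  obtain ⟨hN, xs, hxs, hreg, hlen⟩ := h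
  refine ⟨xs, hxs, hreg, hlen, fun q hq hle => ?_⟩
  have h1 := ringKrullDim_add_length_eq_ringKrullDim_of_isRegular xs hreg
  have h2 : ringKrullDim (B ⧸ Ideal.ofList xs) ≤ 0 := by
    rw [← hlen] at h1
    generalize ringKrullDim (B ⧸ Ideal.ofList xs) = x at h1
    induction x with
    | bot => exact bot_le
    | coe x =>
      induction x with
      | top => exact absurd (WithBot.coe_injective h1) (by simp)
      | coe n =>
        norm_cast at h1 ⊢
        omega
  have h3 : Ring.KrullDimLE 0 (B ⧸ Ideal.ofList xs) := (Order.krullDimLE_iff 0 _).2 h2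
  have h4 : (q.map (Ideal.Quotient.mk (Ideal.ofList xs))).IsPrime :=
    Ideal.map_isPrime_of_surjective Ideal.Quotient.mk_surjective (by rwa [Ideal.mk_ker])
  have h5 := Ring.krullDimLE_zero_iff.1 h3 _ h4
  have h6 := Ideal.comap_isMaximal_of_surjective (Ideal.Quotient.mk (Ideal.ofList xs))
    Ideal.Quotient.mk_surjective (H := h5)
  rw [Ideal.comap_map_of_surjective _ Ideal.Quotient.mk_surjective, ← RingHom.ker_eq_comap_bot,
    Ideal.mk_ker, sup_eq_left.2 hle] at h6
  exact eq_maximalIdeal h6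

theorem isWeaklyRegular_map_ringEquiv {B C : Type*} [CommRing B] [CommRing C] (e : B ≃+* C)
    {xs : List B} (h : IsWeaklyRegular B xs) : IsWeaklyRegular C (xs.map e) := by
  refine (AddEquiv.isWeaklyRegular_congr (e := e.toAddEquiv) (as := xs) (bs := xs.map e) ?_).1 h
  rw [List.forall₂_map_right_iff, List.forall₂_same]
  intro x _ y
  simp

theorem IsCohenMacaulayLocalRing.of_ringEquiv {B C : Type*} [CommRing B] [CommRing C]
    [IsLocalRing B] [IsLocalRing C] (e : B ≃+* C) (h : IsCohenMacaulayLocalRing B) :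
    IsCohenMacaulayLocalRing C := by
  obtain ⟨hN, xs, hxs, hreg, hlen⟩ := h
  have := isNoetherianRing_of_ringEquiv B e
  have hxs' : ∀ y ∈ xs.map e, y ∈ maximalIdeal C := fun y hy => by
    obtain ⟨x, hx, rfl⟩ := List.mem_map.1 hy
    rw [mem_maximalIdeal, mem_nonunits_iff, MulEquiv.isUnit_map]
    exact (mem_maximalIdeal x).1 (hxs x hx)
  refine ⟨this, xs.map e, hxs', (isRegular_iff_isWeaklyRegular_of_subset_maximalIdeal hxs').2
    (isWeaklyRegular_map_ringEquiv e hreg.toIsWeaklyRegular), ?_⟩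
  rw [List.length_map, hlen, ringKrullDim_eq_of_ringEquiv e]

theorem IsCohenMacaulayRing.of_ringEquiv {B C : Type*} [CommRing B] [CommRing C] (e : B ≃+* C)
    (h : IsCohenMacaulayRing B) : IsCohenMacaulayRing C := by
  have := h.1
  refine ⟨isNoetherianRing_of_ringEquiv B e, fun p hp => ?_⟩
  exact (h.2 (p.comap e)).of_ringEquiv <| IsLocalization.ringEquivOfRingEquiv
    (Localization.AtPrime (p.comap e)) (Localization.AtPrime p) e (e.map_primeCompl_comap_eq p)

/-- A prime over the maximal ideal is either `𝔪B[X]`, where a regular sequence of `B` suffices by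
flatness, or `𝔪B[X] + (y)` with `y` monic. A monic polynomial is a nonzerodivisor modulo any ideal
extended from `B`, so `y` extends the sequence. -/
theorem IsCohenMacaulayLocalRing.polynomial {B : Type*} [CommRing B] [IsLocalRing B]
    (h : IsCohenMacaulayLocalRing B) (p : Ideal B[X]) [p.IsPrime]
    (hp : p.comap C = maximalIdeal B) : IsCohenMacaulayLocalRing (Localization.AtPrime p) := by
  obtain ⟨xs, hxs, hreg, -, hq⟩ := h.exists_list
  have := h.1
  have hreg' : IsWeaklyRegular B[X] (xs.map (algebraMap B B[X])) :=
    hreg.toIsWeaklyRegular.of_flat (S := B[X])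
  have hqle : (maximalIdeal B).map C ≤ p := hp ▸ Ideal.map_comap_le
  have hq' : ∀ q : Ideal B[X], q.IsPrime → Ideal.ofList (xs.map (algebraMap B B[X])) ≤ q →
      (maximalIdeal B).map C ≤ q := fun q hqp hle => by
    have := hq (q.comap C) inferInstance (Ideal.span_le.2 fun x hx =>
      hle (Ideal.subset_span (List.mem_map_of_mem hx)))
    rw [← this]
    exact Ideal.map_comap_le
  suffices h : ∃ ys : List B[X], IsWeaklyRegular B[X] ys ∧ (∀ y ∈ ys, y ∈ p) ∧
      ∀ q : Ideal B[X], q.IsPrime → Ideal.ofList ys ≤ q → p ≤ q by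
    obtain ⟨ys, hys, hyp, hyq⟩ := h
    refine isCohenMacaulayLocalRing_of_isWeaklyRegular
      (hys.of_flat (S := Localization.AtPrime p)) (fun z hz => ?_) fun q hqp hle => ?_
    · obtain ⟨y, hy, rfl⟩ := List.mem_map.1 hz
      exact (IsLocalization.AtPrime.to_map_mem_maximal_iff _ p y).2 (hyp y hy)
    · refine le_antisymm (le_maximalIdeal hqp.ne_top) ?_
      rw [← Localization.AtPrime.map_eq_maximalIdeal, Ideal.map_le_iff_le_comap]
      exact hyq _ inferInstance (Ideal.span_le.2 fun y hy =>
        hle (Ideal.subset_span (List.mem_map_of_mem hy)))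
  by_cases hpq : p = (p.comap C).map C
  · refine ⟨_, hreg', fun y hy => ?_, fun q hqp hle => ?_⟩
    · obtain ⟨x, hx, rfl⟩ := List.mem_map.1 hy
      exact hqle (Ideal.mem_map_of_mem _ (hxs x hx))
    · rw [hpq, hp]
      exact hq' q hqp hle
  · have hmax : (p.comap C).IsMaximal := hp ▸ maximalIdeal.isMaximal B
    obtain ⟨y, hy, hpy⟩ := Polynomial.exists_monic_span_sup_map_eq B p hmax hpq
    rw [hp] at hpy
    refine ⟨xs.map (algebraMap B B[X]) ++ [y], ?_, fun z hz => ?_, fun q hqp hle => ?_⟩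
    · rw [isWeaklyRegular_append_iff, isWeaklyRegular_singleton_iff]
      refine ⟨hreg', ?_⟩
      rw [isSMulRegular_quotient_iff_mem_of_smul_mem]
      intro g hg
      rw [← Ideal.map_ofList, smul_eq_mul, Ideal.mul_top, Polynomial.algebraMap_eq,
        ← Ideal.mk_ker (I := Ideal.ofList xs), ← Polynomial.ker_mapRingHom, RingHom.mem_ker] at hg ⊢
      rw [smul_eq_mul, map_mul] at hg
      exact ((hy.map (Ideal.Quotient.mk (Ideal.ofList xs))).mul_right_eq_zero_iff).1 hg
    · rcases List.mem_append.1 hz with hz | hz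
      · obtain ⟨x, hx, rfl⟩ := List.mem_map.1 hz
        exact hqle (Ideal.mem_map_of_mem _ (hxs x hx))
      · rw [List.mem_singleton.1 hz, hpy]
        exact Ideal.mem_sup_right (Ideal.mem_span_singleton_self y)
    · rw [Ideal.ofList_append, Ideal.ofList_singleton] at hle
      rw [hpy]
      exact sup_le (hq' q hqp (le_sup_left.trans hle)) (le_sup_right.trans hle)

theorem IsCohenMacaulayRing.polynomial {B : Type*} [CommRing B] (h : IsCohenMacaulayRing B) :
    IsCohenMacaulayRing B[X] := by
  have := h.1
  refine ⟨inferInstance, fun p hp => ?_⟩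
  let q := p.comap C
  let S := (Localization.AtPrime q)[X]
  let pc := Submonoid.map Polynomial.C.toMonoidHom q.primeCompl
  let : Algebra B[X] S := algebra B (Localization.AtPrime q)
  have : IsLocalization pc S := Polynomial.isLocalization _ _
  let pS := p.map (algebraMap B[X] S)
  have disj : Disjoint (pc : Set B[X]) (p : Set B[X]) := by
    simpa [pc, q] using! Set.disjoint_image_left.mpr
      (Set.disjoint_compl_left_iff_subset.mpr (fun _ a ↦ a))
  have : pS.IsPrime := IsLocalization.isPrime_of_isPrime_disjoint pc _ _ ‹_› disj
  have : IsLocalization.AtPrime (Localization.AtPrime pS) p := by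
    convert IsLocalization.isLocalization_isLocalization_atPrime_isLocalization pc
      (Localization.AtPrime pS) pS
    exact (IsLocalization.under_map_of_isPrime_disjoint pc _ ‹_› disj).symm
  have eq : pS.comap C = maximalIdeal (Localization.AtPrime q) := by
    rw [← IsLocalization.map_under q.primeCompl _ (pS.comap C),
      ← IsLocalization.map_under q.primeCompl _ (maximalIdeal (Localization.AtPrime q))]
    simp only [Ideal.comap_comap, S, pS]
    rw [← Polynomial.algebraMap_eq (R := Localization.AtPrime q),
      ← IsScalarTower.algebraMap_eq B (Localization.AtPrime q) (Localization.AtPrime q)[X],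
      IsScalarTower.algebraMap_eq B B[X] (Localization.AtPrime q)[X], ← Ideal.comap_comap,
      ← Ideal.under_def B[X], IsLocalization.under_map_of_isPrime_disjoint pc _ ‹_› disj]
    simp [q, IsLocalization.AtPrime.under_maximalIdeal (Localization.AtPrime q) q]
  exact ((h.2 q).polynomial pS eq).of_ringEquiv (IsLocalization.algEquiv p.primeCompl
    (Localization.AtPrime pS) (Localization.AtPrime p)).toRingEquiv

theorem IsCohenMacaulayRing.of_field (k : Type*) [Field k] : IsCohenMacaulayRing k := by
  refine ⟨inferInstance, fun p hp => ?_⟩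
  refine isCohenMacaulayLocalRing_of_isWeaklyRegular (xs := []) (IsWeaklyRegular.nil _ _)
    (by simp) fun q hq _ => ?_
  have : Ring.KrullDimLE 0 (Localization.AtPrime p) := inferInstance
  exact eq_maximalIdeal (Ring.krullDimLE_zero_iff.1 this q hq)

theorem IsCohenMacaulayRing.mvPolynomial {B : Type*} [CommRing B] (h : IsCohenMacaulayRing B)
    (ι : Type*) [Finite ι] : IsCohenMacaulayRing (MvPolynomial ι B) := by
  induction ι using Finite.induction_empty_option with
  | of_equiv e H => exact H.of_ringEquiv (MvPolynomial.renameEquiv _ e).toRingEquiv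
  | h_empty => exact h.of_ringEquiv (MvPolynomial.isEmptyRingEquiv B _).symm
  | h_option IH =>
    exact IH.polynomial.of_ringEquiv (MvPolynomial.optionEquivLeft _ _).toRingEquiv.symm

end CohenMacaulay

/-! ### Sequences that become weakly regular after a localization -/

section LocallyRegular

open RingTheory.Sequence IsLocalRing
open scoped Pointwise TensorProduct

universe u v

/-- The sequence `xs` is weakly regular on `N` up to elements killed by a member of `W`. -/
def LocallyWeaklyRegular {R : Type u} [CommRing R] (W : Submonoid R) :
    List R → ∀ (N : Type v) [AddCommGroup N] [Module R N], Prop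
  | [], _, _, _ => True
  | x :: xs, N, _, _ => (∀ n : N, x • n = 0 → ∃ s ∈ W, s • n = 0) ∧
      LocallyWeaklyRegular W xs (QuotSMulTop x N)

variable {R : Type*} [CommRing R] {W : Submonoid R}

theorem quotSMulTop_mk_eq_zero {N : Type*} [AddCommGroup N] [Module R N] (x : R) (n : N) :
    (Submodule.Quotient.mk n : QuotSMulTop x N) = 0 ↔ ∃ m, x • m = n := by
  rw [Submodule.Quotient.mk_eq_zero, Submodule.mem_smul_pointwise_iff_exists]
  simp

theorem LocallyWeaklyRegular.of_subsingleton (xs : List R) (N : Type*) [AddCommGroup N]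
    [Module R N] [Subsingleton N] : LocallyWeaklyRegular W xs N := by
  induction xs generalizing N with
  | nil => trivial
  | cons x xs ih =>
    refine ⟨fun n _ => ⟨1, one_mem W, Subsingleton.elim _ _⟩, ?_⟩
    have : Subsingleton (QuotSMulTop x N) := (Submodule.Quotient.mk_surjective _).subsingleton
    exact ih _

/-- Injectivity on the left is only required up to `W`, because that is what survives reduction
modulo `x`: regularity on `N₃` preserves it. -/
theorem LocallyWeaklyRegular.of_exact {xs : List R} {N₁ N₂ N₃ : Type*} [AddCommGroup N₁]
    [AddCommGroup N₂] [AddCommGroup N₃] [Module R N₁] [Module R N₂] [Module R N₃]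
    (φ : N₁ →ₗ[R] N₂) (ψ : N₂ →ₗ[R] N₃) (hφ : ∀ m, φ m = 0 → ∃ s ∈ W, s • m = 0)
    (hψ : Function.Surjective ψ) (hex : Function.Exact φ ψ)
    (h₁ : LocallyWeaklyRegular W xs N₁) (h₃ : LocallyWeaklyRegular W xs N₃) :
    LocallyWeaklyRegular W xs N₂ := by
  induction xs generalizing N₁ N₂ N₃ with
  | nil => trivial
  | cons x xs ih =>
    refine ⟨fun n hn => ?_, ih (QuotSMulTop.map x φ) (QuotSMulTop.map x ψ) (fun m hm => ?_)
      (QuotSMulTop.map_surjective x hψ) (QuotSMulTop.map_exact x hex hψ) h₁.2 h₃.2⟩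
    · obtain ⟨s, hs, hsn⟩ := h₃.1 (ψ n) (by rw [← map_smul, hn, map_zero])
      rw [← map_smul] at hsn
      obtain ⟨m, hm⟩ := (hex _).1 hsn
      obtain ⟨t, ht, htm⟩ := hφ (x • m) (by rw [map_smul, hm, smul_comm, hn, smul_zero])
      rw [smul_comm] at htm
      obtain ⟨t', ht', htm'⟩ := h₁.1 _ htm
      refine ⟨t' * t * s, mul_mem (mul_mem ht' ht) hs, ?_⟩
      rw [mul_smul, ← hm, ← map_smul, mul_smul, htm', map_zero]
    · obtain ⟨m, rfl⟩ := Submodule.Quotient.mk_surjective _ m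
      have hm' : (Submodule.Quotient.mk (φ m) : QuotSMulTop x N₂) = 0 := hm
      obtain ⟨n, hn⟩ := (quotSMulTop_mk_eq_zero x _).1 hm'
      obtain ⟨s, hs, hsn⟩ := h₃.1 (ψ n) (by
        rw [← map_smul, hn]
        exact (hex _).2 ⟨m, rfl⟩)
      rw [← map_smul] at hsn
      obtain ⟨l, hl⟩ := (hex _).1 hsn
      obtain ⟨t, ht, htm⟩ := hφ (s • m - x • l) (by
        rw [map_sub, map_smul, map_smul, hl, ← hn, smul_comm, sub_self])
      refine ⟨t * s, mul_mem ht hs, ?_⟩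
      rw [← Submodule.Quotient.mk_smul]
      refine (quotSMulTop_mk_eq_zero x _).2 ⟨t • l, ?_⟩
      rw [smul_comm, mul_smul, ← sub_eq_zero, ← smul_sub, ← neg_sub, smul_neg, htm, neg_zero]

section Semilinear

variable {S : Type*} [CommRing S] (π : R →+* S) {N N' : Type*} [AddCommGroup N] [AddCommGroup N']
  [Module R N] [Module S N']

/-- The map on the quotients by `x` and `π x` induced by a semilinear map. -/
def quotSMulTopSemilinear (f : N →ₛₗ[π] N') (x : R) :
    QuotSMulTop x N →ₛₗ[π] QuotSMulTop (π x) N' :=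
  Submodule.mapQ _ _ f fun n hn => by
    obtain ⟨m, -, rfl⟩ := (Submodule.mem_smul_pointwise_iff_exists _ _ _).1 hn
    rw [Submodule.mem_comap, LinearMap.map_smulₛₗ]
    exact Submodule.smul_mem_pointwise_smul _ _ _ trivial

variable {π} {f : N →ₛₗ[π] N'}

theorem quotSMulTopSemilinear_mk (x : R) (n : N) : quotSMulTopSemilinear π f x
    (Submodule.Quotient.mk n) = Submodule.Quotient.mk (f n) := rfl

theorem quotSMulTopSemilinear_exists (hf : ∀ y, ∃ s ∈ W, ∃ n, π s • y = f n) (x : R) (y) :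
    ∃ s ∈ W, ∃ n, π s • y = quotSMulTopSemilinear π f x n := by
  obtain ⟨y, rfl⟩ := Submodule.Quotient.mk_surjective _ y
  obtain ⟨s, hs, n, hn⟩ := hf y
  exact ⟨s, hs, Submodule.Quotient.mk n, by
    rw [quotSMulTopSemilinear_mk, ← hn, Submodule.Quotient.mk_smul]⟩

theorem quotSMulTopSemilinear_torsion (hf : ∀ y, ∃ s ∈ W, ∃ n, π s • y = f n)
    (hf' : ∀ n, f n = 0 → ∃ s ∈ W, s • n = 0) (x : R) (n)
    (hn : quotSMulTopSemilinear π f x n = 0) : ∃ s ∈ W, s • n = 0 := by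
  obtain ⟨n, rfl⟩ := Submodule.Quotient.mk_surjective _ n
  rw [quotSMulTopSemilinear_mk] at hn
  obtain ⟨y, hy⟩ := (quotSMulTop_mk_eq_zero _ _).1 hn
  obtain ⟨s, hs, m, hm⟩ := hf y
  obtain ⟨t, ht, htm⟩ := hf' (s • n - x • m) (by
    rw [map_sub, LinearMap.map_smulₛₗ, LinearMap.map_smulₛₗ, ← hm, ← hy, smul_comm, sub_self])
  refine ⟨t * s, mul_mem ht hs, ?_⟩
  rw [← Submodule.Quotient.mk_smul]
  refine (quotSMulTop_mk_eq_zero x _).2 ⟨t • m, ?_⟩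
  rw [smul_comm, mul_smul, ← sub_eq_zero, ← smul_sub, ← neg_sub, smul_neg, htm, neg_zero]

/-- `hf` and `hf'` express that `f` becomes bijective once `W` is inverted; both pass to the
quotients by `x`. -/
theorem LocallyWeaklyRegular.map {W' : Submonoid S} (hW : ∀ s ∈ W, π s ∈ W')
    (hf : ∀ y, ∃ s ∈ W, ∃ n, π s • y = f n) (hf' : ∀ n, f n = 0 → ∃ s ∈ W, s • n = 0)
    {xs : List R} (h : LocallyWeaklyRegular W xs N) : LocallyWeaklyRegular W' (xs.map π) N' := by
  induction xs generalizing N N' with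
  | nil => trivial
  | cons x xs ih =>
    refine ⟨fun y hy => ?_, ih (quotSMulTopSemilinear_exists hf x)
      (quotSMulTopSemilinear_torsion hf hf' x) h.2⟩
    obtain ⟨s, hs, n, hn⟩ := hf y
    obtain ⟨t, ht, htn⟩ := hf' (x • n) (by
      rw [LinearMap.map_smulₛₗ, ← hn, smul_comm, hy, smul_zero])
    rw [smul_comm] at htn
    obtain ⟨t', ht', htn'⟩ := h.1 _ htn
    refine ⟨π (t' * t * s), hW _ (mul_mem (mul_mem ht' ht) hs), ?_⟩
    rw [map_mul, mul_smul, hn, ← LinearMap.map_smulₛₗ, mul_smul, htn', map_zero]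

theorem LocallyWeaklyRegular.of_isWeaklyRegular
    (hf : ∀ y, ∃ s ∈ W, ∃ n, π s • y = f n) (hf' : ∀ n, f n = 0 → ∃ s ∈ W, s • n = 0)
    {xs : List R} (h : IsWeaklyRegular N' (xs.map π)) : LocallyWeaklyRegular W xs N := by
  induction xs generalizing N N' with
  | nil => trivial
  | cons x xs ih =>
    rw [List.map_cons, isWeaklyRegular_cons_iff] at h
    refine ⟨fun n hn => hf' n (h.1 ?_), ih (quotSMulTopSemilinear_exists hf x)
      (quotSMulTopSemilinear_torsion hf hf' x) h.2⟩
    simp only [smul_zero]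
    rw [← LinearMap.map_smulₛₗ, hn, map_zero]

end Semilinear

theorem LocallyWeaklyRegular.isWeaklyRegular {N : Type*} [AddCommGroup N] [Module R N]
    {xs : List R} (hW : ∀ s ∈ W, IsUnit s) (h : LocallyWeaklyRegular W xs N) :
    IsWeaklyRegular N xs := by
  induction xs generalizing N with
  | nil => exact IsWeaklyRegular.nil _ _
  | cons x xs ih =>
    refine (isWeaklyRegular_cons_iff _ _ _).2 ⟨isSMulRegular_iff_right_eq_zero_of_smul.2
      fun n hn => ?_, ih h.2⟩
    obtain ⟨s, hs, hsn⟩ := h.1 n hn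
    exact (hW s hs).smul_eq_zero.1 hsn

/-- By flatness of `P`, a composition series of `M` gives a filtration of `P ⊗ M` whose factors are
copies of `P ⊗ k`. -/
theorem LocallyWeaklyRegular.tensorProduct {A P : Type*} [CommRing A] [IsLocalRing A] [CommRing P]
    [Algebra A P] [Module.Flat A P] {W : Submonoid P} {xs : List P}
    (h : LocallyWeaklyRegular W xs (P ⊗[A] ResidueField A)) {M : Type*} [AddCommGroup M]
    [Module A M] (hM : IsFiniteLength A M) : LocallyWeaklyRegular W xs (P ⊗[A] M) := by
  induction hM with
  | of_subsingleton => exact LocallyWeaklyRegular.of_subsingleton _ _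
  | of_simple_quotient hN ih =>
    rename_i M _ _ N hs
    refine ih.of_exact (N.subtype.baseChange P) (N.mkQ.baseChange P) (fun m hm => ?_)
      (LinearMap.lTensor_surjective P N.mkQ_surjective)
      (lTensor_exact P (LinearMap.exact_subtype_mkQ N) N.mkQ_surjective) ?_
    · refine ⟨1, one_mem W, ?_⟩
      rw [one_smul]
      exact (injective_iff_map_eq_zero _).1 (Module.Flat.lTensor_preserves_injective_linearMap
        N.subtype N.injective_subtype) m hm
    · obtain ⟨I, hI, ⟨e⟩⟩ := isSimpleModule_iff_quot_maximal.1 hs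
      obtain rfl := eq_maximalIdeal hI
      let e' : ResidueField A ≃ₗ[A] M ⧸ N := e.symm
      let g := e'.baseChange A P
      have := h.map (W' := W) (π := RingHom.id P) (f := g.toLinearMap) (fun s hs => hs)
        (fun y => ⟨1, one_mem W, g.symm y, by
          rw [map_one, one_smul]
          exact (g.apply_symm_apply y).symm⟩)
        (fun n hn => ⟨1, one_mem W, by
          rw [one_smul]
          exact g.map_eq_zero_iff.1 hn⟩)
      simpa using this

end LocallyRegular

/-! ### A criterion for finite algebras over polynomial rings to be Cohen–Macaulay -/

section Criterion

open RingTheory.Sequence IsLocalRing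
open scoped TensorProduct

variable {A : Type*} [CommRing A] [IsLocalRing A] {ι : Type*}

theorem ker_map_residue_le {q : Ideal (MvPolynomial ι A)}
    (hq : ∀ x ∈ maximalIdeal A, MvPolynomial.C x ∈ q) :
    RingHom.ker (MvPolynomial.map (σ := ι) (residue A)) ≤ q := by
  rw [MvPolynomial.ker_map, ker_residue, Ideal.map_le_iff_le_comap]
  exact hq

/-- Here `P ⊗ k = k[T]` is Cohen–Macaulay. A maximal regular sequence of its localization at the
image of `q` is lifted to `P` after clearing denominators; the last clause records that it is a
system of parameters there. -/
theorem exists_locallyWeaklyRegular [Finite ι] (q : Ideal (MvPolynomial ι A)) [q.IsPrime]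
    (hq : ∀ x ∈ maximalIdeal A, MvPolynomial.C x ∈ q) :
    ∃ zs : List (MvPolynomial ι A), (∀ z ∈ zs, z ∈ q) ∧
      LocallyWeaklyRegular q.primeCompl zs (MvPolynomial ι A ⊗[A] ResidueField A) ∧
      ∀ q' : Ideal (MvPolynomial ι A), q'.IsPrime → q' ≤ q →
        (∀ x ∈ maximalIdeal A, MvPolynomial.C x ∈ q') → (∀ z ∈ zs, z ∈ q') → q' = q := by
  let k := ResidueField A
  let π₀ : MvPolynomial ι A →+* MvPolynomial ι k := MvPolynomial.map (residue A)
  have hπ₀ : Function.Surjective π₀ := MvPolynomial.map_surjective _ residue_surjective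
  have hprime : ∀ q' : Ideal (MvPolynomial ι A), q'.IsPrime →
      (∀ x ∈ maximalIdeal A, MvPolynomial.C x ∈ q') →
      (q'.map π₀).IsPrime ∧ (q'.map π₀).comap π₀ = q' := fun q' _ h => by
    refine ⟨Ideal.map_isPrime_of_surjective hπ₀ (ker_map_residue_le h), ?_⟩
    rw [Ideal.comap_map_of_surjective _ hπ₀, ← RingHom.ker_eq_comap_bot]
    exact sup_eq_left.2 (ker_map_residue_le h)
  obtain ⟨hqp, hqc⟩ := hprime q inferInstance hq
  let L := Localization.AtPrime (q.map π₀)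
  let π : MvPolynomial ι A →+* L := (algebraMap _ L).comp π₀
  have hmem : ∀ z, π z ∈ maximalIdeal L ↔ z ∈ q := fun z => by
    conv_rhs => rw [← hqc]
    exact IsLocalization.AtPrime.to_map_mem_maximal_iff L (q.map π₀) (π₀ z)
  have hN : IsNoetherianRing L := (((IsCohenMacaulayRing.of_field k).mvPolynomial ι).2 _).1
  obtain ⟨xs, hxs, hreg, -, hxq⟩ :=
    (((IsCohenMacaulayRing.of_field k).mvPolynomial ι).2 (q.map π₀)).exists_list
  -- Clearing denominators changes each entry by a unit, so the ideal generated is unchanged;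
  -- regularity is recovered from being a system of parameters.
  have hlift : ∀ x : L, ∃ (z : MvPolynomial ι A) (u : Lˣ), π z = u * x := fun x => by
    obtain ⟨⟨y, s⟩, hy⟩ := IsLocalization.surj (q.map π₀).primeCompl x
    obtain ⟨z, rfl⟩ := hπ₀ y
    exact ⟨z, (IsLocalization.map_units L s).unit, by rw [mul_comm]; exact hy.symm⟩
  choose z u hz using hlift
  have hle : ∀ q' : Ideal L, Ideal.ofList ((xs.map z).map π) ≤ q' → Ideal.ofList xs ≤ q' :=
    fun q' hle => Ideal.span_le.2 fun x hx => by
      have : π (z x) ∈ q' :=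
        hle (Ideal.subset_span (List.mem_map_of_mem (List.mem_map_of_mem hx)))
      rw [hz] at this
      exact (Ideal.unit_mul_mem_iff_mem q' (u x).isUnit).1 this
  have hzm : ∀ x ∈ xs, π (z x) ∈ maximalIdeal L := fun x hx => by
    rw [hz]
    exact Ideal.mul_mem_left _ _ (hxs x hx)
  have hbs : IsWeaklyRegular L ((xs.map z).map π) :=
    isWeaklyRegular_of_isWeaklyRegular hreg.toIsWeaklyRegular hxs (by simpa using hzm) (by simp)
      fun q' hq' h => hxq q' hq' (hle q' h)
  refine ⟨xs.map z, ?_, ?_, ?_⟩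
  · simpa [hmem] using hzm
  · let e : MvPolynomial ι A ⊗[A] k ≃+ MvPolynomial ι k :=
      (TensorProduct.comm A (MvPolynomial ι A) k).toAddEquiv.trans
        (MvPolynomial.algebraTensorAlgEquiv A k).toAddEquiv
    have he : ∀ (a : MvPolynomial ι A) t, e (a • t) = π₀ a * e t := fun a t => by
      induction t using TensorProduct.induction_on with
      | zero => simp
      | add x y hx hy => rw [smul_add, map_add, hx, hy, map_add, mul_add]
      | tmul p c =>
        change MvPolynomial.algebraTensorAlgEquiv A k (c ⊗ₜ (a • p)) =
          π₀ a * MvPolynomial.algebraTensorAlgEquiv A k (c ⊗ₜ p)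
        rw [MvPolynomial.algebraTensorAlgEquiv_tmul, MvPolynomial.algebraTensorAlgEquiv_tmul,
          smul_eq_mul, map_mul, mul_smul_comm]
        rfl
    let f : MvPolynomial ι A ⊗[A] k →ₛₗ[π] L :=
      { toFun := fun t => algebraMap _ L (e t)
        map_add' := fun x y => by rw [map_add, map_add]
        map_smul' := fun a t => by rw [he, map_mul]; rfl }
    have hs : ∀ s : (q.map π₀).primeCompl, ∃ t ∈ q.primeCompl, π₀ t = s := fun s => by
      obtain ⟨t, ht⟩ := hπ₀ s
      refine ⟨t, fun h => s.2 ?_, ht⟩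
      rw [← ht]
      exact Ideal.mem_map_of_mem _ h
    refine LocallyWeaklyRegular.of_isWeaklyRegular (f := f) (fun y => ?_) (fun n hn => ?_) hbs
    · obtain ⟨⟨y', s⟩, hy⟩ := IsLocalization.surj (q.map π₀).primeCompl y
      obtain ⟨t, ht, hts⟩ := hs s
      refine ⟨t, ht, e.symm y', ?_⟩
      change algebraMap _ L (π₀ t) * y = algebraMap _ L (e (e.symm y'))
      rw [e.apply_symm_apply, hts, mul_comm]
      exact hy
    · obtain ⟨s, hs'⟩ := (IsLocalization.map_eq_zero_iff (q.map π₀).primeCompl L (e n)).1 hn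
      obtain ⟨t, ht, hts⟩ := hs s
      refine ⟨t, ht, e.injective ?_⟩
      rw [he, hts, hs', map_zero]
  · intro q' hq' hq'q hq'm hzq'
    obtain ⟨h1, h2⟩ := hprime q' hq' hq'm
    have hdisj : Disjoint ((q.map π₀).primeCompl : Set (MvPolynomial ι k)) (q'.map π₀) :=
      Set.disjoint_compl_left_iff_subset.2 (Ideal.map_mono hq'q)
    have h3 := IsLocalization.isPrime_of_isPrime_disjoint (q.map π₀).primeCompl L _ h1 hdisj
    have h4 := hxq _ h3 (hle _ (Ideal.span_le.2 fun b hb => by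
      obtain ⟨y, hy, rfl⟩ := List.mem_map.1 hb
      exact Ideal.mem_map_of_mem _ (Ideal.mem_map_of_mem _ (hzq' y hy))))
    refine le_antisymm hq'q fun y hy => ?_
    rw [← hmem, ← h4] at hy
    have h5 := IsLocalization.under_map_of_isPrime_disjoint (q.map π₀).primeCompl L h1 hdisj
    rw [← h2, Ideal.mem_comap, ← h5]
    exact hy

/-- At a prime `p` of `G` over `q`, the sequence found for `k[T]` at `q` is regular on the
localization of `G`. It is a system of parameters: a prime `p' ≤ p` containing it contracts to `q`,
and incomparability for integral extensions gives `p' = p`. Nilpotency of `𝔪` in `G` ensures that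
these contractions contain `𝔪`. -/
theorem isCohenMacaulayRing_of_locallyWeaklyRegular [Finite ι] [IsNoetherianRing A]
    {G : Type*} [CommRing G] [Algebra (MvPolynomial ι A) G] [Module.Finite (MvPolynomial ι A) G]
    (hm : ∀ x ∈ maximalIdeal A, IsNilpotent (algebraMap (MvPolynomial ι A) G (MvPolynomial.C x)))
    (h : ∀ (W : Submonoid (MvPolynomial ι A)) (zs : List (MvPolynomial ι A)),
      LocallyWeaklyRegular W zs (MvPolynomial ι A ⊗[A] ResidueField A) →
      LocallyWeaklyRegular W zs G) : IsCohenMacaulayRing G := by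
  have hG : IsNoetherianRing G := IsNoetherianRing.of_finite (MvPolynomial ι A) G
  refine ⟨hG, fun p hp => ?_⟩
  let q := p.comap (algebraMap (MvPolynomial ι A) G)
  have hnil : ∀ p' : Ideal G, p'.IsPrime → ∀ x ∈ maximalIdeal A,
      algebraMap (MvPolynomial ι A) G (MvPolynomial.C x) ∈ p' := fun p' hp' x hx => by
    obtain ⟨n, hn⟩ := hm x hx
    exact hp'.mem_of_pow_mem n (hn ▸ zero_mem _)
  obtain ⟨zs, hzs, hreg, hmin⟩ := exists_locallyWeaklyRegular q fun x hx => hnil p hp x hx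
  have h1 := (h _ _ hreg).map (π := algebraMap (MvPolynomial ι A) G) (W' := p.primeCompl)
    (f := ({ toFun := id, map_add' := fun _ _ => rfl, map_smul' := fun a x => Algebra.smul_def a x } :
      G →ₛₗ[algebraMap (MvPolynomial ι A) G] G)) (fun s hs => hs)
    (fun y => ⟨1, one_mem _, y, by rw [map_one, one_smul]; rfl⟩)
    (fun n hn => ⟨1, one_mem _, by rw [one_smul]; exact hn⟩)
  have h2 := h1.map (π := algebraMap G (Localization.AtPrime p))
    (W' := IsUnit.submonoid (Localization.AtPrime p))
    (f := (
      { toFun := algebraMap G (Localization.AtPrime p)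
        map_add' := map_add _
        map_smul' := fun a x => map_mul _ a x } :
      G →ₛₗ[algebraMap G (Localization.AtPrime p)] Localization.AtPrime p))
    (fun s hs => IsLocalization.map_units (Localization.AtPrime p) (⟨s, hs⟩ : p.primeCompl))
    (fun y => by
      obtain ⟨⟨y', s⟩, hy⟩ := IsLocalization.surj p.primeCompl y
      exact ⟨s, s.2, y', by rw [smul_eq_mul, mul_comm]; exact hy⟩)
    (fun n hn => by
      obtain ⟨s, hs⟩ := (IsLocalization.map_eq_zero_iff p.primeCompl
        (Localization.AtPrime p) n).1 hn
      exact ⟨s, s.2, hs⟩)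
  refine isCohenMacaulayLocalRing_of_isWeaklyRegular (h2.isWeaklyRegular fun s hs => hs)
    (fun y hy => ?_) fun q' hq' hle => ?_
  · rw [List.map_map] at hy
    obtain ⟨z, hz, rfl⟩ := List.mem_map.1 hy
    exact (IsLocalization.AtPrime.to_map_mem_maximal_iff _ p _).2 (hzs z hz)
  · let p' := q'.comap (algebraMap G (Localization.AtPrime p))
    have hp'p : p' ≤ p := fun x hx =>
      (IsLocalization.AtPrime.to_map_mem_maximal_iff (Localization.AtPrime p) p x).1
        (le_maximalIdeal hq'.ne_top hx)
    have hp' : p'.IsPrime := inferInstance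
    have h3 : p'.comap (algebraMap (MvPolynomial ι A) G) = q :=
      hmin _ inferInstance (Ideal.comap_mono hp'p) (fun x hx => hnil p' hp' x hx) fun z hz =>
        hle (Ideal.subset_span (List.mem_map_of_mem (List.mem_map_of_mem hz)))
    have h4 : p' = p := by
      by_contra hne
      have hlt := lt_of_le_of_ne hp'p hne
      exact (Ideal.IsIntegral.comap_lt_comap (R := MvPolynomial ι A) hlt).ne h3
    refine le_antisymm (le_maximalIdeal hq'.ne_top) ?_
    rw [← Localization.AtPrime.map_eq_maximalIdeal, Ideal.map_le_iff_le_comap]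
    exact h4.ge

end Criterion

/-! ### The grading of the associated graded ring -/

section Rees

variable {A : Type*} [CommRing A] (I : Ideal A)

/-- The element `a tⁿ` of the Rees algebra, for `a ∈ Iⁿ`. -/
noncomputable def reesMonomial (n : ℕ) (a : A) (ha : a ∈ I ^ n) : reesAlgebra I :=
  ⟨monomial n a, reesAlgebra.monomial_mem.2 ha⟩

variable {I}

theorem mem_reesPiece {n : ℕ} {x : reesAlgebra I} :
    x ∈ reesPiece I n ↔ ∃ (a : A) (ha : a ∈ I ^ n), x = reesMonomial I n a ha := by
  constructor
  · rintro ⟨a, ha⟩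
    have hx : monomial n a = (x : A[X]) := ha
    refine ⟨a, ?_, Subtype.ext hx.symm⟩
    have := x.2 n
    rwa [← hx, coeff_monomial, if_pos rfl] at this
  · rintro ⟨a, ha, rfl⟩
    exact ⟨a, rfl⟩

theorem reesMonomial_mem (n : ℕ) (a : A) (ha : a ∈ I ^ n) :
    reesMonomial I n a ha ∈ reesPiece I n :=
  mem_reesPiece.2 ⟨a, ha, rfl⟩

theorem reesMonomial_mul {m n : ℕ} {a b : A} (ha : a ∈ I ^ m) (hb : b ∈ I ^ n) :
    reesMonomial I m a ha * reesMonomial I n b hb =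
      reesMonomial I (m + n) (a * b) (pow_add I m n ▸ Ideal.mul_mem_mul ha hb) :=
  Subtype.ext (monomial_mul_monomial m n a b)

theorem coeff_mem (x : reesAlgebra I) (n : ℕ) : (x : A[X]).coeff n ∈ I ^ n := x.2 n

theorem reesAlgebra_eq_sum (x : reesAlgebra I) :
    x = ∑ n ∈ (x : A[X]).support, reesMonomial I n ((x : A[X]).coeff n) (coeff_mem x n) := by
  refine Subtype.ext ?_
  rw [AddSubmonoidClass.coe_finsetSum]
  exact (x : A[X]).as_sum_support

instance : SetLike.GradedMonoid (reesPiece I) where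
  one_mem := mem_reesPiece.2 ⟨1, by simp, Subtype.ext monomial_zero_one.symm⟩
  mul_mem := fun _ _ _ _ hx hy => by
    obtain ⟨a, ha, rfl⟩ := mem_reesPiece.1 hx
    obtain ⟨b, hb, rfl⟩ := mem_reesPiece.1 hy
    rw [reesMonomial_mul]
    exact reesMonomial_mem _ _ _

theorem mem_map_algebraMap_iff {x : reesAlgebra I} :
    x ∈ I.map (algebraMap A (reesAlgebra I)) ↔ ∀ n, (x : A[X]).coeff n ∈ I ^ (n + 1) := by
  constructor
  · intro hx
    refine Submodule.span_induction ?_ (fun n => by simp) (fun x y _ _ hx hy n => ?_)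
      (fun r x _ hx n => ?_) hx
    · rintro _ ⟨c, hc, rfl⟩ n
      change (C c : A[X]).coeff n ∈ _
      rw [coeff_C]
      split_ifs with h
      · simpa [h] using hc
      · exact zero_mem _
    · rw [Subalgebra.coe_add, coeff_add]
      exact add_mem (hx n) (hy n)
    · rw [smul_eq_mul, Subalgebra.coe_mul, coeff_mul]
      refine sum_mem fun ij hij => ?_
      rw [← Finset.HasAntidiagonal.mem_antidiagonal.1 hij, add_assoc, pow_add]
      exact Ideal.mul_mem_mul (coeff_mem r _) (hx _)
  · intro hx
    rw [reesAlgebra_eq_sum x]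
    refine sum_mem fun n _ => ?_
    -- The membership proof is quantified inside, since induction over the product ideal needs a
    -- property of `c` alone.
    have key : ∀ c ∈ I ^ (n + 1), ∃ hc : c ∈ I ^ n, reesMonomial I n c hc ∈
        I.map (algebraMap A (reesAlgebra I)) := fun c hc => by
      rw [pow_succ'] at hc
      refine Submodule.mul_induction_on hc (fun b hb c hc => ?_) ?_
      · refine ⟨Ideal.mul_mem_left _ _ hc, ?_⟩
        have : reesMonomial I n (b * c) (Ideal.mul_mem_left _ _ hc) =
            algebraMap A (reesAlgebra I) b * reesMonomial I n c hc :=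
          Subtype.ext (C_mul_monomial).symm
        rw [this]
        exact Ideal.mul_mem_right _ _ (Ideal.mem_map_of_mem _ hb)
      · rintro b c ⟨hb, hb'⟩ ⟨hc, hc'⟩
        refine ⟨add_mem hb hc, ?_⟩
        have : reesMonomial I n (b + c) (add_mem hb hc) =
            reesMonomial I n b hb + reesMonomial I n c hc := Subtype.ext (map_add _ b c)
        rw [this]
        exact add_mem hb' hc'
    exact (key _ (hx n)).2

noncomputable instance : DistribMulAction (reesAlgebra I) (AssocGradedRing I) :=
  (inferInstance : Module (reesAlgebra I) (AssocGradedRing I)).toDistribMulAction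

noncomputable instance : DistribSMul (reesAlgebra I) (AssocGradedRing I) :=
  (inferInstance : DistribMulAction (reesAlgebra I) (AssocGradedRing I)).toDistribSMul

noncomputable instance : SMulZeroClass (reesAlgebra I) (AssocGradedRing I) :=
  (inferInstance : DistribSMul (reesAlgebra I) (AssocGradedRing I)).toSMulZeroClass

noncomputable instance : MulAction (reesAlgebra I) (AssocGradedRing I) :=
  (inferInstance : DistribMulAction (reesAlgebra I) (AssocGradedRing I)).toMulAction

noncomputable instance : SMul (reesAlgebra I) (AssocGradedRing I) :=
  (inferInstance : MulAction (reesAlgebra I) (AssocGradedRing I)).toSMul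

variable (I) in
/-- The projection from the Rees algebra onto the associated graded ring. -/
noncomputable def reesMk : reesAlgebra I →+* AssocGradedRing I := Ideal.Quotient.mk _

theorem reesMk_surjective : Function.Surjective (reesMk I) := Ideal.Quotient.mk_surjective

theorem reesMk_eq_zero {x : reesAlgebra I} :
    reesMk I x = 0 ↔ ∀ n, (x : A[X]).coeff n ∈ I ^ (n + 1) :=
  Ideal.Quotient.eq_zero_iff_mem.trans mem_map_algebraMap_iff

theorem reesMk_reesMonomial_eq_zero {n : ℕ} {a : A} {ha : a ∈ I ^ n} :
    reesMk I (reesMonomial I n a ha) = 0 ↔ a ∈ I ^ (n + 1) := by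
  rw [reesMk_eq_zero]
  constructor
  · intro h
    simpa [reesMonomial] using h n
  · intro h m
    change (monomial n a).coeff m ∈ _
    rw [coeff_monomial]
    split_ifs with hm
    · rwa [← hm]
    · exact zero_mem _

theorem smul_assocGraded (r : reesAlgebra I) (x : reesAlgebra I) : r • reesMk I x = reesMk I (r * x) :=
  rfl

variable (I) in
/-- The components of the associated graded ring, indexed by the integers. -/
noncomputable def assocGradedPieceInt (n : ℤ) : AddSubgroup (AssocGradedRing I) :=
  if 0 ≤ n then (assocGradedPiece I n.toNat).toAddSubgroup else ⊥

theorem assocGradedPieceInt_natCast (n : ℕ) :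
    assocGradedPieceInt I n = (assocGradedPiece I n).toAddSubgroup := by
  rw [assocGradedPieceInt, if_pos (Int.natCast_nonneg n), Int.toNat_natCast]

theorem assocGradedPieceInt_of_neg {n : ℤ} (hn : n < 0) : assocGradedPieceInt I n = ⊥ :=
  if_neg (not_le.2 hn)

theorem mem_assocGradedPiece {n : ℕ} {x : AssocGradedRing I} :
    x ∈ assocGradedPiece I n ↔ ∃ (a : A) (ha : a ∈ I ^ n), x = reesMk I (reesMonomial I n a ha) := by
  constructor
  · rintro ⟨y, hy, rfl⟩
    obtain ⟨a, ha, rfl⟩ := mem_reesPiece.1 hy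
    exact ⟨a, ha, rfl⟩
  · rintro ⟨a, ha, rfl⟩
    exact ⟨_, reesMonomial_mem n a ha, rfl⟩

theorem mem_assocGradedPieceInt_natCast {n : ℕ} {x : AssocGradedRing I} :
    x ∈ assocGradedPieceInt I n ↔
      ∃ (a : A) (ha : a ∈ I ^ n), x = reesMk I (reesMonomial I n a ha) := by
  rw [assocGradedPieceInt_natCast]
  exact mem_assocGradedPiece

theorem assocGraded_gradedSMul : GradedSMul (reesPiece I) (assocGradedPieceInt I) := by
  intro l n r hr x hx
  rcases lt_or_ge n 0 with hn | hn
  · rw [assocGradedPieceInt_of_neg hn, AddSubgroup.mem_bot] at hx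
    rw [hx, smul_zero]
    exact zero_mem _
  · lift n to ℕ using hn
    obtain ⟨a, ha, rfl⟩ := mem_assocGradedPieceInt_natCast.1 hx
    obtain ⟨b, hb, rfl⟩ := mem_reesPiece.1 hr
    rw [smul_assocGraded, reesMonomial_mul, ← Nat.cast_add, add_comm n l]
    exact mem_assocGradedPieceInt_natCast.2 ⟨_, _, rfl⟩

variable (I) in
theorem nonempty_gradedProj_assocGraded : Nonempty (GradedProj (assocGradedPieceInt I)) := by
  classical
  refine GradedProj.nonempty_of_span_of_indep (fun x => ?_) fun F y hy h0 => ?_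
  · obtain ⟨x, rfl⟩ := reesMk_surjective x
    refine ⟨(x : A[X]).support.image Nat.cast, fun n => if 0 ≤ n then
      reesMk I (reesMonomial I n.toNat _ (coeff_mem x n.toNat)) else 0, fun n => ?_, ?_⟩
    · dsimp only
      split_ifs with hn
      · lift n to ℕ using hn
        exact mem_assocGradedPieceInt_natCast.2 ⟨_, _, rfl⟩
      · exact zero_mem _
    · rw [Finset.sum_image (by simp)]
      conv_lhs => rw [reesAlgebra_eq_sum x, map_sum]
      exact Finset.sum_congr rfl fun n _ => by rw [if_pos (Int.natCast_nonneg n)]; rfl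
  · have hex : ∀ n : ℤ, ∃ (a : A) (ha : a ∈ I ^ n.toNat), n ∈ F →
        y n = reesMk I (reesMonomial I n.toNat a ha) ∧ (n < 0 → a = 0) := fun n => by
      by_cases hn : n ∈ F
      · have := hy n hn
        rcases lt_or_ge n 0 with h | h
        · rw [assocGradedPieceInt_of_neg h, AddSubgroup.mem_bot] at this
          refine ⟨0, zero_mem _, fun _ => ⟨?_, fun _ => rfl⟩⟩
          rw [this, eq_comm, reesMk_reesMonomial_eq_zero]
          exact zero_mem _
        · lift n to ℕ using h
          obtain ⟨a, ha, h⟩ := mem_assocGradedPieceInt_natCast.1 this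
          exact ⟨a, ha, fun _ => ⟨h, fun h' => by omega⟩⟩
      · exact ⟨0, zero_mem _, fun h => absurd h hn⟩
    choose a ha hya using hex
    rw [Finset.sum_congr rfl fun n hn => (hya n hn).1, ← map_sum, reesMk_eq_zero] at h0
    intro n hn
    rw [(hya n hn).1, reesMk_reesMonomial_eq_zero]
    rcases lt_or_ge n 0 with h | h
    · rw [(hya n hn).2 h]
      exact zero_mem _
    · have h1 := h0 n.toNat
      rw [AddSubmonoidClass.coe_finsetSum, finsetSum_coeff, Finset.sum_eq_single_of_mem n hn] at h1
      · simpa [reesMonomial] using h1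
      · intro m hm hmn
        change (monomial m.toNat (a m)).coeff n.toNat = 0
        rw [coeff_monomial]
        split_ifs with hmn'
        · exact (hya m hm).2 (by omega)
        · rfl

variable {r : ℕ} (f : Fin r → reesAlgebra I)

/-- Extending the grading of `G` by zero to negative degrees adds no new fractions. -/
theorem cechLocalizationPiece_eq (S : Finset (Fin r)) (n : ℤ) :
    cechLocalizationPiece f (AssocGradedRing I) (reesPiece I) (assocGradedPiece I) S n =
      localizedPiece (reesPiece I) (assocGradedPieceInt I) f assocGraded_gradedSMul S n := by
  refine le_antisymm ((AddSubgroup.closure_le _).2 ?_) ?_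
  · rintro x ⟨j, l, m, s, hm, hs, hn, rfl⟩
    refine ⟨l, m, s, ?_, hs, rfl⟩
    rw [← hn, sub_add_cancel, assocGradedPieceInt_natCast]
    exact hm
  · rintro x ⟨l, m, s, hm, hs, rfl⟩
    rcases lt_or_ge (n + l) 0 with hn | hn
    · rw [assocGradedPieceInt_of_neg hn, AddSubgroup.mem_bot] at hm
      rw [hm, LocalizedModule.zero_mk]
      exact AddSubgroup.zero_mem _
    · obtain ⟨j, hj⟩ := Int.eq_ofNat_of_zero_le hn
      rw [hj, assocGradedPieceInt_natCast] at hm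
      exact AddSubgroup.subset_closure ⟨j, l, m, s, hm, hs, by omega, rfl⟩

theorem assocGradedCohomologyPiece_eq (p : ℕ) (n : ℤ) :
    assocGradedCohomologyPiece I f p n =
      cohomologyPiece (reesPiece I) (assocGradedPieceInt I) f assocGraded_gradedSMul p n := by
  unfold assocGradedCohomologyPiece cechLocalCohomologyPiece cohomologyPiece cechTotalPiece
  simp only [cechLocalizationPiece_eq]

end Rees

/-! ### The associated graded ring when `I ^ 2 = Q * I` -/

section GoodReduction

open IsLocalRing
open scoped TensorProduct

variable {A : Type*} [CommRing A]

theorem isFiniteLength_quotient_of_radical_eq [IsLocalRing A] [IsNoetherianRing A] {J : Ideal A}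
    (hJ : J.radical = maximalIdeal A) : IsFiniteLength A (A ⧸ J) := by
  have hmin : maximalIdeal A ∈ J.minimalPrimes := by
    refine ⟨⟨inferInstance, hJ ▸ Ideal.le_radical⟩, fun q hq _ => ?_⟩
    have := hq.1
    rw [← hJ]
    exact hq.1.radical_le_iff.2 hq.2
  have := quotient_artinian_of_mem_minimalPrimes_of_isLocalRing _ hmin
  rw [← Module.length_ne_top_iff, Module.length_eq_of_surjective (S := A) (R := A ⧸ J)
    Ideal.Quotient.mk_surjective]
  exact Module.length_ne_top

variable {I : Ideal A} {ι : Type*} {a : ι → A}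

/-- The map `T i ↦ a i * t` from a polynomial ring to the Rees algebra. -/
noncomputable def reesEval (ha : ∀ i, a i ∈ I) : MvPolynomial ι A →ₐ[A] reesAlgebra I :=
  MvPolynomial.aeval fun i => reesMonomial I 1 (a i) (by simpa using ha i)

variable (ha : ∀ i, a i ∈ I)

theorem reesEval_X (i : ι) :
    reesEval ha (MvPolynomial.X i) = reesMonomial I 1 (a i) (by simpa using ha i) :=
  MvPolynomial.aeval_X _ i

theorem coe_reesEval_of_isHomogeneous {p : MvPolynomial ι A} {n : ℕ} (hp : p.IsHomogeneous n) :
    (reesEval ha p : A[X]) = monomial n (MvPolynomial.aeval a p) := by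
  have h : ((reesAlgebra I).val.comp (reesEval ha)) p =
      MvPolynomial.aeval (fun i => (monomial 1 (a i) : A[X])) p :=
    DFunLike.congr_fun (MvPolynomial.algHom_ext (fun i => by
      rw [AlgHom.comp_apply, reesEval_X, MvPolynomial.aeval_X]
      rfl)) p
  refine h.trans ?_
  rw [MvPolynomial.aeval_def, MvPolynomial.eval₂_eq, MvPolynomial.aeval_def, MvPolynomial.eval₂_eq,
    map_sum]
  refine Finset.sum_congr rfl fun α hα => ?_
  simp only [monomial_pow, one_mul]
  have hprod : ∀ s : Finset ι, ∏ i ∈ s, (monomial (α i) (a i ^ α i) : A[X]) =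
      monomial (∑ i ∈ s, α i) (∏ i ∈ s, a i ^ α i) := fun s => by
    classical
    induction s using Finset.induction_on with
    | empty => simp
    | insert i s hi ih => rw [Finset.prod_insert hi, Finset.sum_insert hi, Finset.prod_insert hi,
        ih, monomial_mul_monomial]
  rw [hprod, show ∑ i ∈ α.support, α i = n from by
      rw [← hp (MvPolynomial.mem_support_iff.1 hα), Finsupp.weight_apply]
      simp [Finsupp.sum], Polynomial.algebraMap_eq, C_mul_monomial]
  rfl

theorem coeff_reesEval (p : MvPolynomial ι A) (n : ℕ) :
    (reesEval ha p : A[X]).coeff n = MvPolynomial.aeval a (MvPolynomial.homogeneousComponent n p) := by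
  conv_lhs => rw [← MvPolynomial.sum_homogeneousComponent p]
  rw [map_sum, AddSubmonoidClass.coe_finsetSum, finsetSum_coeff]
  simp only [coe_reesEval_of_isHomogeneous ha (MvPolynomial.homogeneousComponent_isHomogeneous _ p),
    coeff_monomial]
  rw [Finset.sum_ite_eq']
  split_ifs with h
  · rfl
  · rw [MvPolynomial.homogeneousComponent_eq_zero _ _ (by simpa using h), map_zero]

theorem tmul_mk_one_eq_zero {K : Ideal A} {p : MvPolynomial ι A} (hp : ∀ α, p.coeff α ∈ K) :
    p ⊗ₜ[A] (1 : A ⧸ K) = 0 := by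
  rw [p.as_sum, TensorProduct.sum_tmul]
  refine Finset.sum_eq_zero fun α _ => ?_
  rw [show MvPolynomial.monomial α (p.coeff α) = p.coeff α • MvPolynomial.monomial α (1 : A) by
    rw [MvPolynomial.smul_monomial, smul_eq_mul, mul_one], TensorProduct.smul_tmul,
    Algebra.smul_def, mul_one, Ideal.Quotient.algebraMap_eq, Ideal.Quotient.eq_zero_iff_mem.2 (hp α),
    TensorProduct.tmul_zero]

theorem coeff_mem_of_homogeneousComponent {K : Ideal A} {p : MvPolynomial ι A}
    (hp : ∀ n α, (MvPolynomial.homogeneousComponent n p).coeff α ∈ K) (α : ι →₀ ℕ) :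
    p.coeff α ∈ K := by
  have := hp α.degree α
  rwa [MvPolynomial.coeff_homogeneousComponent, if_pos rfl] at this

theorem exists_eq_tmul_one {K : Ideal A} (x : MvPolynomial ι A ⊗[A] (A ⧸ K)) :
    ∃ p, x = p ⊗ₜ 1 := by
  induction x using TensorProduct.induction_on with
  | zero => exact ⟨0, (TensorProduct.zero_tmul _ _).symm⟩
  | add x y hx hy =>
    obtain ⟨p, rfl⟩ := hx
    obtain ⟨q, rfl⟩ := hy
    exact ⟨p + q, (TensorProduct.add_tmul _ _ _).symm⟩
  | tmul p c =>
    obtain ⟨c, rfl⟩ := Ideal.Quotient.mk_surjective c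
    refine ⟨c • p, ?_⟩
    rw [TensorProduct.smul_tmul, Algebra.smul_def, mul_one]
    rfl

/-- The linear map `c ↦ c t` from `I` to the Rees algebra. -/
noncomputable def reesDegreeOne : I →ₗ[A] reesAlgebra I where
  toFun c := reesMonomial I 1 c (by simp)
  map_add' b c := Subtype.ext (map_add (monomial 1) (b : A) c)
  map_smul' b c := Subtype.ext (map_smul (monomial 1) b (c : A))

theorem coeff_reesEval_mul_reesDegreeOne (p : MvPolynomial ι A) (c : I) (n : ℕ) :
    ((reesEval ha p * reesDegreeOne c : reesAlgebra I) : A[X]).coeff (n + 1) =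
      MvPolynomial.aeval a (MvPolynomial.homogeneousComponent n ((c : A) • p)) := by
  rw [Subalgebra.coe_mul, map_smul, map_smul, ← coeff_reesEval ha, smul_eq_mul, mul_comm (c : A)]
  exact coeff_mul_monomial _ _ _ _

end GoodReduction

/-! ### The extension of `P ⊗ I/Q` by `P ⊗ A/I` that describes `G` -/

section GoodReductionExact

open IsLocalRing
open scoped TensorProduct

variable {A : Type*} [CommRing A] {I : Ideal A} {d : ℕ} {a : Fin d → A} (ha : ∀ i, a i ∈ I)

/-- Multiplication `P ⊗ I → P` for a polynomial ring `P`. -/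
noncomputable def tensorIdealMul (I : Ideal A) (ι : Type*) :
    MvPolynomial ι A ⊗[A] I →ₗ[MvPolynomial ι A] MvPolynomial ι A :=
  LinearMap.liftBaseChange (MvPolynomial ι A) ((Algebra.linearMap A (MvPolynomial ι A)).comp I.subtype)

theorem tensorIdealMul_tmul (p : MvPolynomial (Fin d) A) (c : I) :
    tensorIdealMul I (Fin d) (p ⊗ₜ c) = (c : A) • p := by
  rw [tensorIdealMul, LinearMap.liftBaseChange_tmul, Algebra.smul_def (c : A), mul_comm]
  rfl

/-- The map `P ⊗ (I / Q) → P ⊗ (A / Q)` for ideals `I` and `Q`. -/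
noncomputable def idealQuotientMap (I Q : Ideal A) : (I ⧸ Q.submoduleOf I) →ₗ[A] A ⧸ Q :=
  Submodule.mapQ _ _ I.subtype le_rfl

theorem idealQuotientMap_injective (I Q : Ideal A) : Function.Injective (idealQuotientMap I Q) := by
  rw [injective_iff_map_eq_zero]
  intro c hc
  obtain ⟨c, rfl⟩ := Submodule.Quotient.mk_surjective _ c
  have hc' : (Submodule.Quotient.mk (c : A) : A ⧸ Q) = 0 := hc
  rw [Submodule.Quotient.mk_eq_zero] at hc' ⊢
  exact hc'

/-- Since `I/Q` embeds in `A/Q` and `P` is flat, vanishing in `P ⊗ I/Q` can be tested on polynomial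
coefficients modulo `Q`. -/
theorem baseChange_mkQ_eq_zero {Q : Ideal A} {x : MvPolynomial (Fin d) A ⊗[A] I}
    (hx : ∀ α, (tensorIdealMul I (Fin d) x).coeff α ∈ Q) :
    (Q.submoduleOf I).mkQ.baseChange (MvPolynomial (Fin d) A) x = 0 := by
  have hinj : Function.Injective ((idealQuotientMap I Q).baseChange (MvPolynomial (Fin d) A)) :=
    Module.Flat.lTensor_preserves_injective_linearMap _ (idealQuotientMap_injective I Q)
  apply hinj
  rw [map_zero, ← tmul_mk_one_eq_zero hx]
  clear hx
  induction x using TensorProduct.induction_on with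
  | zero => simp
  | add x y hx hy => rw [map_add, map_add, map_add, TensorProduct.add_tmul, hx, hy]
  | tmul p c =>
    rw [tensorIdealMul_tmul, LinearMap.baseChange_tmul, LinearMap.baseChange_tmul,
      TensorProduct.smul_tmul, Algebra.smul_def, mul_one]
    rfl

variable (hreg : ∀ i x, a i * x ∈ Ideal.span (a '' Set.Ioi i) → x ∈ Ideal.span (a '' Set.Ioi i))
  (hQI : I ^ 2 = Ideal.span (Set.range a) * I)

include hQI in
theorem pow_succ_eq_of_sq (n : ℕ) : I ^ (n + 1) = Ideal.span (Set.range a) ^ n * I := by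
  have := pow_add_eq_of_isReduction (n := 1) (hQI.trans (by rw [pow_one])) n
  rwa [pow_one, add_comm] at this

-- As `I ^ (n + 1) = I Q^n`, the value `p(a)` is also that of a form with coefficients in `I`;
-- quasi-regularity puts the difference of coefficients in `Q ⊆ I`.
include hreg hQI ha in
theorem coeff_mem_of_aeval_mem_pow {n : ℕ} {p : MvPolynomial (Fin d) A} (hp : p.IsHomogeneous n)
    (h : MvPolynomial.aeval a p ∈ I ^ (n + 1)) (α : Fin d →₀ ℕ) : p.coeff α ∈ I := by
  rw [pow_succ_eq_of_sq hQI, mul_comm] at h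
  obtain ⟨q, hq1, hq2, hq3⟩ := exists_isHomogeneous_of_mem_mul h
  have h1 := coeff_mem_span_of_aeval_eq_zero hreg (hp.sub hq1) (by rw [map_sub, hq3, sub_self]) α
  rw [MvPolynomial.coeff_sub] at h1
  have h2 : Ideal.span (Set.range a) ≤ I := Ideal.span_le.2 (by rintro _ ⟨i, rfl⟩; exact ha i)
  exact (Submodule.sub_mem_iff_left _ (hq2 α)).1 (h2 h1)

variable {G : Type*} [CommRing G] [Algebra A G] (mk : reesAlgebra I →ₐ[A] G)

/-- The linear map `c ↦ c` from `A / I` to the associated graded ring. -/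
noncomputable def degreeZeroMap (hker : ∀ x, mk x = 0 ↔ ∀ n, (x : A[X]).coeff n ∈ I ^ (n + 1)) :
    (A ⧸ I) →ₗ[A] G :=
  Submodule.liftQ I (Algebra.linearMap A G) fun c hc => by
    rw [LinearMap.mem_ker, Algebra.linearMap_apply, ← mk.commutes, hker]
    intro n
    change (C c : A[X]).coeff n ∈ _
    rw [coeff_C]
    split_ifs with h
    · simpa [h] using hc
    · exact zero_mem _

variable {mk} (hmk : Function.Surjective mk)
  (hker : ∀ x, mk x = 0 ↔ ∀ n, (x : A[X]).coeff n ∈ I ^ (n + 1))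

-- The map `φ` from `P ⊗ A/I` to `G` is injective by quasi-regularity, and `ρ`, sending `p ⊗ c` to
-- `p · ct`, identifies `P ⊗ I/Q` with its cokernel. Surjectivity of `ρ` is `I ^ (n + 1) = Q ^ n I`.
-- Both ends come from `A`-modules of finite length, so regularity on `P ⊗ k` passes to `G`.
include ha hreg hQI hmk hker in
theorem finite_and_locallyWeaklyRegular_of_sq [IsLocalRing A] [IsNoetherianRing A]
    (hI : I.radical = maximalIdeal A) (hQ : (Ideal.span (Set.range a)).radical = maximalIdeal A)
    [Algebra (MvPolynomial (Fin d) A) G] [IsScalarTower A (MvPolynomial (Fin d) A) G]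
    (hG : ∀ p, algebraMap (MvPolynomial (Fin d) A) G p = mk (reesEval ha p)) :
    Module.Finite (MvPolynomial (Fin d) A) G ∧
    ∀ (W : Submonoid (MvPolynomial (Fin d) A)) (zs : List (MvPolynomial (Fin d) A)),
      LocallyWeaklyRegular W zs (MvPolynomial (Fin d) A ⊗[A] ResidueField A) →
      LocallyWeaklyRegular W zs G := by
  set Q := Ideal.span (Set.range a) with hQdef
  set P := MvPolynomial (Fin d) A with hP
  have hsmul : ∀ (p : P) (x : reesAlgebra I), p • mk x = mk (reesEval ha p * x) := fun p x => by
    rw [Algebra.smul_def, hG, map_mul]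
  let φ : P ⊗[A] (A ⧸ I) →ₗ[P] G := LinearMap.liftBaseChange P (degreeZeroMap mk hker)
  have hφ1 : ∀ p : P, φ (p ⊗ₜ 1) = mk (reesEval ha p) := fun p => by
    rw [LinearMap.liftBaseChange_tmul]
    have : degreeZeroMap mk hker 1 = 1 := map_one (algebraMap A G)
    rw [this, Algebra.smul_def, mul_one, hG]
  have hφ : Function.Injective φ := by
    rw [injective_iff_map_eq_zero]
    intro x hx
    obtain ⟨p, rfl⟩ := exists_eq_tmul_one x
    rw [hφ1, hker] at hx
    refine tmul_mk_one_eq_zero (coeff_mem_of_homogeneousComponent fun n =>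
      coeff_mem_of_aeval_mem_pow ha hreg hQI (MvPolynomial.homogeneousComponent_isHomogeneous n p) ?_)
    rw [← coeff_reesEval ha]
    exact hx n
  let N := G ⧸ LinearMap.range φ
  let g : I →ₗ[A] N := ((LinearMap.range φ).mkQ.restrictScalars A).comp
    (mk.toLinearMap.comp reesDegreeOne)
  have hg : ∀ c : I, g c = (LinearMap.range φ).mkQ (mk (reesDegreeOne c)) := fun c => rfl
  have hgQ : Q.submoduleOf I ≤ LinearMap.ker g := fun c hc => by
    obtain ⟨p, hp, hpc⟩ := (Ideal.mem_span_pow_iff_exists_isHomogeneous (n := 1) a (c : A)).1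
      (by rw [pow_one]; exact hc)
    rw [LinearMap.mem_ker, hg, Submodule.mkQ_apply, Submodule.Quotient.mk_eq_zero]
    refine ⟨p ⊗ₜ 1, ?_⟩
    rw [hφ1]
    congr 1
    refine Subtype.ext ?_
    rw [coe_reesEval_of_isHomogeneous ha hp, ← RingHom.coe_coe (MvPolynomial.aeval a),
      MvPolynomial.coe_aeval_eq_eval, hpc]
    rfl
  let ρ : P ⊗[A] (I ⧸ Q.submoduleOf I) →ₗ[P] N :=
    LinearMap.liftBaseChange P (Submodule.liftQ (Q.submoduleOf I) g hgQ)
  have hρ1 : ∀ (p : P) (c : I), ρ (p ⊗ₜ Submodule.Quotient.mk c) =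
      (LinearMap.range φ).mkQ (mk (reesEval ha p * reesDegreeOne c)) := fun p c => by
    rw [LinearMap.liftBaseChange_tmul, ← hsmul, map_smul]
    rfl
  have hρs : Function.Surjective ρ := by
    have key : ∀ n, ∀ c ∈ I ^ n, ∃ hc : c ∈ I ^ n,
        (LinearMap.range φ).mkQ (mk (reesMonomial I n c hc)) ∈ LinearMap.range ρ := fun n c hc => by
      rcases n with _ | n
      · refine ⟨hc, 0, ?_⟩
        rw [map_zero, eq_comm, Submodule.mkQ_apply, Submodule.Quotient.mk_eq_zero]
        refine ⟨MvPolynomial.C c ⊗ₜ 1, ?_⟩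
        rw [hφ1]
        congr 1
        refine Subtype.ext ?_
        rw [coe_reesEval_of_isHomogeneous ha (MvPolynomial.isHomogeneous_C _ c),
          MvPolynomial.aeval_C]
        rfl
      · have hc' := hc
        rw [pow_succ_eq_of_sq hQI] at hc'
        refine Submodule.mul_induction_on hc' (fun z hz b hb => ?_) ?_
        · obtain ⟨p, hp, rfl⟩ := (Ideal.mem_span_pow_iff_exists_isHomogeneous a z).1 hz
          have hmem : MvPolynomial.eval a p * b ∈ I ^ (n + 1) := by
            rw [pow_succ_eq_of_sq hQI]
            exact Ideal.mul_mem_mul hz hb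
          refine ⟨hmem, p ⊗ₜ Submodule.Quotient.mk ⟨b, hb⟩, ?_⟩
          rw [hρ1]
          congr 2
          refine Subtype.ext ?_
          rw [Subalgebra.coe_mul, coe_reesEval_of_isHomogeneous ha hp,
            ← RingHom.coe_coe (MvPolynomial.aeval a), MvPolynomial.coe_aeval_eq_eval]
          exact monomial_mul_monomial _ _ _ _
        · rintro x y ⟨hx, hx'⟩ ⟨hy, hy'⟩
          refine ⟨add_mem hx hy, ?_⟩
          have : reesMonomial I (n + 1) (x + y) (add_mem hx hy) =
              reesMonomial I (n + 1) x hx + reesMonomial I (n + 1) y hy :=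
            Subtype.ext (map_add (monomial (n + 1)) x y)
          rw [this, map_add, map_add]
          exact add_mem hx' hy'
    intro y
    obtain ⟨y, rfl⟩ := Submodule.Quotient.mk_surjective _ y
    obtain ⟨x, rfl⟩ := hmk y
    change (LinearMap.range φ).mkQ (mk x) ∈ LinearMap.range ρ
    rw [reesAlgebra_eq_sum x, map_sum, map_sum]
    exact sum_mem fun n _ => (key n _ (coeff_mem x n)).2
  have hρi : Function.Injective ρ := by
    rw [injective_iff_map_eq_zero]
    intro x hx
    obtain ⟨x, rfl⟩ := LinearMap.lTensor_surjective P (Q.submoduleOf I).mkQ_surjective x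
    obtain ⟨θ, hθ1, hθ2⟩ : ∃ θ : reesAlgebra I, ρ ((Q.submoduleOf I).mkQ.lTensor P x) =
        (LinearMap.range φ).mkQ (mk θ) ∧ ∀ n, (θ : A[X]).coeff (n + 1) =
        MvPolynomial.aeval a (MvPolynomial.homogeneousComponent n (tensorIdealMul I (Fin d) x)) := by
      clear hx
      induction x using TensorProduct.induction_on with
      | zero => exact ⟨0, by simp, by simp⟩
      | add x y hx hy =>
        obtain ⟨θ, h1, h2⟩ := hx
        obtain ⟨θ', h1', h2'⟩ := hy
        refine ⟨θ + θ', by rw [map_add, map_add, map_add, map_add, h1, h1'], fun n => ?_⟩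
        rw [Subalgebra.coe_add, coeff_add, h2, h2', map_add, map_add, map_add]
      | tmul p c =>
        refine ⟨_, hρ1 p c, fun n => ?_⟩
        rw [coeff_reesEval_mul_reesDegreeOne, tensorIdealMul_tmul]
    rw [hθ1, Submodule.mkQ_apply, Submodule.Quotient.mk_eq_zero] at hx
    obtain ⟨y, hy⟩ := hx
    obtain ⟨p, rfl⟩ := exists_eq_tmul_one y
    rw [hφ1, eq_comm, ← sub_eq_zero, ← map_sub, hker] at hy
    refine baseChange_mkQ_eq_zero (coeff_mem_of_homogeneousComponent fun n =>
      coeff_mem_span_of_aeval_mem hreg (MvPolynomial.homogeneousComponent_isHomogeneous n _) ?_)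
    -- In degree `n + 1`, a form of degree `n` in `a` agrees with an element of `Q ^ (n + 1)` up to
    -- `I ^ (n + 2) = Q ^ (n + 1) I`. It therefore lies in `Q ^ (n + 1)`, and quasi-regularity
    -- applies.
    have h1 := hy (n + 1)
    rw [Subalgebra.coe_sub, coeff_sub, hθ2, coeff_reesEval, pow_succ_eq_of_sq hQI] at h1
    have h2 : MvPolynomial.aeval a (MvPolynomial.homogeneousComponent (n + 1) p) ∈ Q ^ (n + 1) :=
      (Ideal.mem_span_pow_iff_exists_isHomogeneous a _).2 ⟨_,
        MvPolynomial.homogeneousComponent_isHomogeneous (n + 1) p, by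
          rw [← MvPolynomial.coe_aeval_eq_eval]; rfl⟩
    have h3 : Q ^ (n + 1) * I ≤ Q ^ (n + 1) := Ideal.mul_le_left
    have h4 := h3 h1
    have h5 := sub_mem h4 (neg_mem h2)
    rwa [sub_neg_eq_add, sub_add_cancel] at h5
  have hfin1 : IsFiniteLength A (A ⧸ I) := isFiniteLength_quotient_of_radical_eq hI
  have hfin2 : IsFiniteLength A (I ⧸ Q.submoduleOf I) := by
    obtain ⟨h1, h2⟩ := isFiniteLength_iff_isNoetherian_isArtinian.1
      (isFiniteLength_quotient_of_radical_eq hQ)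
    exact isFiniteLength_iff_isNoetherian_isArtinian.2
      ⟨isNoetherian_of_injective _ (idealQuotientMap_injective I Q),
        isArtinian_of_injective _ (idealQuotientMap_injective I Q)⟩
  refine ⟨?_, fun W zs h => ?_⟩
  · have : Module.Finite P N := Module.Finite.of_surjective ρ hρs
    exact Module.Finite.of_submodule_quotient (LinearMap.range φ)
  · refine LocallyWeaklyRegular.of_exact φ (LinearMap.range φ).mkQ
      (fun m hm => ⟨1, one_mem W, by rw [one_smul]; exact hφ (hm.trans (map_zero φ).symm)⟩)
      (Submodule.mkQ_surjective _) (LinearMap.exact_map_mkQ_range φ) (h.tensorProduct hfin1) ?_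
    have h1 := (h.tensorProduct hfin2).map (W' := W) (π := RingHom.id P) (f := ρ)
      (fun s hs => hs) (fun y => by
        obtain ⟨x, rfl⟩ := hρs y
        exact ⟨1, one_mem W, x, by rw [map_one, one_smul]⟩)
      (fun n hn => ⟨1, one_mem W, by rw [one_smul]; exact hρi (hn.trans (map_zero ρ).symm)⟩)
    simpa using h1

include hreg hQI ha hmk hker in
/-- If `a` is a regular sequence in `I` and `I ^ 2 = (a) * I`, then the associated graded ring of
`I` is Cohen–Macaulay. -/
theorem isCohenMacaulayRing_of_sq [IsLocalRing A] [IsNoetherianRing A]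
    (hI : I.radical = maximalIdeal A) (hQ : (Ideal.span (Set.range a)).radical = maximalIdeal A) :
    IsCohenMacaulayRing G := by
  let : Algebra (MvPolynomial (Fin d) A) G := (mk.comp (reesEval ha)).toRingHom.toAlgebra
  have : IsScalarTower A (MvPolynomial (Fin d) A) G :=
    IsScalarTower.of_algebraMap_eq fun c => ((mk.comp (reesEval ha)).commutes c).symm
  obtain ⟨h1, h2⟩ := finite_and_locallyWeaklyRegular_of_sq ha hreg hQI hmk hker hI hQ fun _ => rfl
  refine isCohenMacaulayRing_of_locallyWeaklyRegular (fun x hx => ?_) h2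
  rw [← hI] at hx
  obtain ⟨n, hn⟩ := hx
  refine ⟨n, ?_⟩
  rw [← map_pow, ← map_pow]
  change mk (reesEval ha (algebraMap A _ (x ^ n))) = 0
  rw [AlgHom.commutes, hker]
  intro m
  change (C (x ^ n) : A[X]).coeff m ∈ _
  rw [coeff_C]
  split_ifs with h
  · simpa [h] using hn
  · exact zero_mem _

end GoodReductionExact

/-! ### Minimal reductions as parameter ideals -/

section Parameters

open IsLocalRing RingTheory.Sequence

variable {A : Type*} [CommRing A] [IsLocalRing A]

/-- Lists are tested modulo their earlier entries and families here modulo the later ones, hence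
`Fin.rev`. -/
theorem mem_span_image_of_isWeaklyRegular {B : Type*} [CommRing B] {d : ℕ} {a : Fin d → B}
    (h : IsWeaklyRegular B (List.ofFn (a ∘ Fin.rev))) (i : Fin d) {x : B}
    (hx : a i * x ∈ Ideal.span (a '' Set.Ioi i)) : x ∈ Ideal.span (a '' Set.Ioi i) := by
  rw [isWeaklyRegular_iff_Fin] at h
  have h1 := h ⟨i.rev, by simpa using i.rev.2⟩
  have h2 : (Ideal.ofList (List.take i.rev (List.ofFn (a ∘ Fin.rev))) • ⊤ : Submodule B B) =
      Ideal.span (a '' Set.Ioi i) := by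
    rw [smul_eq_mul, Ideal.mul_top, Ideal.ofList]
    congr 1
    ext y
    simp only [Set.mem_ofPred_eq, Set.mem_image, Set.mem_Ioi]
    rw [List.mem_take_iff_getElem]
    constructor
    · rintro ⟨k, hk, rfl⟩
      have hk' : k < i.rev.val ∧ k < d := by
        rw [List.length_ofFn] at hk
        exact ⟨hk.trans_le (min_le_left _ _), hk.trans_le (min_le_right _ _)⟩
      refine ⟨Fin.rev ⟨k, hk'.2⟩, ?_, by simp⟩
      rw [Fin.lt_rev_iff]
      exact hk'.1
    · rintro ⟨j, hj, rfl⟩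
      have hj' : j.rev < i.rev := Fin.rev_lt_rev.2 hj
      refine ⟨j.rev, ?_, ?_⟩
      · rw [List.length_ofFn]
        exact lt_min hj' j.rev.2
      · rw [List.getElem_ofFn]
        exact congrArg a (Fin.rev_rev j)
  have h3 : (List.ofFn (a ∘ Fin.rev))[i.rev.val]'(by simpa using i.rev.2) = a i := by
    rw [List.getElem_ofFn]
    exact congrArg a (Fin.rev_rev i)
  rw [Fin.getElem_fin, h3] at h1
  rw [← h2]
  exact (isSMulRegular_quotient_iff_mem_of_smul_mem _ _).1 h1 x (by rw [h2]; exact hx)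

theorem ringKrullDim_le_of_radical_span_eq [IsNoetherianRing A] {l : ℕ} {a : Fin l → A}
    (h : (Ideal.span (Set.range a)).radical = maximalIdeal A) : ringKrullDim A ≤ l := by
  classical
  rw [← maximalIdeal_height_eq_ringKrullDim]
  have h1 : (maximalIdeal A).height ≤ ((Finset.univ.image a).card : ℕ∞) := by
    refine Ideal.height_le_card_of_mem_minimalPrimes_span_finset ?_
    rw [Finset.coe_image, Finset.coe_univ, Set.image_univ]
    refine ⟨⟨inferInstance, h ▸ Ideal.le_radical⟩, fun q hq _ => ?_⟩
    rw [← h]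
    exact hq.1.radical_le_iff.2 hq.2
  have h2 : (maximalIdeal A).height ≤ (l : ℕ∞) :=
    h1.trans (by exact_mod_cast Finset.card_image_le.trans (by simp))
  exact_mod_cast WithBot.coe_le_coe.2 h2

theorem IsReduction.radical_eq {B : Type*} [CommRing B] {Q I : Ideal B} (h : IsReduction Q I) :
    Q.radical = I.radical := by
  obtain ⟨h1, n, hn⟩ := h
  refine le_antisymm (Ideal.radical_mono h1) ?_
  rw [← Ideal.radical_pow I n.succ_ne_zero, Nat.succ_eq_add_one, hn]
  exact Ideal.radical_mono Ideal.mul_le_left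

/-- Minimal reductions of `𝔪`-primary ideals of a Cohen–Macaulay local ring of dimension `d` are
generated by regular sequences of length `d`. -/
theorem IsMinimalReduction.exists_parameters [Infinite (ResidueField A)]
    (hA : IsCohenMacaulayLocalRing A) {d : ℕ} (hd : ringKrullDim A = d) {Q I : Ideal A}
    (hI : I.radical = maximalIdeal A) (hQ : IsMinimalReduction Q I) :
    ∃ a : Fin d → A, Ideal.span (Set.range a) = Q ∧ IsShortest I a ∧
      ∀ i x, a i * x ∈ Ideal.span (a '' Set.Ioi i) → x ∈ Ideal.span (a '' Set.Ioi i) := by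
  have := hA.1
  obtain ⟨l, a, rfl, ha⟩ := hQ.exists_isShortest
  have hrad := hQ.1.radical_eq.trans hI
  have haI : ∀ i, a i ∈ I := fun i => hQ.1.1 (Ideal.subset_span ⟨i, rfl⟩)
  -- Analytic independence gives `l ≤ d` by counting monomials; Krull's height theorem gives `d ≤
  -- l`.
  have h1 := le_ringKrullDim_of_coeff_mem hI haI fun n p hp h =>
    coeff_mem_maximalIdeal_of_isShortest ha hQ.1 hp h
  have h2 := ringKrullDim_le_of_radical_span_eq hrad
  obtain rfl : l = d := by
    rw [hd] at h1 h2
    exact le_antisymm (by exact_mod_cast h1) (by exact_mod_cast h2)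
  refine ⟨a, rfl, ha, fun i x => mem_span_image_of_isWeaklyRegular ?_ i⟩
  obtain ⟨xs, hxs, hreg, hlen, -⟩ := hA.exists_list
  have hlen' : xs.length = l := by
    rw [hd] at hlen
    exact_mod_cast hlen
  refine isWeaklyRegular_of_isWeaklyRegular hreg.toIsWeaklyRegular hxs (fun b hb => ?_)
    (by simp [hlen']) fun q hq h => ?_
  · obtain ⟨i, rfl⟩ := (List.mem_ofFn' _ _).1 hb
    rw [← hI]
    exact Ideal.le_radical (haI _)
  · have h3 : maximalIdeal A ≤ q := by
      rw [← hrad]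
      refine hq.radical_le_iff.2 (Ideal.span_le.2 ?_)
      rintro _ ⟨i, rfl⟩
      exact h (Ideal.subset_span ((List.mem_ofFn' _ _).2 ⟨i.rev, by simp⟩))
    exact ((maximalIdeal.isMaximal A).eq_of_le hq.ne_top h3).symm

end Parameters

/-! ### Removing a localization from graded modules -/

section GradedNakayama

open scoped Pointwise
open RingTheory.Sequence

variable {A R : Type*} [CommRing A] [CommRing R] [Algebra A R] {𝒜 : ℕ → Submodule A R}

/-- Multiplication by `e` strictly raises degrees and the degrees are bounded below, so `y = e • y`
has no lowest component. -/
theorem GradedProj.eq_zero_of_smul_eq {N : Type*} [AddCommGroup N] [Module R N]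
    {𝒩 : ℤ → AddSubgroup N} (P : GradedProj 𝒩) (hsm : GradedSMul 𝒜 𝒩) (hneg : ∀ n < 0, 𝒩 n = ⊥)
    {e : R} (he : e ∈ AddSubmonoid.closure {x | ∃ n : ℕ, 0 < n ∧ x ∈ 𝒜 n}) {y : N}
    (hy : e • y = y) : y = 0 := by
  have step : ∀ k : ℤ, (∀ m < k, P.proj m y = 0) → ∀ m ≤ k, P.proj m (e • y) = 0 := by
    intro k hk m hm
    clear hy
    induction he using AddSubmonoid.closure_induction with
    | mem z hz =>
      obtain ⟨l, hl, hz⟩ := hz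
      have h1 := P.map_proj P (DistribSMul.toAddMonoidHom N z) l
        (fun n m hm => hsm l n z hz m hm) (m - l) y
      simp only [DistribSMul.toAddMonoidHom_apply, sub_add_cancel] at h1
      rw [← h1, hk _ (by omega), smul_zero]
    | zero => rw [zero_smul, map_zero]
    | add x x' _ _ hx hx' => rw [add_smul, map_add, hx, hx', add_zero]
  have key : ∀ k : ℕ, ∀ m < (k : ℤ), P.proj m y = 0 := by
    intro k
    induction k with
    | zero =>
      intro m hm
      have := P.proj_mem m y
      rwa [hneg m (by simpa using hm), AddSubgroup.mem_bot] at this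
    | succ k ih =>
      intro m hm
      rw [← hy]
      exact step k ih m (by push_cast at hm; omega)
  obtain ⟨F, hF⟩ := P.exists_sum y
  rw [hF]
  exact Finset.sum_eq_zero fun n _ => key (n.toNat + 1) n (by push_cast; omega)

/-- A homogeneous sequence that is weakly regular on a graded module after inverting elements that
are units modulo elements of positive degree is weakly regular. -/
theorem LocallyWeaklyRegular.isWeaklyRegular_of_graded {W : Submonoid R} {N : Type*}
    [AddCommGroup N] [Module R N] {𝒩 : ℤ → AddSubgroup N} (P : GradedProj 𝒩)
    (hsm : GradedSMul 𝒜 𝒩) (hneg : ∀ n < 0, 𝒩 n = ⊥)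
    (hW : ∀ w ∈ W, ∃ v : R, 1 - v * w ∈ AddSubmonoid.closure {x | ∃ n : ℕ, 0 < n ∧ x ∈ 𝒜 n})
    {xs : List R} (hxs : ∀ x ∈ xs, ∃ l, x ∈ 𝒜 l) (h : LocallyWeaklyRegular W xs N) :
    IsWeaklyRegular N xs := by
  induction xs generalizing N with
  | nil => exact IsWeaklyRegular.nil _ _
  | cons x xs ih =>
    refine (isWeaklyRegular_cons_iff _ _ _).2 ⟨isSMulRegular_iff_right_eq_zero_of_smul.2
      fun n hn => ?_, ?_⟩
    · obtain ⟨w, hw, hwn⟩ := h.1 n hn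
      obtain ⟨v, hv⟩ := hW w hw
      exact P.eq_zero_of_smul_eq hsm hneg hv (by rw [sub_smul, one_smul, mul_smul, hwn, smul_zero,
        sub_zero])
    · obtain ⟨l, hl⟩ := hxs x List.mem_cons_self
      obtain ⟨P'⟩ := P.quotSMulTop hsm hl
      refine ih P' (hsm.quotSMulTop x) (fun n hn => ?_)
        (fun y hy => hxs y (List.mem_cons_of_mem _ hy)) h.2
      rw [quotSMulTopPiece, hneg n hn, AddSubgroup.map_bot]

end GradedNakayama

/-! ### The Rees algebra localized at its graded maximal ideal -/

section ReesLocal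

open IsLocalRing RingTheory.Sequence

variable {A : Type*} [CommRing A] [IsLocalRing A] (I : Ideal A)

/-- The map from the Rees algebra to the residue field that kills the elements of positive
degree. -/
noncomputable def reesResidue : reesAlgebra I →+* ResidueField A :=
  (residue A).comp (constantCoeff.comp (reesAlgebra I).val.toRingHom)

variable {I}

theorem mem_ker_reesResidue {x : reesAlgebra I} :
    x ∈ RingHom.ker (reesResidue I) ↔ (x : A[X]).coeff 0 ∈ maximalIdeal A := by
  rw [RingHom.mem_ker, ← residue_eq_zero_iff]
  rfl

omit [IsLocalRing A] in
theorem coeff_zero_mul (x y : reesAlgebra I) :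
    ((x * y : reesAlgebra I) : A[X]).coeff 0 = (x : A[X]).coeff 0 * (y : A[X]).coeff 0 := by
  rw [Subalgebra.coe_mul, mul_coeff_zero]

/-- When `k` factors contribute to a degree `n < k`, at least one contributes its constant
coefficient, which lies in `𝔪`. -/
theorem coeff_mem_of_mem_ker_reesResidue_pow {k : ℕ} {x : reesAlgebra I}
    (hx : x ∈ RingHom.ker (reesResidue I) ^ k) :
    ∀ n < k, (x : A[X]).coeff n ∈ maximalIdeal A * I ^ n := by
  induction k generalizing x with
  | zero => intro n hn; omega
  | succ k ih =>
    rw [pow_succ] at hx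
    refine Submodule.mul_induction_on hx (fun y hy z hz n hn => ?_) fun y z hy hz n hn => ?_
    · rw [Subalgebra.coe_mul, coeff_mul]
      refine sum_mem fun ij hij => ?_
      rw [Finset.HasAntidiagonal.mem_antidiagonal] at hij
      rw [← hij, pow_add]
      by_cases h : ij.1 < k
      · rw [← mul_assoc]
        exact Ideal.mul_mem_mul (ih hy _ h) (coeff_mem z _)
      · rw [mul_left_comm]
        refine Ideal.mul_mem_mul (coeff_mem y _) ?_
        have h0 : ij.2 = 0 := by omega
        rw [h0, pow_zero, mul_one]
        exact mem_ker_reesResidue.1 hz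
    · rw [Subalgebra.coe_add, coeff_add]
      exact add_mem (hy n hn) (hz n hn)

theorem map_le_ker_reesResidue (hI : I ≤ maximalIdeal A) :
    I.map (algebraMap A (reesAlgebra I)) ≤ RingHom.ker (reesResidue I) := fun x hx => by
  rw [mem_ker_reesResidue]
  exact hI (by simpa using mem_map_algebraMap_iff.1 hx 0)

theorem reesMaximalIdeal_le_ker_reesResidue : reesMaximalIdeal I ≤ RingHom.ker (reesResidue I) := by
  refine sup_le (Ideal.map_le_iff_le_comap.2 fun c hc => ?_) (Ideal.span_le.2 ?_)
  · rw [Ideal.mem_comap, mem_ker_reesResidue]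
    change (C c : A[X]).coeff 0 ∈ _
    rwa [coeff_C_zero]
  · rintro x ⟨n, hn, hx⟩
    obtain ⟨c, hc, rfl⟩ := mem_reesPiece.1 hx
    rw [SetLike.mem_coe, mem_ker_reesResidue]
    change (monomial n c).coeff 0 ∈ _
    rw [coeff_monomial, if_neg hn.ne']
    exact zero_mem _

variable {d : ℕ} {a : Fin d → A} (ha : ∀ i, a i ∈ I)

/-- The elements `a i * t` of the Rees algebra. -/
noncomputable def reesLinear (i : Fin d) : reesAlgebra I := reesMonomial I 1 (a i) (by simpa using ha i)

omit [IsLocalRing A] in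
theorem reesMonomial_pow (n : ℕ) (c : A) (hc : c ∈ I ^ n) (k : ℕ) : reesMonomial I n c hc ^ k =
    reesMonomial I (n * k) (c ^ k) (by rw [pow_mul]; exact Ideal.pow_mem_pow hc k) :=
  Subtype.ext ((SubmonoidClass.coe_pow _ _).trans (monomial_pow n _ k))

omit [IsLocalRing A] in
theorem reesMonomial_mem_span_reesLinear {n : ℕ} {c : A}
    (hc : c ∈ Ideal.span (Set.range a) * I ^ n) :
    ∃ hc' : c ∈ I ^ (n + 1), reesMonomial I (n + 1) c hc' ∈
      Ideal.span (Set.range (reesLinear ha)) := by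
  refine Submodule.mul_induction_on hc (fun q hq b hb => ?_) ?_
  · obtain ⟨y, rfl⟩ := Ideal.mem_span_range_iff_exists_fun.1 hq
    have h1 : (∑ i, y i * a i) * b ∈ I ^ (n + 1) := by
      rw [pow_succ']
      exact Ideal.mul_mem_mul (sum_mem fun i _ => Ideal.mul_mem_left _ _ (ha i)) hb
    refine ⟨h1, ?_⟩
    have h2 : reesMonomial I (n + 1) _ h1 = ∑ i, reesMonomial I n (y i * b)
        (Ideal.mul_mem_left _ _ hb) * reesLinear ha i := by
      refine Subtype.ext ?_
      rw [AddSubmonoidClass.coe_finsetSum]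
      change monomial (n + 1) _ = ∑ i, monomial n (y i * b) * monomial 1 (a i)
      simp only [monomial_mul_monomial]
      rw [← map_sum, Finset.sum_mul]
      congr 1
      exact Finset.sum_congr rfl fun i _ => by ring
    rw [h2]
    exact sum_mem fun i _ => Ideal.mul_mem_left _ _ (Ideal.subset_span ⟨i, rfl⟩)
  · rintro x y ⟨hx, hx'⟩ ⟨hy, hy'⟩
    refine ⟨add_mem hx hy, ?_⟩
    have : reesMonomial I (n + 1) (x + y) (add_mem hx hy) =
        reesMonomial I (n + 1) x hx + reesMonomial I (n + 1) y hy :=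
      Subtype.ext (map_add (monomial (n + 1)) x y)
    rw [this]
    exact add_mem hx' hy'

/-- It suffices to treat monomials. In degree zero a power lies in `I`; in positive degree the power
`N + 1` brings in `I ^ (N + 1) = Q I ^ N`. -/
theorem ker_reesResidue_le_radical (hI : I.radical = maximalIdeal A)
    (hred : IsReduction (Ideal.span (Set.range a)) I) :
    RingHom.ker (reesResidue I) ≤ (Ideal.span (Set.range (reesLinear ha)) ⊔
      I.map (algebraMap A (reesAlgebra I))).radical := by
  intro x hx
  rw [mem_ker_reesResidue] at hx
  rw [reesAlgebra_eq_sum x]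
  refine sum_mem fun n _ => ?_
  have hc := coeff_mem x n
  rcases n with _ | n
  · rw [← hI] at hx
    obtain ⟨k, hk⟩ := hx
    refine ⟨k, Ideal.mem_sup_right ?_⟩
    rw [reesMonomial_pow]
    exact Ideal.Quotient.eq_zero_iff_mem.1 (reesMk_reesMonomial_eq_zero.2 (by simpa using hk))
  · obtain ⟨-, N, hN⟩ := hred
    refine ⟨N + 1, Ideal.mem_sup_left ?_⟩
    rw [reesMonomial_pow]
    have h1 : (x : A[X]).coeff (n + 1) ^ (N + 1) ∈ Ideal.span (Set.range a) * I ^ (N + n * (N + 1)) := by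
      have h2 := Ideal.pow_mem_pow hc (N + 1)
      rwa [← pow_mul, show (n + 1) * (N + 1) = (N + 1) + n * (N + 1) by ring, pow_add, hN, mul_assoc,
        ← pow_add] at h2
    obtain ⟨h2, h3⟩ := reesMonomial_mem_span_reesLinear ha h1
    convert h3 using 2
    ring

section Localization

variable {B : Type*} [CommRing B] [IsLocalRing B] [IsNoetherianRing B]
  {π : reesAlgebra I →+* B}

-- The ring `B` stands for the localization of `G` at the graded maximal ideal, described by `h1`,
-- `h2` and `h3`. The monomial count is applied to the images of the `a i * t`: a relation over `B`
-- is approximated by a form `p` over `A`, and its degree `n` part shows `p(a) ∈ 𝔪 I^n`.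
include ha in
theorem le_ringKrullDim_of_reesAlgebra (hI : I ≤ maximalIdeal A)
    (hcoeff : ∀ (n : ℕ) (p : MvPolynomial (Fin d) A), p.IsHomogeneous n →
      MvPolynomial.aeval a p ∈ maximalIdeal A * I ^ n → ∀ α, p.coeff α ∈ maximalIdeal A)
    (h1 : (RingHom.ker (reesResidue I)).map π = maximalIdeal B)
    (h2 : ∀ b : B, ∃ c : A, b - π (algebraMap A _ c) ∈ maximalIdeal B)
    (h3 : ∀ (z : reesAlgebra I) (K : Ideal (reesAlgebra I)),
      I.map (algebraMap A (reesAlgebra I)) ≤ K → π z ∈ K.map π →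
      ∃ u ∉ RingHom.ker (reesResidue I), u * z ∈ K) :
    (d : WithBot ℕ∞) ≤ ringKrullDim B := by
  have hmem : ∀ x ∈ RingHom.ker (reesResidue I), π x ∈ maximalIdeal B := fun x hx =>
    h1 ▸ Ideal.mem_map_of_mem π hx
  have hlin : ∀ i, reesLinear ha i ∈ RingHom.ker (reesResidue I) := fun i => by
    rw [mem_ker_reesResidue]
    change (monomial 1 (a i)).coeff 0 ∈ _
    rw [coeff_monomial, if_neg one_ne_zero]
    exact zero_mem _
  refine le_ringKrullDim_of_coeff_mem (J := maximalIdeal B) (a := fun i => π (reesLinear ha i))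
    (Ideal.IsPrime.radical inferInstance) (fun i => hmem _ (hlin i)) fun n P hP hPn α => ?_
  choose σ hσ using h2
  let p : MvPolynomial (Fin d) A := ∑ β ∈ P.support, MvPolynomial.monomial β (σ (P.coeff β))
  have hp : p.IsHomogeneous n := MvPolynomial.IsHomogeneous.sum _ _ _ fun β hβ =>
    MvPolynomial.isHomogeneous_monomial _ (by
      rw [← hP (MvPolynomial.mem_support_iff.1 hβ), Finsupp.weight_apply, Finsupp.degree_apply]
      simp [Finsupp.sum])
  have hpc : ∀ β, p.coeff β = if β ∈ P.support then σ (P.coeff β) else 0 := fun β => by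
    rw [MvPolynomial.coeff_sum]
    simp only [MvPolynomial.coeff_monomial]
    rw [Finset.sum_ite_eq']
  have hdiff : ∀ β, (P - MvPolynomial.map (π.comp (algebraMap A _)) p).coeff β ∈ maximalIdeal B :=
    fun β => by
      rw [MvPolynomial.coeff_sub, MvPolynomial.coeff_map, hpc]
      split_ifs with h
      · exact hσ _
      · rw [MvPolynomial.notMem_support_iff.1 h, map_zero, sub_zero]
        exact zero_mem _
  have h4 := aeval_mem_mul_pow (Q := maximalIdeal B) (fun i => hmem _ (hlin i))
    (hP.sub (hp.map _)) hdiff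
  rw [map_sub] at h4
  have h5 : MvPolynomial.aeval (fun i => π (reesLinear ha i))
      (MvPolynomial.map (π.comp (algebraMap A _)) p) = π (reesEval ha p) := by
    rw [MvPolynomial.aeval_def, MvPolynomial.eval₂_map, reesEval, MvPolynomial.aeval_def,
      MvPolynomial.eval₂_comp_left]
    rfl
  rw [h5, Submodule.sub_mem_iff_right _ hPn, ← pow_succ', ← h1, ← Ideal.map_pow] at h4
  obtain ⟨u, hu, huz⟩ := h3 _ (RingHom.ker (reesResidue I) ^ (n + 1) ⊔ I.map (algebraMap A _))
    le_sup_right (Ideal.map_mono le_sup_left h4)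
  -- The coefficient of `t ^ n` is compared: elements of the power `n + 1` of the maximal ideal have
  -- it in `𝔪 I^n`, and those of `I𝓡` in `I ^ (n + 1)`.
  have h6 : (u : A[X]).coeff 0 * MvPolynomial.aeval a p ∈ maximalIdeal A * I ^ n := by
    obtain ⟨y, hy, z, hz, hyz⟩ := Submodule.mem_sup.1 huz
    have h7 : ((u * reesEval ha p : reesAlgebra I) : A[X]).coeff n =
        (u : A[X]).coeff 0 * MvPolynomial.aeval a p := by
      rw [Subalgebra.coe_mul, coe_reesEval_of_isHomogeneous ha hp]
      simpa using coeff_mul_monomial (u : A[X]) n 0 (MvPolynomial.aeval a p)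
    rw [← h7, ← hyz, Subalgebra.coe_add, coeff_add]
    refine add_mem (coeff_mem_of_mem_ker_reesResidue_pow hy n n.lt_succ_self) ?_
    have h8 := mem_map_algebraMap_iff.1 hz n
    rw [pow_succ'] at h8
    exact Ideal.mul_mono_left hI h8
  have hu' : IsUnit ((u : A[X]).coeff 0) := by
    rw [mem_ker_reesResidue] at hu
    simpa using hu
  have h9 := hcoeff n p hp ((Ideal.unit_mul_mem_iff_mem _ hu').1 h6) α
  by_cases hα : α ∈ P.support
  · rw [hpc, if_pos hα] at h9
    have h10 : π (algebraMap A _ (σ (P.coeff α))) ∈ maximalIdeal B := by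
      refine hmem _ (mem_ker_reesResidue.2 ?_)
      change (C _ : A[X]).coeff 0 ∈ _
      rwa [coeff_C_zero]
    exact (Submodule.sub_mem_iff_left _ h10).1 (hσ _)
  · rw [MvPolynomial.notMem_support_iff.1 hα]
    exact zero_mem _

theorem isWeaklyRegular_map_reesLinear (hB : IsCohenMacaulayLocalRing B)
    (hI : I.radical = maximalIdeal A) (hred : IsReduction (Ideal.span (Set.range a)) I)
    (hcoeff : ∀ (n : ℕ) (p : MvPolynomial (Fin d) A), p.IsHomogeneous n →
      MvPolynomial.aeval a p ∈ maximalIdeal A * I ^ n → ∀ α, p.coeff α ∈ maximalIdeal A)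
    (h0 : ∀ x ∈ I.map (algebraMap A (reesAlgebra I)), π x = 0)
    (h1 : (RingHom.ker (reesResidue I)).map π = maximalIdeal B)
    (h2 : ∀ b : B, ∃ c : A, b - π (algebraMap A _ c) ∈ maximalIdeal B)
    (h3 : ∀ (z : reesAlgebra I) (K : Ideal (reesAlgebra I)),
      I.map (algebraMap A (reesAlgebra I)) ≤ K → π z ∈ K.map π →
      ∃ u ∉ RingHom.ker (reesResidue I), u * z ∈ K) :
    IsWeaklyRegular B ((List.ofFn (reesLinear ha)).map π) := by
  have hdim := le_ringKrullDim_of_reesAlgebra ha (hI ▸ Ideal.le_radical) hcoeff h1 h2 h3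
  obtain ⟨xs, hxs, hreg, hlen, -⟩ := hB.exists_list
  rw [← hlen] at hdim
  refine isWeaklyRegular_of_isWeaklyRegular hreg.toIsWeaklyRegular hxs (fun b hb => ?_)
    (by rw [List.length_map, List.length_ofFn]; exact_mod_cast hdim) fun q hq hbq => ?_
  · obtain ⟨x, hx, rfl⟩ := List.mem_map.1 hb
    obtain ⟨i, rfl⟩ := (List.mem_ofFn' _ _).1 hx
    rw [← h1]
    refine Ideal.mem_map_of_mem π (mem_ker_reesResidue.2 ?_)
    change (monomial 1 (a i)).coeff 0 ∈ _
    rw [coeff_monomial, if_neg one_ne_zero]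
    exact zero_mem _
  · refine ((maximalIdeal.isMaximal B).eq_of_le hq.ne_top ?_).symm
    rw [← h1, Ideal.map_le_iff_le_comap]
    refine (ker_reesResidue_le_radical ha hI hred).trans
      ((hq.comap π).radical_le_iff.2 (sup_le (Ideal.span_le.2 ?_) fun x hx => ?_))
    · rintro _ ⟨i, rfl⟩
      exact hbq (Ideal.subset_span (List.mem_map.2 ⟨_, (List.mem_ofFn' _ _).2 ⟨i, rfl⟩, rfl⟩))
    · rw [Ideal.mem_comap, h0 x hx]
      exact zero_mem _

end Localization

end ReesLocal

/-! ### The elements `at` form a regular sequence on a Cohen–Macaulay `G` -/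

section AssocGradedLocal

open IsLocalRing RingTheory.Sequence

variable {A : Type*} [CommRing A] [IsLocalRing A] {I : Ideal A}

instance : (RingHom.ker (reesResidue I)).IsPrime := RingHom.ker_isPrime _

omit [IsLocalRing A] in
theorem ker_reesMk : RingHom.ker (reesMk I) = I.map (algebraMap A (reesAlgebra I)) :=
  Ideal.ext fun _ => Ideal.Quotient.eq_zero_iff_mem

theorem exists_one_sub_mul_mem_closure {w : reesAlgebra I} (hw : w ∉ RingHom.ker (reesResidue I)) :
    ∃ v : reesAlgebra I, 1 - v * w ∈ AddSubmonoid.closure {x | ∃ n : ℕ, 0 < n ∧ x ∈ reesPiece I n} := by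
  rw [mem_ker_reesResidue] at hw
  obtain ⟨u, hu⟩ : IsUnit ((w : A[X]).coeff 0) := by simpa using hw
  refine ⟨algebraMap A _ (↑u⁻¹), ?_⟩
  set e := 1 - algebraMap A (reesAlgebra I) (↑u⁻¹) * w with he
  have h0 : (e : A[X]).coeff 0 = 0 := by
    rw [he, Subalgebra.coe_sub, coeff_sub, coeff_zero_mul, ← hu]
    change (1 : A[X]).coeff 0 - (C (↑u⁻¹ : A)).coeff 0 * _ = 0
    simp
  rw [reesAlgebra_eq_sum e]
  refine sum_mem fun n hn => AddSubmonoid.subset_closure ⟨n, ?_, reesMonomial_mem _ _ _⟩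
  rw [mem_support_iff] at hn
  exact Nat.pos_of_ne_zero (by rintro rfl; exact hn h0)

variable {d : ℕ} {a : Fin d → A} (ha : ∀ i, a i ∈ I)

theorem locallyWeaklyRegular_reesLinear {G : Type*} [CommRing G] [Module (reesAlgebra I) G]
    {mk : reesAlgebra I →+* G} (hmk : Function.Surjective mk)
    (hker : RingHom.ker mk = I.map (algebraMap A (reesAlgebra I)))
    (hsm : ∀ r x : reesAlgebra I, r • mk x = mk (r * x)) (hG : IsCohenMacaulayRing G)
    (hI : I.radical = maximalIdeal A) (hred : IsReduction (Ideal.span (Set.range a)) I)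
    (hcoeff : ∀ (n : ℕ) (p : MvPolynomial (Fin d) A), p.IsHomogeneous n →
      MvPolynomial.aeval a p ∈ maximalIdeal A * I ^ n → ∀ α, p.coeff α ∈ maximalIdeal A) :
    LocallyWeaklyRegular (RingHom.ker (reesResidue I)).primeCompl
      (List.ofFn (reesLinear ha)) G := by
  have hIm : I ≤ maximalIdeal A := hI ▸ Ideal.le_radical
  let ρ : G →+* ResidueField A := RingHom.liftOfSurjective mk hmk ⟨reesResidue I, by
    rw [hker]
    exact map_le_ker_reesResidue hIm⟩
  have hρ : ∀ x, ρ (mk x) = reesResidue I x := fun x =>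
    RingHom.liftOfRightInverse_comp_apply _ _ _ _ x
  let p : Ideal G := RingHom.ker ρ
  have hpmem : ∀ x, mk x ∈ p ↔ x ∈ RingHom.ker (reesResidue I) := fun x => by
    rw [RingHom.mem_ker, RingHom.mem_ker, hρ]
  have : p.IsPrime := RingHom.ker_isPrime _
  let B := Localization.AtPrime p
  have hB : IsCohenMacaulayLocalRing B := hG.2 p
  have := hB.1
  let π : reesAlgebra I →+* B := (algebraMap (G) B).comp (mk)
  have hcomap : p.comap mk = RingHom.ker (reesResidue I) := Ideal.ext hpmem
  have hpm : (RingHom.ker (reesResidue I)).map (mk) = p := by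
    rw [← hcomap, Ideal.map_comap_of_surjective _ hmk]
  have hW : IsWeaklyRegular B ((List.ofFn (reesLinear ha)).map π) := by
    refine isWeaklyRegular_map_reesLinear ha hB hI hred hcoeff (fun x hx => ?_) ?_ (fun b => ?_) ?_
    · change algebraMap _ B (mk x) = 0
      rw [show mk x = 0 from by rwa [← RingHom.mem_ker, hker], map_zero]
    · rw [← Ideal.map_map, hpm]
      exact Localization.AtPrime.map_eq_maximalIdeal
    · obtain ⟨⟨s, t⟩, hst⟩ := IsLocalization.surj p.primeCompl b
      obtain ⟨c, hc⟩ := residue_surjective (ρ s / ρ t)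
      refine ⟨c, ?_⟩
      have ht : ρ t ≠ 0 := t.2
      have h1 : algebraMap _ B (s - mk (algebraMap A _ c) * t) ∈ maximalIdeal B := by
        rw [IsLocalization.AtPrime.to_map_mem_maximal_iff B p, RingHom.mem_ker, map_sub, map_mul,
          hρ]
        have h2 : reesResidue I (algebraMap A _ c) = residue A c := by
          change residue A ((C c : A[X]).coeff 0) = _
          rw [coeff_C_zero]
        rw [h2, hc, div_mul_cancel₀ _ ht, sub_self]
      have h3 : algebraMap _ B (s - mk (algebraMap A _ c) * t) =
          (b - π (algebraMap A _ c)) * algebraMap _ B (t : G) := by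
        rw [map_sub, map_mul, ← hst, sub_mul]
        rfl
      rw [h3] at h1
      exact (Ideal.mul_unit_mem_iff_mem _ (IsLocalization.map_units B t)).1 h1
    · intro z K hK hz
      rw [← Ideal.map_map] at hz
      obtain ⟨m, hm, hmz⟩ :=
        (IsLocalization.algebraMap_mem_map_algebraMap_iff p.primeCompl B _ _).1 hz
      obtain ⟨u, rfl⟩ := hmk m
      refine ⟨u, fun h => hm ((hpmem u).2 h), ?_⟩
      change mk u * mk z ∈ _ at hmz
      rw [← map_mul, Ideal.mem_map_iff_of_surjective _ hmk] at hmz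
      obtain ⟨w, hw, hwz⟩ := hmz
      have : w - u * z ∈ K := hK (by rw [← hker, RingHom.mem_ker, map_sub, hwz, sub_self])
      exact (Submodule.sub_mem_iff_right _ hw).1 this
  let g : G →ₛₗ[π] B :=
    { toFun := algebraMap _ B
      map_add' := map_add _
      map_smul' := fun r x => by
        obtain ⟨x, rfl⟩ := hmk x
        rw [hsm, map_mul, map_mul]
        rfl }
  refine LocallyWeaklyRegular.of_isWeaklyRegular (π := π) (f := g) (fun y => ?_) (fun n hn => ?_) hW
  · obtain ⟨⟨s, t⟩, hst⟩ := IsLocalization.surj p.primeCompl y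
    obtain ⟨u, hu⟩ := hmk (t : G)
    have ht : (t : G) ∉ p := t.2
    rw [← hu, hpmem] at ht
    refine ⟨u, ht, s, ?_⟩
    · change algebraMap _ B (mk u) * y = algebraMap _ B s
      rw [hu, mul_comm]
      exact hst
  · obtain ⟨m, hmn⟩ := (IsLocalization.map_eq_zero_iff p.primeCompl B n).1 hn
    obtain ⟨u, hu⟩ := hmk (m : G)
    obtain ⟨n, rfl⟩ := hmk n
    have hm : (m : G) ∉ p := m.2
    rw [← hu, hpmem] at hm
    refine ⟨u, hm, ?_⟩
    rw [hsm, map_mul, hu]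
    exact hmn

/-- Elements outside the graded maximal ideal have unit constant coefficient, so they are units
modulo positive degree, and graded Nakayama turns regularity in the localization into regularity on
`G`. -/
theorem isWeaklyRegular_reesLinear (hG : IsCohenMacaulayRing (AssocGradedRing I))
    (hI : I.radical = maximalIdeal A) (hred : IsReduction (Ideal.span (Set.range a)) I)
    (hcoeff : ∀ (n : ℕ) (p : MvPolynomial (Fin d) A), p.IsHomogeneous n →
      MvPolynomial.aeval a p ∈ maximalIdeal A * I ^ n → ∀ α, p.coeff α ∈ maximalIdeal A) :
    IsWeaklyRegular (AssocGradedRing I) (List.ofFn (reesLinear ha)) := by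
  have hL := locallyWeaklyRegular_reesLinear (G := AssocGradedRing I) (mk := reesMk I) ha
    reesMk_surjective ker_reesMk smul_assocGraded hG hI
    hred hcoeff
  obtain ⟨P⟩ := nonempty_gradedProj_assocGraded I
  refine hL.isWeaklyRegular_of_graded P assocGraded_gradedSMul
    (fun n hn => assocGradedPieceInt_of_neg hn) (fun w hw => exists_one_sub_mul_mem_closure hw)
    fun x hx => ?_
  obtain ⟨i, rfl⟩ := (List.mem_ofFn' _ _).1 hx
  exact ⟨1, reesMonomial_mem _ _ _⟩

end AssocGradedLocal

/-! ### The socle map and the degrees of local cohomology -/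

section SocleMap

theorem GradedProj.map_eq_map_proj {N H : Type*} [AddCommGroup N] [AddCommGroup H]
    {𝒩 : ℤ → AddSubgroup N} (P : GradedProj 𝒩) {φ : N →+ H} {m : N} {k : ℤ}
    (h : ∀ n ≠ k, φ (P.proj n m) = 0) : φ m = φ (P.proj k m) := by
  obtain ⟨F, hF⟩ := P.exists_sum m
  conv_lhs => rw [hF, map_sum]
  by_cases hk : k ∈ F
  · exact Finset.sum_eq_single_of_mem k hk fun n _ hn => h n hn
  · rw [P.proj_eq_zero hF hk, map_zero]
    exact Finset.sum_eq_zero fun n hn => h n (by rintro rfl; exact hk hn)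

open RingTheory.Sequence

variable {A R : Type*} [CommRing A] [CommRing R] [Algebra A R] {𝒜 : ℕ → Submodule A R}
  [SetLike.GradedMonoid 𝒜] {N : Type*} [AddCommGroup N] [Module R N] {𝒩 : ℤ → AddSubgroup N}
  {r : ℕ} (f : Fin r → R) (hf : ∀ i, ∃ n, f i ∈ 𝒜 n) (P : GradedProj 𝒩) {hsm : GradedSMul 𝒜 𝒩}

theorem exists_socle_map_of_length_eq (hf : ∀ i, ∃ n, f i ∈ 𝒜 n)
    {xs : List R} {p : ℕ} (hp : xs.length = p) (P : GradedProj 𝒩)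
    (hsm : GradedSMul 𝒜 𝒩) (hxs : ∀ x ∈ xs, x ∈ 𝒜 1)
    (hxf : ∀ x ∈ xs, x ∈ (Ideal.span (Set.range f)).radical) (hreg : IsWeaklyRegular N xs)
    (ht : ∀ i, ∀ y : N, ∃ n : ℕ, f i ^ n • y ∈ (Ideal.ofList xs • ⊤ : Submodule R N)) :
    ∃ φ : N →ₗ[R] CechLocalCohomology f N p,
      (∀ m, φ m = 0 ↔ m ∈ (Ideal.ofList xs • ⊤ : Submodule R N)) ∧
      (∀ h, (∃ m, φ m = h) ↔ ∀ x ∈ xs, x • h = 0) ∧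
      ∀ n, ∀ m ∈ 𝒩 n, φ m ∈ cohomologyPiece 𝒜 𝒩 f hsm p (n - p) := by
  subst hp
  obtain ⟨φ, h1, h2, h3⟩ := exists_socle_map f hf xs P hsm hxs hxf hreg fun i y => by
    obtain ⟨y, rfl⟩ := Submodule.mkQ_surjective _ y
    obtain ⟨n, hn⟩ := ht i y
    exact ⟨n, by rwa [← map_smul, Submodule.mkQ_apply, Submodule.Quotient.mk_eq_zero]⟩
  refine ⟨φ.comp (Submodule.mkQ _), fun m => ?_, fun h => ?_, h3⟩
  · rw [LinearMap.comp_apply, map_eq_zero_iff φ h1, Submodule.mkQ_apply, Submodule.Quotient.mk_eq_zero]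
  · rw [← h2]
    constructor
    · rintro ⟨m, rfl⟩
      exact ⟨_, rfl⟩
    · rintro ⟨m, rfl⟩
      obtain ⟨m, rfl⟩ := Submodule.mkQ_surjective _ m
      exact ⟨m, rfl⟩

theorem exists_pow_smul_eq_zero_of_mem_radical {p : ℕ} {x : R}
    (hx : x ∈ (Ideal.span (Set.range f)).radical) (h : CechLocalCohomology f N p) :
    ∃ n : ℕ, x ^ n • h = 0 := by
  obtain ⟨c, rfl⟩ := Submodule.Quotient.mk_surjective _ h
  obtain ⟨n, hn⟩ := exists_pow_smul_mem_range_of_mem_radical f hx ((mem_cechCocycles f).1 c.2).2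
  exact ⟨n, (cechClass_eq_zero f (x ^ n • c)).2 hn⟩

/-- A nonzero homogeneous local cohomology class has a nonzero homogeneous multiple, of at least
the same degree, that is killed by given elements of degree one of the ideal of definition. -/
theorem exists_ne_zero_forall_smul_eq_zero {p : ℕ} {xs : List R} (hxs : ∀ x ∈ xs, x ∈ 𝒜 1)
    (hxf : ∀ x ∈ xs, x ∈ (Ideal.span (Set.range f)).radical) {n : ℤ}
    {h : CechLocalCohomology f N p} (hn : h ∈ cohomologyPiece 𝒜 𝒩 f hsm p n) (h0 : h ≠ 0) :
    ∃ n' ≥ n, ∃ h' ∈ cohomologyPiece 𝒜 𝒩 f hsm p n', h' ≠ 0 ∧ ∀ x ∈ xs, x • h' = 0 := by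
  classical
  induction xs with
  | nil => exact ⟨n, le_rfl, h, hn, h0, by simp⟩
  | cons x xs ih =>
    obtain ⟨n', hn', h', hh', h0', hx'⟩ := ih (fun y hy => hxs y (List.mem_cons_of_mem _ hy))
      fun y hy => hxf y (List.mem_cons_of_mem _ hy)
    have hex := exists_pow_smul_eq_zero_of_mem_radical f (hxf x List.mem_cons_self) h'
    -- `k + 1` is the least exponent with `x ^ (k + 1) • h' = 0`, so `x ^ k • h'` is the multiple
    -- sought.
    obtain ⟨k, hk⟩ := Nat.exists_eq_succ_of_ne_zero (n := Nat.find hex) fun h => by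
      have := Nat.find_spec hex
      rw [h, pow_zero, one_smul] at this
      exact h0' this
    have hpow : x ^ k ∈ 𝒜 k := by
      simpa using SetLike.pow_mem_graded k (hxs x List.mem_cons_self)
    refine ⟨n' + k, by omega, x ^ k • h', smul_mem_cohomologyPiece f hpow hh',
      Nat.find_min hex (hk ▸ k.lt_succ_self), fun y hy => ?_⟩
    rcases List.mem_cons.1 hy with rfl | hy
    · rw [smul_smul, ← pow_succ', ← Nat.succ_eq_add_one, ← hk]
      exact Nat.find_spec hex
    · rw [smul_comm, hx' y hy, smul_zero]

include P hf

theorem eq_zero_of_mem_cohomologyPiece_of_ne {p : ℕ} {m n : ℤ} (hmn : m ≠ n)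
    {h : CechLocalCohomology f N p} (hm : h ∈ cohomologyPiece 𝒜 𝒩 f hsm p m)
    (hn : h ∈ cohomologyPiece 𝒜 𝒩 f hsm p n) : h = 0 :=
  eq_zero_of_mem_cohomologyPiece f P hf (F := {n}) (by simpa using hmn) hm (g := fun _ => h)
    (by simpa using hn) (by simp)

variable {p : ℕ} {φ : N →+ CechLocalCohomology f N p} {k : ℤ}
  (hφ : ∀ n, ∀ m ∈ 𝒩 n, φ m ∈ cohomologyPiece 𝒜 𝒩 f hsm p (n + k))
include hφ

theorem eq_map_proj_of_mem_cohomologyPiece {n : ℤ} {m : N}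
    (hm : φ m ∈ cohomologyPiece 𝒜 𝒩 f hsm p (n + k)) : φ m = φ (P.proj n m) := by
  classical
  obtain ⟨F, hF⟩ := P.exists_sum m
  rw [← sub_eq_zero]
  refine eq_zero_of_mem_cohomologyPiece f P hf (F := (F.erase n).image (· + k)) (n := n + k)
    (by simp) (sub_mem hm (hφ n _ (P.proj_mem n m))) (g := fun j => φ (P.proj (j - k) m))
    (fun j _ => by simpa using hφ (j - k) _ (P.proj_mem (j - k) m)) ?_
  rw [Finset.sum_image (by simp), sub_eq_iff_eq_add]
  simp only [add_sub_cancel_right]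
  by_cases hn : n ∈ F
  · rw [Finset.sum_erase_add _ _ hn, ← map_sum, ← hF]
  · rw [Finset.erase_eq_of_notMem hn, P.proj_eq_zero hF hn, map_zero, add_zero, ← map_sum, ← hF]

theorem map_proj_eq_zero {m : N} (hm : φ m = 0) (n : ℤ) : φ (P.proj n m) = 0 := by
  rw [← eq_map_proj_of_mem_cohomologyPiece f hf P hφ (n := n) (m := m)
    (hm.symm ▸ AddSubgroup.zero_mem _), hm]

/-- A nonzero class of degree `n` has a nonzero multiple of degree at least `n` killed by `xs`. That
multiple is the image under `φ` of an element of degree above `b`, where `φ` vanishes. -/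
theorem cohomologyPiece_eq_bot {xs : List R} (hxs : ∀ x ∈ xs, x ∈ 𝒜 1)
    (hxf : ∀ x ∈ xs, x ∈ (Ideal.span (Set.range f)).radical)
    (hrange : ∀ h : CechLocalCohomology f N p, (∀ x ∈ xs, x • h = 0) → ∃ m, φ m = h) {b : ℤ}
    (hb : ∀ n > b, ∀ m ∈ 𝒩 n, φ m = 0) {n : ℤ} (hn : b + k < n) :
    cohomologyPiece 𝒜 𝒩 f hsm p n = ⊥ := by
  rw [eq_bot_iff]
  intro h hh
  by_contra h0
  obtain ⟨n', hn', h', hh', h0', hx⟩ := exists_ne_zero_forall_smul_eq_zero f hxs hxf hh h0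
  obtain ⟨m, rfl⟩ := hrange h' hx
  refine h0' ?_
  rw [eq_map_proj_of_mem_cohomologyPiece f hf P hφ (n := n' - k) (by rwa [sub_add_cancel])]
  exact hb _ (by omega) _ (P.proj_mem _ _)

end SocleMap

/-! ### The quotient `G/(at)G` degree by degree -/

section AssocGradedSocle

open IsLocalRing RingTheory.Sequence

variable {A : Type*} [CommRing A] {I : Ideal A} {d : ℕ} {a : Fin d → A} (ha : ∀ i, a i ∈ I)

theorem coeff_of_mem_span_reesLinear {z : reesAlgebra I}
    (hz : z ∈ Ideal.span (Set.range (reesLinear ha))) : (z : A[X]).coeff 0 = 0 ∧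
      ∀ n, (z : A[X]).coeff (n + 1) ∈ Ideal.span (Set.range a) * I ^ n := by
  obtain ⟨y, rfl⟩ := Ideal.mem_span_range_iff_exists_fun.1 hz
  rw [AddSubmonoidClass.coe_finsetSum]
  refine ⟨?_, fun n => ?_⟩
  · rw [finsetSum_coeff]
    refine Finset.sum_eq_zero fun i _ => ?_
    rw [coeff_zero_mul]
    change _ * (monomial 1 (a i)).coeff 0 = 0
    rw [coeff_monomial, if_neg one_ne_zero, mul_zero]
  · rw [finsetSum_coeff]
    refine sum_mem fun i _ => ?_
    have h : ((y i * reesLinear ha i : reesAlgebra I) : A[X]).coeff (n + 1) =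
        (y i : A[X]).coeff n * a i := coeff_mul_monomial (y i : A[X]) 1 n (a i)
    rw [h, mul_comm ((y i : A[X]).coeff n)]
    exact Ideal.mul_mem_mul (Ideal.subset_span ⟨i, rfl⟩) (coeff_mem _ n)

/-- The component of `G/(at)G` is thus `A/I` in degree `0` and `I^(n+1) / (Q I^n + I^(n+2))` in
degree `n + 1`. -/
theorem mem_span_reesLinear_sup_iff {w : reesAlgebra I} :
    w ∈ Ideal.span (Set.range (reesLinear ha)) ⊔ I.map (algebraMap A (reesAlgebra I)) ↔
      (w : A[X]).coeff 0 ∈ I ∧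
        ∀ n, (w : A[X]).coeff (n + 1) ∈ Ideal.span (Set.range a) * I ^ n ⊔ I ^ (n + 2) := by
  constructor
  · intro h
    obtain ⟨z, hz, y, hy, rfl⟩ := Submodule.mem_sup.1 h
    obtain ⟨h1, h2⟩ := coeff_of_mem_span_reesLinear ha hz
    rw [mem_map_algebraMap_iff] at hy
    refine ⟨?_, fun n => ?_⟩
    · rw [Subalgebra.coe_add, coeff_add, h1, zero_add]
      simpa using hy 0
    · rw [Subalgebra.coe_add, coeff_add]
      exact Submodule.add_mem_sup (h2 n) (hy (n + 1))
  · rintro ⟨h1, h2⟩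
    rw [reesAlgebra_eq_sum w]
    refine sum_mem fun n _ => ?_
    have hc := coeff_mem w n
    rcases n with _ | n
    · refine Ideal.mem_sup_right ?_
      rw [← ker_reesMk, RingHom.mem_ker, reesMk_reesMonomial_eq_zero]
      simpa using h1
    · obtain ⟨u, hu, v, hv, huv⟩ := Submodule.mem_sup.1 (h2 n)
      obtain ⟨hu', hu''⟩ := reesMonomial_mem_span_reesLinear ha hu
      have hv' : v ∈ I ^ (n + 1) := Ideal.pow_le_pow_right (by omega) hv
      have : reesMonomial I (n + 1) _ hc =
          reesMonomial I (n + 1) u hu' + reesMonomial I (n + 1) v hv' :=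
        Subtype.ext ((congrArg (monomial (n + 1)) huv.symm).trans (map_add _ u v))
      rw [this]
      refine Submodule.add_mem_sup hu'' ?_
      rw [← ker_reesMk, RingHom.mem_ker, reesMk_reesMonomial_eq_zero]
      exact hv

theorem reesMk_mem_ofList_smul_top {w : reesAlgebra I} :
    reesMk I w ∈ (Ideal.ofList (List.ofFn (reesLinear ha)) • ⊤ :
      Submodule (reesAlgebra I) (AssocGradedRing I)) ↔
    w ∈ Ideal.span (Set.range (reesLinear ha)) ⊔ I.map (algebraMap A (reesAlgebra I)) := by
  have hlist : Ideal.ofList (List.ofFn (reesLinear ha)) = Ideal.span (Set.range (reesLinear ha)) := by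
    rw [Ideal.ofList]
    congr 1
    ext x
    exact List.mem_ofFn' _ _
  rw [hlist]
  constructor
  · intro h
    have key : ∃ z ∈ Ideal.span (Set.range (reesLinear ha)), reesMk I w = reesMk I z := by
      refine Submodule.smul_induction_on (p := fun y => ∃ z ∈ Ideal.span (Set.range (reesLinear ha)),
        y = reesMk I z) h (fun r hr y _ => ?_) ?_
      · obtain ⟨y, rfl⟩ := reesMk_surjective y
        exact ⟨r * y, Ideal.mul_mem_right _ _ hr, smul_assocGraded r y⟩
      · rintro _ _ ⟨z, hz, rfl⟩ ⟨z', hz', rfl⟩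
        exact ⟨z + z', add_mem hz hz', (map_add _ _ _).symm⟩
    obtain ⟨z, hz, hwz⟩ := key
    rw [← sub_add_cancel w z, add_comm]
    refine Submodule.add_mem_sup hz ?_
    rw [← ker_reesMk, RingHom.mem_ker, map_sub, hwz, sub_self]
  · intro h
    obtain ⟨z, hz, y, hy, rfl⟩ := Submodule.mem_sup.1 h
    rw [← ker_reesMk, RingHom.mem_ker] at hy
    rw [map_add, hy, add_zero, ← mul_one z, ← smul_assocGraded]
    exact Submodule.smul_mem_smul hz trivial

variable {r : ℕ} (f : Fin r → reesAlgebra I)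

/-- The map from the associated graded ring `G` to its local cohomology that identifies
`G / (a t) G` with the elements killed by the parameters `a t`. -/
theorem exists_assocGraded_socleMap [IsLocalRing A] (hf : ∀ i, ∃ n : ℕ, f i ∈ reesPiece I n)
    (hfspan : Ideal.span (Set.range f) = reesMaximalIdeal I)
    (hI : I.radical = maximalIdeal A) (hred : IsReduction (Ideal.span (Set.range a)) I)
    (hreg : IsWeaklyRegular (AssocGradedRing I) (List.ofFn (reesLinear ha))) :
    ∃ φ : AssocGradedRing I →ₗ[reesAlgebra I] CechLocalCohomology f (AssocGradedRing I) d,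
      (∀ w, φ (reesMk I w) = 0 ↔ (w : A[X]).coeff 0 ∈ I ∧
        ∀ n, (w : A[X]).coeff (n + 1) ∈ Ideal.span (Set.range a) * I ^ n ⊔ I ^ (n + 2)) ∧
      (∀ h, (∃ m, φ m = h) ↔ ∀ i, reesLinear ha i • h = 0) ∧
      ∀ n, ∀ m ∈ assocGradedPieceInt I n, φ m ∈
        cohomologyPiece (reesPiece I) (assocGradedPieceInt I) f assocGraded_gradedSMul d (n - d) := by
  obtain ⟨P⟩ := nonempty_gradedProj_assocGraded I
  have hlin : ∀ i, reesLinear ha i ∈ reesPiece I 1 := fun i => reesMonomial_mem _ _ _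
  have hlist : ∀ {p : reesAlgebra I → Prop}, (∀ x ∈ List.ofFn (reesLinear ha), p x) ↔
      ∀ i, p (reesLinear ha i) := fun {p} =>
    ⟨fun h i => h _ ((List.mem_ofFn' _ _).2 ⟨i, rfl⟩), fun h x hx => by
      obtain ⟨i, rfl⟩ := (List.mem_ofFn' _ _).1 hx
      exact h i⟩
  have hxf : ∀ i, reesLinear ha i ∈ (Ideal.span (Set.range f)).radical := fun i => by
    refine Ideal.le_radical ?_
    rw [hfspan]
    exact Ideal.mem_sup_right (Ideal.subset_span ⟨1, one_pos, hlin i⟩)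
  have ht : ∀ i, ∀ y : AssocGradedRing I, ∃ n : ℕ, f i ^ n • y ∈
      (Ideal.ofList (List.ofFn (reesLinear ha)) • ⊤ :
        Submodule (reesAlgebra I) (AssocGradedRing I)) := fun i y => by
    obtain ⟨y, rfl⟩ := reesMk_surjective y
    have hfi : f i ∈ RingHom.ker (reesResidue I) :=
      reesMaximalIdeal_le_ker_reesResidue (hfspan ▸ Ideal.subset_span ⟨i, rfl⟩)
    obtain ⟨n, hn⟩ := ker_reesResidue_le_radical ha hI hred hfi
    refine ⟨n, ?_⟩
    rw [smul_assocGraded, reesMk_mem_ofList_smul_top]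
    exact Ideal.mul_mem_right _ _ hn
  obtain ⟨φ, h1, h2, h3⟩ := exists_socle_map_of_length_eq (N := AssocGradedRing I) f hf
    (xs := List.ofFn (reesLinear ha)) List.length_ofFn P assocGraded_gradedSMul
    (hlist.2 hlin) (hlist.2 hxf) hreg ht
  refine ⟨φ, fun w => ?_, fun h => ?_, h3⟩
  · rw [← mem_span_reesLinear_sup_iff ha, ← reesMk_mem_ofList_smul_top]
    exact h1 _
  · exact (h2 h).trans (hlist (p := fun x => x • h = 0))

end AssocGradedSocle

/-! ### Goodness in terms of local cohomology -/

section GoodIdeals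

open IsLocalRing RingTheory.Sequence

variable {A : Type*} [CommRing A] {I : Ideal A}

theorem coeff_reesMonomial {n m : ℕ} {c : A} {hc : c ∈ I ^ n} :
    (reesMonomial I n c hc : A[X]).coeff m = if n = m then c else 0 := coeff_monomial

theorem socle_cond_reesMonomial_zero {Q : Ideal A} {c : A} {hc : c ∈ I ^ 0} :
    ((reesMonomial I 0 c hc : A[X]).coeff 0 ∈ I ∧
      ∀ n, (reesMonomial I 0 c hc : A[X]).coeff (n + 1) ∈ Q * I ^ n ⊔ I ^ (n + 2)) ↔ c ∈ I := by
  simp [coeff_reesMonomial]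

theorem socle_cond_reesMonomial_succ {Q : Ideal A} {k : ℕ} {c : A} {hc : c ∈ I ^ (k + 1)} :
    ((reesMonomial I (k + 1) c hc : A[X]).coeff 0 ∈ I ∧
      ∀ n, (reesMonomial I (k + 1) c hc : A[X]).coeff (n + 1) ∈ Q * I ^ n ⊔ I ^ (n + 2)) ↔
      c ∈ Q * I ^ k ⊔ I ^ (k + 2) := by
  simp only [coeff_reesMonomial]
  constructor
  · intro h
    simpa using h.2 k
  · intro h
    refine ⟨by simp, fun n => ?_⟩
    split_ifs with hn
    · obtain rfl : k = n := by omega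
      exact h
    · exact zero_mem _

theorem pow_eq_of_sq {Q : Ideal A} (h : I ^ 2 = Q * I) (k : ℕ) : I ^ (k + 2) = Q * I ^ (k + 1) := by
  rw [add_comm, pow_add, h, mul_assoc, ← pow_succ']

theorem isCohenMacaulayRing_assocGradedRing_of_sq [IsLocalRing A] [IsNoetherianRing A] {d : ℕ}
    {a : Fin d → A} (ha : ∀ i, a i ∈ I)
    (hreg : ∀ i x, a i * x ∈ Ideal.span (a '' Set.Ioi i) → x ∈ Ideal.span (a '' Set.Ioi i))
    (hQI : I ^ 2 = Ideal.span (Set.range a) * I) (hI : I.radical = maximalIdeal A)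
    (hQ : (Ideal.span (Set.range a)).radical = maximalIdeal A) :
    IsCohenMacaulayRing (AssocGradedRing I) :=
  isCohenMacaulayRing_of_sq (G := AssocGradedRing I) (mk := Ideal.Quotient.mkₐ A _) ha hreg hQI
    reesMk_surjective (fun _ => reesMk_eq_zero) hI hQ

variable [IsLocalRing A] [Infinite (ResidueField A)] (hA : IsCohenMacaulayLocalRing A) {d : ℕ}
  (hd : ringKrullDim A = d) (hI : I.radical = maximalIdeal A) {r : ℕ} (f : Fin r → reesAlgebra I)
  (hf : ∀ i, ∃ n : ℕ, f i ∈ reesPiece I n)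
  (hfspan : Ideal.span (Set.range f) = reesMaximalIdeal I)

include hA hd hI hf hfspan

/-- The socle map of `exists_assocGraded_socleMap` for a minimal reduction. -/
theorem IsMinimalReduction.exists_socleMap {Q : Ideal A} (hQ : IsMinimalReduction Q I)
    (hG : I ^ 2 = Q * I ∨ IsCohenMacaulayRing (AssocGradedRing I)) :
    IsCohenMacaulayRing (AssocGradedRing I) ∧ ∃ (xs : List (reesAlgebra I))
      (φ : AssocGradedRing I →ₗ[reesAlgebra I] AssocGradedCohomology I f d),
      (∀ x ∈ xs, x ∈ reesPiece I 1) ∧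
      (∀ w, φ (reesMk I w) = 0 ↔ (w : A[X]).coeff 0 ∈ I ∧
        ∀ n, (w : A[X]).coeff (n + 1) ∈ Q * I ^ n ⊔ I ^ (n + 2)) ∧
      (∀ h, (∃ m, φ m = h) ↔ ∀ x ∈ xs, x • h = 0) ∧
      ∀ n, ∀ m ∈ assocGradedPieceInt I n, φ m ∈ cohomologyPiece (reesPiece I)
        (assocGradedPieceInt I) f assocGraded_gradedSMul d (n + (-d : ℤ)) := by
  have := hA.1
  obtain ⟨a, rfl, hshort, hreg⟩ := hQ.exists_parameters hA hd hI
  have ha : ∀ i, a i ∈ I := fun i => hQ.1.1 (Ideal.subset_span ⟨i, rfl⟩)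
  have hcm : IsCohenMacaulayRing (AssocGradedRing I) := hG.elim
    (fun h => isCohenMacaulayRing_assocGradedRing_of_sq ha hreg h hI (hQ.1.radical_eq.trans hI)) id
  refine ⟨hcm, ?_⟩
  have hw := isWeaklyRegular_reesLinear ha hcm hI hQ.1 fun n p hp h =>
    coeff_mem_maximalIdeal_of_isShortest hshort hQ.1 hp h
  obtain ⟨φ, h1, h2, h3⟩ := exists_assocGraded_socleMap ha f hf hfspan hI hQ.1 hw
  refine ⟨List.ofFn (reesLinear ha), φ, fun x hx => ?_, h1, fun h => (h2 h).trans ?_, h3⟩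
  · obtain ⟨i, rfl⟩ := (List.mem_ofFn' _ _).1 hx
    exact reesMonomial_mem _ _ _
  · constructor
    · intro h' x hx
      obtain ⟨i, rfl⟩ := (List.mem_ofFn' _ _).1 hx
      exact h' i
    · exact fun h' i => h' _ ((List.mem_ofFn' _ _).2 ⟨i, rfl⟩)

omit [Infinite (ResidueField A)] hA hd hI hf hfspan in
theorem reesMonomial_one_mem_reesMaximalIdeal {c : A} (hc : c ∈ I ^ 1) :
    reesMonomial I 1 c hc ∈ reesMaximalIdeal I :=
  Ideal.mem_sup_right (Ideal.subset_span ⟨1, one_pos, reesMonomial_mem _ _ _⟩)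

-- Here `G/(at)G = A/I ⊕ I/Q`, so `H^d` vanishes above degree `1 - d`. It is nonzero in that degree,
-- as `I = Q` would give `Q : I = A`. A socle element is some `φ m`; the degree zero part `c` of `m`
-- satisfies `cI ⊆ Q`, so `c ∈ Q : I = I` and only the degree one part of `m` matters.
set_option maxHeartbeats 800000 in
theorem IsMinimalReduction.aInvariant_and_socle_of_good {Q : Ideal A} (hQ : IsMinimalReduction Q I)
    (hQI : I ^ 2 = Q * I) (hcolon : Q.colon (I : Set A) = I) :
    IsCohenMacaulayRing (AssocGradedRing I) ∧ AssocGradedHasAInvariant I f d (1 - d) ∧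
      ∀ h ∈ socle (reesMaximalIdeal I) (AssocGradedCohomology I f d),
        h ∈ assocGradedCohomologyPiece I f d (1 - d) := by
  obtain ⟨hcm, xs, φ, hxs, h1, h2, h3⟩ :=
    hQ.exists_socleMap hA hd hI f hf hfspan (Or.inl hQI)
  obtain ⟨P⟩ := nonempty_gradedProj_assocGraded I
  have hI2 : Q * I ^ 0 ⊔ I ^ 2 ≤ Q := by
    rw [pow_zero, mul_one, hQI]
    exact sup_le le_rfl Ideal.mul_le_left
  have hpieces : ∀ n > (1 : ℤ), ∀ m ∈ assocGradedPieceInt I n, φ m = 0 := fun n hn m hm => by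
    obtain ⟨k, rfl⟩ : ∃ k : ℕ, n = ((k + 1 + 1 : ℕ) : ℤ) := ⟨(n - 2).toNat, by omega⟩
    obtain ⟨c, hc, rfl⟩ := mem_assocGradedPieceInt_natCast.1 hm
    rw [h1, socle_cond_reesMonomial_succ]
    exact Ideal.mem_sup_left (pow_eq_of_sq hQI k ▸ hc)
  have hmem : ∀ x ∈ xs, x ∈ reesMaximalIdeal I := fun x hx => by
    obtain ⟨c, hc, rfl⟩ := mem_reesPiece.1 (hxs x hx)
    exact reesMonomial_one_mem_reesMaximalIdeal hc
  have hrad : ∀ x ∈ xs, x ∈ (Ideal.span (Set.range f)).radical := fun x hx =>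
    Ideal.le_radical (hfspan ▸ hmem x hx)
  refine ⟨hcm, ⟨?_, fun n hn => ?_⟩, fun h hh => ?_⟩
  · intro hbot
    rw [assocGradedCohomologyPiece_eq] at hbot
    have hle : I ≤ Q := fun c hc => by
      have hc1 : c ∈ I ^ 1 := by rwa [pow_one]
      have h4 := h3 1 _ (mem_assocGradedPieceInt_natCast (n := 1).2 ⟨c, hc1, rfl⟩)
      rw [← sub_eq_add_neg, hbot, AddSubgroup.mem_bot, h1, socle_cond_reesMonomial_succ] at h4
      exact hI2 h4
    have htop : I = ⊤ := by
      rw [← hcolon, Ideal.eq_top_iff_one, Submodule.mem_colon]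
      intro c hc
      rw [one_smul]
      exact hle hc
    rw [htop, Ideal.radical_top] at hI
    exact (maximalIdeal.isMaximal A).ne_top hI.symm
  · by_contra hlt
    refine hn ?_
    rw [assocGradedCohomologyPiece_eq]
    exact cohomologyPiece_eq_bot (φ := φ.toAddMonoidHom) f hf P h3 hxs hrad
      (fun h => (h2 h).2) hpieces (by omega)
  · rw [socle, Submodule.mem_torsionBySet_iff] at hh
    obtain ⟨m, rfl⟩ := (h2 h).2 fun x hx => hh ⟨x, hmem x hx⟩
    have h4 : φ (P.proj 0 m) = 0 := by
      obtain ⟨c, hc, h5⟩ := mem_assocGradedPieceInt_natCast (n := 0).1 (P.proj_mem 0 m)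
      change P.proj 0 m = _ at h5
      rw [h5, h1, socle_cond_reesMonomial_zero, ← hcolon, Submodule.mem_colon]
      intro b hb
      have hb1 : b ∈ I ^ 1 := by rwa [pow_one]
      have h6 := hh ⟨_, reesMonomial_one_mem_reesMaximalIdeal hb1⟩
      change reesMonomial I 1 b hb1 • φ m = 0 at h6
      rw [← map_smul] at h6
      -- The degree one part of `bt • m` is `bt` times the degree zero part of `m`; its vanishing
      -- under `φ` means `b * c ∈ Q`.
      have h7 := map_proj_eq_zero (φ := φ.toAddMonoidHom) f hf P h3 h6 1
      have h8 := P.map_proj P (DistribSMul.toAddMonoidHom _ (reesMonomial I 1 b hb1)) 1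
        (fun n m hm => assocGraded_gradedSMul 1 n _ (reesMonomial_mem 1 b hb1) m hm) 0 m
      simp only [DistribSMul.toAddMonoidHom_apply, zero_add] at h8
      rw [← h8, h5, smul_assocGraded, reesMonomial_mul] at h7
      have h9 := (h1 _).1 h7
      rw [socle_cond_reesMonomial_succ] at h9
      rw [smul_eq_mul, mul_comm]
      exact hI2 h9
    have h5 : φ m = φ (P.proj 1 m) := P.map_eq_map_proj (φ := φ.toAddMonoidHom) fun n hn => by
      rcases lt_or_gt_of_ne hn with hn | hn
      · rcases eq_or_ne n 0 with rfl | hn0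
        · exact h4
        · have h5 := P.proj_mem n m
          rw [assocGradedPieceInt_of_neg (by omega), AddSubgroup.mem_bot] at h5
          rw [h5, map_zero]
      · exact hpieces n hn _ (P.proj_mem n m)
    rw [assocGradedCohomologyPiece_eq, h5]
    exact h3 1 _ (P.proj_mem 1 m)

-- Some power of `𝔪` carries `x` into `I`. With the least such power `k + 1`, a multiple of `x` by
-- an element of `𝔪 ^ k` lying outside `I` is a socle element of `A/I`.
omit [Infinite (ResidueField A)] hd hf hfspan in
theorem exists_mem_colon_notMem {J : Ideal A} (hJ : ¬ J ≤ I) :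
    ∃ x ∈ J, x ∉ I ∧ ∀ c ∈ maximalIdeal A, c * x ∈ I := by
  classical
  have := hA.1
  obtain ⟨x, hx, hxI⟩ := SetLike.not_le_iff_exists.1 hJ
  have hex : ∃ k, ∀ c ∈ maximalIdeal A ^ k, c * x ∈ I := by
    obtain ⟨k, hk⟩ := Ideal.exists_radical_pow_le_of_fg I (IsNoetherian.noetherian _)
    exact ⟨k, fun c hc => Ideal.mul_mem_right _ _ (hk (hI ▸ hc))⟩
  obtain ⟨k, hk⟩ := Nat.exists_eq_succ_of_ne_zero (n := Nat.find hex) fun h => by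
    have := Nat.find_spec hex 1 (by rw [h, pow_zero, Ideal.one_eq_top]; trivial)
    exact hxI (by rwa [one_mul] at this)
  have h1 := Nat.find_min hex (hk ▸ k.lt_succ_self)
  push Not at h1
  obtain ⟨c, hc, hcx⟩ := h1
  refine ⟨c * x, Ideal.mul_mem_left _ _ hx, hcx, fun b hb => ?_⟩
  rw [← mul_assoc]
  refine Nat.find_spec hex _ ?_
  rw [hk, Nat.succ_eq_add_one, pow_succ']
  exact Ideal.mul_mem_mul hb hc

/-- Vanishing in degree `2 - d` yields `I² ⊆ QI + I³`, and Nakayama gives `I² = QI`. An element of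
`Q : I` outside `I` could then be chosen in the socle of `A/I`, and it would produce a nonzero socle
element of `H^d` in degree `-d`. -/
theorem IsMinimalReduction.good_of_aInvariant_of_socle {Q : Ideal A} (hQ : IsMinimalReduction Q I)
    (hG : IsCohenMacaulayRing (AssocGradedRing I)) (ha : AssocGradedHasAInvariant I f d (1 - d))
    (hsoc : ∀ h ∈ socle (reesMaximalIdeal I) (AssocGradedCohomology I f d),
      h ∈ assocGradedCohomologyPiece I f d (1 - d)) :
    I ^ 2 = Q * I ∧ Q.colon (I : Set A) = I := by
  have := hA.1
  obtain ⟨-, xs, φ, hxs, h1, h2, h3⟩ :=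
    hQ.exists_socleMap hA hd hI f hf hfspan (Or.inr hG)
  obtain ⟨P⟩ := nonempty_gradedProj_assocGraded I
  have hIm : I ≤ maximalIdeal A := hI ▸ Ideal.le_radical
  have hQI : I ^ 2 = Q * I := by
    refine le_antisymm ?_ (by rw [sq]; exact Ideal.mul_mono_left hQ.1.1)
    refine Submodule.le_of_le_smul_of_le_jacobson_bot (I := I) (IsNoetherian.noetherian _)
      (hIm.trans (maximalIdeal_le_jacobson _)) fun c hc => ?_
    have h4 := h3 2 _ (mem_assocGradedPieceInt_natCast (n := 2).2 ⟨c, hc, rfl⟩)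
    have h5 : cohomologyPiece (reesPiece I) (assocGradedPieceInt I) f assocGraded_gradedSMul d
        (2 + (-d : ℤ)) = ⊥ := by
      rw [← assocGradedCohomologyPiece_eq]
      by_contra hne
      have := ha.2 hne
      omega
    rw [h5, AddSubgroup.mem_bot, h1, socle_cond_reesMonomial_succ, pow_one] at h4
    rwa [smul_eq_mul, ← pow_succ']
  refine ⟨hQI, le_antisymm ?_ fun x hx => ?_⟩
  · by_contra hle
    obtain ⟨x, hx, hxI, hxm⟩ := exists_mem_colon_notMem hA hI hle
    rw [Submodule.mem_colon] at hx
    have hx0 : x ∈ I ^ 0 := by simp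
    have h4 := h3 0 _ (mem_assocGradedPieceInt_natCast (n := 0).2 ⟨x, hx0, rfl⟩)
    have h5 := hsoc (φ (reesMk I (reesMonomial I 0 x hx0))) (by
      rw [socle, Submodule.mem_torsionBySet_iff]
      rintro ⟨w, hw⟩
      change w • φ _ = 0
      have hw0 := mem_ker_reesResidue.1 (reesMaximalIdeal_le_ker_reesResidue hw)
      rw [← map_smul, smul_assocGraded, h1]
      have h6 : ∀ n, ((w * reesMonomial I 0 x hx0 : reesAlgebra I) : A[X]).coeff n =
          (w : A[X]).coeff n * x := fun n => coeff_mul_monomial (w : A[X]) 0 n x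
      refine ⟨?_, fun n => Ideal.mem_sup_left ?_⟩
      · rw [h6]
        exact hxm _ hw0
      · rw [h6]
        have hc := coeff_mem w (n + 1)
        rcases n with _ | n
        · rw [pow_zero, mul_one, mul_comm]
          exact hx _ (by simpa using hc)
        · rw [← pow_eq_of_sq hQI]
          exact Ideal.mul_mem_right _ _ hc)
    rw [assocGradedCohomologyPiece_eq] at h5
    -- The class has degree `-d` by construction and `1 - d` by the socle hypothesis, so it is zero.
    have h6 := eq_zero_of_mem_cohomologyPiece_of_ne f hf P (by omega) h4 h5
    rw [h1, socle_cond_reesMonomial_zero] at h6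
    exact hxI h6
  · rw [Submodule.mem_colon]
    intro b hb
    have : x * b ∈ I ^ 2 := by
      rw [sq]
      exact Ideal.mul_mem_mul hx hb
    rw [hQI] at this
    exact Ideal.mul_le_left this

end GoodIdeals
theorem mainTheorem8 {A : Type*} [CommRing A] [IsLocalRing A]
    (hA : IsCohenMacaulayLocalRing A) [Infinite (IsLocalRing.ResidueField A)]
    (d : ℕ) (hd : ringKrullDim A = d)
    (I : Ideal A) (hI : I.radical = IsLocalRing.maximalIdeal A)
    {r : ℕ} (f : Fin r → reesAlgebra I) (hf : ∀ i, ∃ n : ℕ, f i ∈ reesPiece I n)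
    (hfspan : Ideal.span (Set.range f) = reesMaximalIdeal I) :
    (IsGoodIdeal I ↔
      IsCohenMacaulayRing (AssocGradedRing I) ∧
      AssocGradedHasAInvariant I f d (1 - d) ∧
      ∀ h ∈ socle (reesMaximalIdeal I) (AssocGradedCohomology I f d),
        h ∈ assocGradedCohomologyPiece I f d (1 - d)) ∧
    (∀ Q : Ideal A, IsMinimalReduction Q I →
      (IsGoodIdeal I ↔ I ^ 2 = Q * I ∧ Q.colon (I : Set A) = I)) := by
  have := hA.1
  -- The right-hand side does not involve `Q`, so the condition holds for all minimal reductions as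
  -- soon as it holds for one.
  have key : ∀ Q : Ideal A, IsMinimalReduction Q I →
      (I ^ 2 = Q * I ∧ Q.colon (I : Set A) = I ↔
        IsCohenMacaulayRing (AssocGradedRing I) ∧ AssocGradedHasAInvariant I f d (1 - d) ∧
        ∀ h ∈ socle (reesMaximalIdeal I) (AssocGradedCohomology I f d),
          h ∈ assocGradedCohomologyPiece I f d (1 - d)) := fun Q hQ =>
    ⟨fun h => hQ.aInvariant_and_socle_of_good hA hd hI f hf hfspan h.1 h.2,
      fun h => hQ.good_of_aInvariant_of_socle hA hd hI f hf hfspan h.1 h.2.1 h.2.2⟩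
  have hgood : IsGoodIdeal I ↔
      IsCohenMacaulayRing (AssocGradedRing I) ∧ AssocGradedHasAInvariant I f d (1 - d) ∧
      ∀ h ∈ socle (reesMaximalIdeal I) (AssocGradedCohomology I f d),
        h ∈ assocGradedCohomologyPiece I f d (1 - d) := by
    constructor
    · rintro ⟨Q, hQ, h⟩
      exact (key Q hQ).1 h
    · intro h
      obtain ⟨Q, hQ⟩ := exists_isMinimalReduction I
      exact ⟨Q, hQ, (key Q hQ).2 h⟩
  exact ⟨hgood, fun Q hQ => hgood.trans (key Q hQ).symm⟩
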